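/- For a domain $\Omega\subset\mathbb C$ let $$c_\Omega(z)=\sup\{|f'(z)| : f:\Omega\to\mathbb D \text{ holomorphic},\ f(z)=0\},\qquad z\in\Omega,$$ be its Carathéodory metric. If $\Omega$ is bounded with $C^\infty$-smooth boundary, let $H^2(b\Omega)$ be the closure in $L^2(b\Omega)$ (with respect to arc length) of the set of boundary traces of holomorphic functions on $\Omega$ that are smooth on $\overline\Omega$, its elements being identified with their holomorphic extensions to $\Omega$. Let $S_\Omega(z,\zeta)$ be the reproducing kernel of $H^2(b\Omega)$ (the Szegő kernel), put $S_\Omega(z)=S_\Omega(z,z)$, and let $$s_\Omega(z)=\sqrt{\frac{\partial^2\log S_\Omega(z)}{\partial z\,\partial\bar z}}$$ be the Szegő metric. The Gaussian curvature of a conformal metric $m(z)|dz|$ is $\kappa_m=-\dfrac{\Delta\log m}{m^2}$. For $r\in(0,1)$ let $A_r=\{z\in\mathbb C: r<|z|<1\}$. Then for every $\lambda\in(0,1)$ the following hold. (a) $c_{A_r}(r^\lambda)=2\pi S_{A_r}(r^\lambda)$ for all $r\in(0,1)$, and $$\lim_{r\to0+}c_{A_r}(r^\lambda)=\lim_{r\to0+}2\pi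 S_{A_r}(r^\lambda)=\begin{cases}1&0<\lambda<\frac12,\\ 2&\lambda=\frac12,\\ +\infty&\frac12<\lambda<1.\end{cases}$$ (b) $$\lim_{r\to0+}s_{A_r}(r^\lambda)=\begin{cases}1&0<\lambda<\frac14,\\ \sqrt2&\lambda=\frac14,\\ +\infty&\frac14<\lambda<1.\end{cases}$$ (c) $$\lim_{r\to0+}\kappa_{c_{A_r}}(r^\lambda)=\begin{cases}-4&0<\lambda<\frac14,\\ -8&\lambda=\frac14,\\ -\infty&\frac14<\lambda<\frac34,\\ -8&\lambda=\frac34,\\ -4&\frac34<\lambda<1.\end{cases}$$ (d) $$\lim_{r\to0+}\kappa_{s_{A_r}}(r^\lambda)=\begin{cases}-4&0<\lambda<\frac16,\\ -12&\lambda=\frac16,\\ -\infty&\frac16<\lambda<\frac13,\\ -4&\lambda=\frac13,\\ 4&\frac13<\lambda<\frac23,\\ -4&\lambda=\frac23,\\ -\infty&\frac23<\lambda<\frac56,\\ -12&\lambda=\frac56,\\ -4&\frac56<\lambda<1.\end{cases}$$ -/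

import Mathlib

open Set Filter Topology MeasureTheory
open scoped ContDiff ENNReal ComplexConjugate Laplacian

noncomputable section

namespace PlanarMetric

/-- The annulus `A_r = {z : r < |z| < 1}`. -/
def annulus (r : ℝ) : Set ℂ := {z | r < ‖z‖ ∧ ‖z‖ < 1}

/-- The arc length measure `ρ dθ` on the circle `|z| = ρ`, as a measure on `ℂ`. -/
def circleArcLength (ρ : ℝ) : Measure ℂ :=
  ENNReal.ofReal ρ •
    (volume.restrict (Ioc (0 : ℝ) (2 * Real.pi))).map (circleMap 0 ρ)

/-- The arc length measure `ds` on the boundary of the annulus `A_r`, which consists of the two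
circles `|z| = r` and `|z| = 1`. -/
def annulusArcLength (r : ℝ) : Measure ℂ := circleArcLength r + circleArcLength 1

/-- The Carathéodory metric
`c_Ω(z) = sup {|f'(z)| : f : Ω → 𝔻 holomorphic, f(z) = 0}`. -/
def caratheodory (Ω : Set ℂ) (z : ℂ) : ℝ :=
  sSup {t : ℝ | ∃ f : ℂ → ℂ, DifferentiableOn ℂ f Ω ∧ MapsTo f Ω (Metric.ball (0 : ℂ) 1) ∧
    f z = 0 ∧ t = ‖deriv f z‖}

/-- `f` is holomorphic on `Ω` and `C^∞`-smooth up to the boundary. -/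
def IsHolSmooth (Ω : Set ℂ) (f : ℂ → ℂ) : Prop :=
  DifferentiableOn ℂ f Ω ∧ ContDiffOn ℝ ∞ f (closure Ω)

/-- The Hardy space `H²(bΩ)`: the closure in `L²(bΩ, ds)` of the set of boundary traces of
holomorphic functions on `Ω` that are smooth on the closure of `Ω`. Here `σ` is the arc length
measure `ds` on the boundary `bΩ`, regarded as a measure on `ℂ` carried by `bΩ`. -/
def hardySpace (Ω : Set ℂ) (σ : Measure ℂ) : Set (Lp ℂ 2 σ) :=
  closure {g : Lp ℂ 2 σ | ∃ f : ℂ → ℂ, IsHolSmooth Ω f ∧ g =ᵐ[σ] f}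

/-- `F` is, on `Ω`, the holomorphic extension of the element `h` of `H²(bΩ)`: there are functions
holomorphic on `Ω` and smooth on its closure whose boundary traces converge to `h` in `L²(bΩ, ds)`
and which converge to `F` locally uniformly on `Ω`. -/
def IsHolExtension (Ω : Set ℂ) (σ : Measure ℂ) (h : Lp ℂ 2 σ) (F : ℂ → ℂ) : Prop :=
  ∃ f : ℕ → ℂ → ℂ, (∀ n, IsHolSmooth Ω (f n)) ∧
    Tendsto (fun n => eLpNorm (fun w => f n w - h w) 2 σ) atTop (𝓝 0) ∧
    TendstoLocallyUniformlyOn f F atTop Ω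

/-- `S` is the Szegő kernel of `Ω`, i.e. the reproducing kernel of `H²(bΩ)`. The element `k ζ` is
the boundary function of `S(·, ζ)`, so that `conj (k z w)` is the value `S(z, w)` for `w ∈ bΩ`. -/
def IsSzegoKernel (Ω : Set ℂ) (σ : Measure ℂ) (S : ℂ → ℂ → ℂ) : Prop :=
  ∃ k : ℂ → Lp ℂ 2 σ,
    (∀ ζ ∈ Ω, k ζ ∈ hardySpace Ω σ ∧ IsHolExtension Ω σ (k ζ) (fun z => S z ζ)) ∧
    (∀ z ∈ Ω, ∀ ζ ∈ Ω, S z ζ = conj (S ζ z)) ∧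
    (∀ h ∈ hardySpace Ω σ, ∀ F : ℂ → ℂ, IsHolExtension Ω σ h F →
      ∀ z ∈ Ω, F z = ∫ w, conj (k z w) * h w ∂σ)

open Classical in
/-- The Szegő kernel `S_Ω(z, ζ)` for `z, ζ ∈ Ω` (its values are relevant only there; it is `0` if
there is no Szegő kernel). -/
def szegoKernel (Ω : Set ℂ) (σ : Measure ℂ) : ℂ → ℂ → ℂ :=
  if h : ∃ S, IsSzegoKernel Ω σ S then h.choose else fun _ _ => 0

/-- The Szegő kernel on the diagonal, `S_Ω(z) = S_Ω(z, z)`, a real number. -/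
def szegoDiag (Ω : Set ℂ) (σ : Measure ℂ) (z : ℂ) : ℝ := (szegoKernel Ω σ z z).re

/-- The Wirtinger derivative `∂/∂z = (∂/∂x - i ∂/∂y) / 2`. -/
def wirtinger (f : ℂ → ℂ) (z : ℂ) : ℂ :=
  (fderiv ℝ f z 1 - Complex.I * fderiv ℝ f z Complex.I) / 2

/-- The conjugate Wirtinger derivative `∂/∂z̄ = (∂/∂x + i ∂/∂y) / 2`. -/
def wirtingerBar (f : ℂ → ℂ) (z : ℂ) : ℂ :=
  (fderiv ℝ f z 1 + Complex.I * fderiv ℝ f z Complex.I) / 2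

/-- The Szegő metric `s_Ω(z) = √(∂² log S_Ω(z) / ∂z ∂z̄)`. -/
def szegoMetric (Ω : Set ℂ) (σ : Measure ℂ) (z : ℂ) : ℝ :=
  √(wirtinger (wirtingerBar fun w => (Real.log (szegoDiag Ω σ w) : ℂ)) z).re

/-- The Gaussian curvature `κ_m = -Δ log m / m²` of the conformal metric `m(z)|dz|`. -/
def gaussCurvature (m : ℂ → ℝ) (z : ℂ) : ℝ :=
  -(Δ (fun w => Real.log (m w))) z / m z ^ 2

/-- The Carathéodory metric of the annulus `A_r`. -/
def cAnn (r : ℝ) : ℂ → ℝ := caratheodory (annulus r)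

/-- The Szegő kernel of the annulus `A_r` on the diagonal. -/
def SAnn (r : ℝ) : ℂ → ℝ := szegoDiag (annulus r) (annulusArcLength r)

/-- The Szegő metric of the annulus `A_r`. -/
def sAnn (r : ℝ) : ℂ → ℝ := szegoMetric (annulus r) (annulusArcLength r)

/-- The point `r ^ l` on the real axis, as a complex number. -/
def pt (r l : ℝ) : ℂ := ((r ^ l : ℝ) : ℂ)

end PlanarMetric

end

/-! Everything reduces to one elliptic function. On the boundary of `annulus q` the monomials zⁿ are
orthogonal with squared norm 2π(1 + q^{2n+1}), so the Szegő kernel should be s(w z̄)/(2π), where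
s(x) = ∑ xⁿ/(1 + q^{2n+1}). Its bilateral Lambert form continues s past |x| = 1 and gives s(q²x) =
-s(x)/q and s(1/x) = -x s(x). Hence F(u) = e^{u/2} s(e^u) is odd, changes sign under u ↦ u + 2 log q
and u ↦ u + 2πi, has a simple pole at 0 and a zero at ω = log q + πi. Liouville's theorem then shows
that F(u) F(u - ω) is constant (`exists_ellF_mul_eq`) and that F'² = F⁴ + βF² - A with explicit A
and β (`deriv_ellF_sq`).

On the boundary w̄ equals 1/w or q²/w, which makes the conjugate of the Szegő kernel S proportional
to the Garabedian kernel L; Cauchy's formula with L becomes the reproducing property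
(`szego_reproducing`). The same relation solves the extremal problem for the Carathéodory metric:
Cauchy's formula for f L² bounds |f'(a)| by 2πS(a,a), and the Ahlfors function S/L, of modulus one
on the boundary, attains the bound (`cAnn_eq`). So c = 2πS = s(|z|²).

These functions are radial. In the variable u = log |z|² the operator ∂∂̄ is |z|⁻² d²/du², and the
differential equation gives (log F)'' = F² + A/F². Therefore the squared Szegő metric is (F² +
A/F²)/|z|², the curvature of c is -4(1 + A/F⁴), and the curvature of the Szegő metric is rational in
F², A and β (`gaussCurvature_sAnn`).

As r → 0 only two terms of the Lambert series survive (`tendsto_lambert`). They give A ~ r, β → 1/4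
and, at the point r^λ with λ < 1/2, s → 1 and F² ~ r^{2λ}. The size of A/F⁴ ~ r^{1-4λ} then decides
(c), and (b) as well for λ < 1/2. In (d) there is a further term: 16βA/F⁶ ~ 4r^{1-6λ} while A/F⁴ →
0, and 16βF⁶/A² ~ 4r^{6λ-2} once A/F⁴ → ∞; these produce the thresholds 1/6 and 1/3. Since F², hence
each curvature, is invariant under λ ↦ 1 - λ, the other half of (c) and (d) follows. -/

noncomputable section

namespace PlanarMetric

/-! ### The bilateral Lambert series `∑ (-q)^k / (1 - x q^{2k})` -/

/-- The general term of the bilateral Lambert series. -/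
def lambertTerm (q : ℝ) (k : ℤ) (x : ℂ) : ℂ := (-(q : ℂ)) ^ k / (1 - x * (q : ℂ) ^ (2 * k))

/-- The bilateral Lambert series `∑ (-q)^k / (1 - x q^{2k})`; for `q² < |x| < 1` its Laurent series
is `∑ xⁿ / (1 + q^{2n+1})`. -/
def lambert (q : ℝ) (x : ℂ) : ℂ := ∑' k : ℤ, lambertTerm q k x

/-- The Lambert series without the term that has its pole at `1`. -/
def lambertReg (q : ℝ) (x : ℂ) : ℂ := ∑' k : ℤ, if k = 0 then 0 else lambertTerm q k x

/-- For k > 0 the denominator is at least 1 - c. For k = -n < 0 it is at least (1 - c)|x|q^{-2n},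
and the gain q^{2n} outweighs the numerator q^{-n}. The two bounds by c keep x away from the
neighbouring poles q⁻² and q². -/
theorem norm_lambertTerm_le {q c : ℝ} (hq0 : 0 < q) (hq1 : q < 1) (hc : c < 1) {x : ℂ} (hx : x ≠ 0)
    (h1 : ‖x‖ * q ^ 2 ≤ c) (h2 : q ^ 2 ≤ c * ‖x‖) {k : ℤ} (hk : k ≠ 0) :
    ‖lambertTerm q k x‖ ≤ (1 + 1 / ‖x‖) / (1 - c) * q ^ k.natAbs := by
  have hx' : 0 < ‖x‖ := norm_pos_iff.2 hx
  have hc' : 0 < 1 - c := by linarith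
  have hn2 : ∀ n : ℕ, 1 ≤ n → q ^ (2 * n) ≤ q ^ 2 := fun n hn =>
    pow_le_pow_of_le_one hq0.le hq1.le (by omega)
  have key : ∀ n : ℕ, ‖(-(q : ℂ)) ^ n‖ = q ^ n := fun n => by
    simp [abs_of_pos hq0]
  obtain ⟨n, rfl | rfl⟩ := Int.eq_nat_or_neg k
  · have hn : 1 ≤ n := by omega
    have hb : 1 - c ≤ ‖1 - x * (q : ℂ) ^ (2 * (n : ℤ))‖ := by
      have h3 : ‖x * (q : ℂ) ^ (2 * (n : ℤ))‖ ≤ c := by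
        have : (q : ℂ) ^ (2 * (n : ℤ)) = (q : ℂ) ^ (2 * n) := by
          rw [← zpow_natCast]; norm_cast
        rw [this, norm_mul, norm_pow, Complex.norm_real, Real.norm_of_nonneg hq0.le]
        exact (mul_le_mul_of_nonneg_left (hn2 n hn) hx'.le).trans h1
      have := norm_sub_norm_le (1 : ℂ) (x * (q : ℂ) ^ (2 * (n : ℤ)))
      rw [norm_one] at this
      linarith
    rw [lambertTerm, norm_div, zpow_natCast, key, Int.natAbs_natCast, div_le_iff₀ (hc'.trans_le hb)]
    have h4 : 0 ≤ 1 / ‖x‖ := by positivity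
    calc q ^ n = 1 / (1 - c) * q ^ n * (1 - c) := by field_simp
      _ ≤ (1 + 1 / ‖x‖) / (1 - c) * q ^ n * ‖1 - x * (q : ℂ) ^ (2 * (n : ℤ))‖ := by
        gcongr
        linarith
  · have hn : 1 ≤ n := by omega
    have hqn : 0 < q ^ (2 * n) := by positivity
    have hb : ‖x‖ / q ^ (2 * n) * (1 - c) ≤ ‖1 - x * (q : ℂ) ^ (2 * (-n : ℤ))‖ := by
      have : (q : ℂ) ^ (2 * (-n : ℤ)) = ((q : ℂ) ^ (2 * n))⁻¹ := by
        rw [← zpow_natCast, ← zpow_neg]; norm_num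
      have h3 : ‖x * (q : ℂ) ^ (2 * (-n : ℤ))‖ = ‖x‖ / q ^ (2 * n) := by
        rw [this, norm_mul, norm_inv, norm_pow, Complex.norm_real, Real.norm_of_nonneg hq0.le]
        rfl
      have h5 := norm_sub_norm_le (x * (q : ℂ) ^ (2 * (-n : ℤ))) 1
      rw [norm_one, h3, norm_sub_rev] at h5
      have h6 : 1 ≤ c * ‖x‖ / q ^ (2 * n) := by
        rw [le_div_iff₀ hqn, one_mul]
        exact (hn2 n hn).trans h2
      have : c * ‖x‖ / q ^ (2 * n) = c * (‖x‖ / q ^ (2 * n)) := by ring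
      nlinarith
    have hpos : 0 < ‖x‖ / q ^ (2 * n) * (1 - c) := by positivity
    rw [lambertTerm, norm_div, zpow_neg, zpow_natCast, norm_inv, key, Int.natAbs_neg,
      Int.natAbs_natCast, div_le_iff₀ (hpos.trans_le hb)]
    calc (q ^ n)⁻¹ = (1 / ‖x‖) / (1 - c) * q ^ n * (‖x‖ / q ^ (2 * n) * (1 - c)) := by
          field_simp
          ring
      _ ≤ (1 + 1 / ‖x‖) / (1 - c) * q ^ n * ‖1 - x * (q : ℂ) ^ (2 * (-n : ℤ))‖ := by
        gcongr
        linarith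

theorem summable_pow_natAbs {q : ℝ} (hq0 : 0 < q) (hq1 : q < 1) :
    Summable fun k : ℤ => q ^ k.natAbs := by
  refine Summable.of_nat_of_neg ?_ ?_ <;>
  simpa using summable_geometric_of_lt_one hq0.le hq1

/-- A majorant that is uniform near x is what the Weierstrass test needs for analyticity of the sum.
-/
theorem exists_norm_lambertTerm_le {q : ℝ} (hq0 : 0 < q) (hq1 : q < 1) {x : ℂ} (h1 : q ^ 2 < ‖x‖)
    (h2 : ‖x‖ * q ^ 2 < 1) : ∃ B : ℝ, ∃ U : Set ℂ, IsOpen U ∧ x ∈ U ∧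
      (∀ w ∈ U, w ≠ 0) ∧ ∀ w ∈ U, ∀ k : ℤ, k ≠ 0 →
        ‖lambertTerm q k w‖ ≤ B * q ^ k.natAbs ∧ 1 - w * (q : ℂ) ^ (2 * k) ≠ 0 := by
  have hx : 0 < ‖x‖ := (by positivity : 0 < q ^ 2).trans h1
  obtain ⟨c, hc1, hc2⟩ : ∃ c, max (‖x‖ * q ^ 2) (q ^ 2 / ‖x‖) < c ∧ c < 1 :=
    exists_between (max_lt h2 ((div_lt_one hx).2 h1))
  obtain ⟨hc3, hc4⟩ := max_lt_iff.1 hc1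
  have hc0 : 0 < c := lt_trans (by positivity) hc3
  refine ⟨(1 + 1 / (q ^ 2 / c)) / (1 - c), {w | ‖w‖ * q ^ 2 < c ∧ q ^ 2 < c * ‖w‖}, ?_, ?_, ?_, ?_⟩
  · exact (isOpen_lt (f := fun w : ℂ => ‖w‖ * q ^ 2) (g := fun _ => c) (by fun_prop)
      (by fun_prop)).inter
      (isOpen_lt (f := fun _ : ℂ => q ^ 2) (g := fun w => c * ‖w‖) (by fun_prop) (by fun_prop))
  · exact ⟨hc3, by rwa [div_lt_iff₀ hx] at hc4⟩
  · rintro w ⟨-, hw⟩ rfl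
    simp at hw
    nlinarith
  · rintro w ⟨hw1, hw2⟩ k hk
    have hw0 : 0 < ‖w‖ := by
      by_contra h
      have : ‖w‖ = 0 := le_antisymm (not_lt.1 h) (norm_nonneg _)
      rw [this] at hw2
      nlinarith [sq_nonneg q]
    have hq2 : 0 < q ^ 2 / c := by positivity
    constructor
    · refine (norm_lambertTerm_le hq0 hq1 hc2 (norm_pos_iff.1 hw0) hw1.le hw2.le hk).trans ?_
      have : q ^ 2 / c ≤ ‖w‖ := by rw [div_le_iff₀ hc0]; linarith
      have : 0 < 1 - c := by linarith
      gcongr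
    · intro h
      have h3 : ‖w * (q : ℂ) ^ (2 * k)‖ = 1 := by
        rw [← sub_eq_zero.1 h, norm_one]
      rw [norm_mul, norm_zpow, Complex.norm_real, Real.norm_of_nonneg hq0.le] at h3
      rcases lt_or_gt_of_ne hk with hk' | hk'
      · have h4 : q ^ (-2 : ℤ) ≤ q ^ (2 * k) :=
          (zpow_right_anti₀ hq0 hq1.le) (by omega)
        have h5 : q ^ (-2 : ℤ) = 1 / q ^ 2 := by
          rw [zpow_neg]; norm_cast; simp
        rw [h5] at h4
        have h6 := mul_le_mul_of_nonneg_left h4 hw0.le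
        rw [h3, mul_one_div, div_le_one (by positivity)] at h6
        nlinarith
      · have h4 : q ^ (2 * k) ≤ q ^ (2 : ℤ) :=
          (zpow_right_anti₀ hq0 hq1.le) (by omega)
        have h5 : q ^ (2 : ℤ) = q ^ 2 := by norm_cast
        rw [h5] at h4
        have h6 := mul_le_mul_of_nonneg_left h4 hw0.le
        rw [h3] at h6
        linarith

theorem analyticAt_lambertReg {q : ℝ} (hq0 : 0 < q) (hq1 : q < 1) {x : ℂ} (h1 : q ^ 2 < ‖x‖)
    (h2 : ‖x‖ * q ^ 2 < 1) : AnalyticAt ℂ (lambertReg q) x := by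
  obtain ⟨B, U, hU, hxU, hU0, hUB⟩ := exists_norm_lambertTerm_le hq0 hq1 h1 h2
  have hBnn : 0 ≤ B := by
    have := (norm_nonneg _).trans (hUB x hxU 1 one_ne_zero).1
    simp only [Int.natAbs_one, pow_one] at this
    exact nonneg_of_mul_nonneg_left this hq0
  have : DifferentiableOn ℂ (lambertReg q) U := by
    refine Complex.differentiableOn_tsum_of_summable_norm
      ((summable_pow_natAbs hq0 hq1).mul_left B) (fun k => ?_) hU (fun k w hw => ?_)
    · split_ifs with hk
      · exact differentiableOn_const _
      · intro w hw
        refine DifferentiableAt.differentiableWithinAt ?_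
        unfold lambertTerm
        exact (differentiableAt_const _).div (by fun_prop) (hUB w hw k hk).2
    · split_ifs with hk
      · simp only [norm_zero]; positivity
      · exact (hUB w hw k hk).1
  exact this.analyticAt (hU.mem_nhds hxU)

theorem lambert_eq {q : ℝ} (hq0 : 0 < q) (hq1 : q < 1) {x : ℂ} (h1 : q ^ 2 < ‖x‖)
    (h2 : ‖x‖ * q ^ 2 < 1) : lambert q x = 1 / (1 - x) + lambertReg q x := by
  obtain ⟨B, U, hU, hxU, hU0, hUB⟩ := exists_norm_lambertTerm_le hq0 hq1 h1 h2
  have hs : Summable fun k : ℤ => lambertTerm q k x := by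
    refine Summable.of_norm_bounded_eventually
      ((summable_pow_natAbs hq0 hq1).mul_left B) ?_
    refine ((finite_singleton (0 : ℤ)).subset ?_)
    intro k hk
    by_contra h
    exact hk (hUB x hxU k h).1
  rw [lambert, hs.tsum_eq_add_tsum_ite 0, lambertReg]
  simp [lambertTerm]

theorem analyticAt_lambert {q : ℝ} (hq0 : 0 < q) (hq1 : q < 1) {x : ℂ} (h1 : q ^ 2 < ‖x‖)
    (h2 : ‖x‖ * q ^ 2 < 1) (hx : x ≠ 1) : AnalyticAt ℂ (lambert q) x := by
  have h3 : AnalyticAt ℂ (fun x => 1 / (1 - x) + lambertReg q x) x :=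
    (analyticAt_const.div (analyticAt_const.sub analyticAt_id)
      (sub_ne_zero.2 hx.symm)).add (analyticAt_lambertReg hq0 hq1 h1 h2)
  refine h3.congr ?_
  filter_upwards [(isOpen_lt continuous_const continuous_norm).mem_nhds h1,
    (isOpen_lt (continuous_norm.mul continuous_const) continuous_const).mem_nhds h2] with w hw1 hw2
  exact (lambert_eq hq0 hq1 hw1 hw2).symm

/-- Shifting the summation index by one absorbs the factor q². The reflection k ↦ -k gives
`lambert_inv` in the same way. -/
theorem lambert_sq_mul {q : ℝ} (hq0 : 0 < q) (x : ℂ) :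
    lambert q (q ^ 2 * x) = -lambert q x / q := by
  have hq : (q : ℂ) ≠ 0 := by exact_mod_cast hq0.ne'
  rw [lambert, lambert, ← (Equiv.subRight (1 : ℤ)).tsum_eq, neg_div, div_eq_mul_inv, ← tsum_mul_right,
    ← tsum_neg]
  congr 1
  ext k
  simp only [Equiv.subRight_apply, lambertTerm]
  rw [zpow_sub₀ (neg_ne_zero.2 hq), mul_sub, zpow_sub₀ hq, zpow_one]
  have : (q : ℂ) ^ 2 * x * ((q : ℂ) ^ (2 * k) / (q : ℂ) ^ ((2 : ℤ) * 1)) = x * (q : ℂ) ^ (2 * k) := by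
    have : (q : ℂ) ^ ((2 : ℤ) * 1) = (q : ℂ) ^ 2 := by norm_cast
    rw [this]; field_simp
  rw [this]
  field_simp

theorem lambert_inv {q : ℝ} (hq0 : 0 < q) {x : ℂ} (hx : x ≠ 0) :
    lambert q x⁻¹ = -x * lambert q x := by
  have hq : (q : ℂ) ≠ 0 := by exact_mod_cast hq0.ne'
  rw [lambert, lambert, ← (Equiv.neg ℤ).tsum_eq, ← tsum_mul_left]
  congr 1
  ext k
  simp only [Equiv.neg_apply, lambertTerm]
  have h1 : (-(q : ℂ)) ^ (-k) * (q : ℂ) ^ (2 * k) = (-(q : ℂ)) ^ k := by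
    have : (q : ℂ) ^ (2 * k) = (-(q : ℂ)) ^ (2 * k) := by
      rw [zpow_mul, zpow_mul]; norm_cast; simp
    rw [this, ← zpow_add₀ (neg_ne_zero.2 hq)]
    congr 1; ring
  have h2 : (q : ℂ) ^ (2 * -k) = ((q : ℂ) ^ (2 * k))⁻¹ := by
    rw [mul_neg, zpow_neg]
  rw [h2, ← h1]
  set y := (q : ℂ) ^ (2 * k) with hy
  have hy0 : y ≠ 0 := zpow_ne_zero _ hq
  have h3 : 1 - x⁻¹ * y⁻¹ = -(1 - x * y) / (x * y) := by field_simp; ring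
  rw [h3, div_div_eq_mul_div, div_neg]
  ring

theorem lambert_conj (q : ℝ) (x : ℂ) : lambert q (conj x) = conj (lambert q x) := by
  rw [lambert, lambert, Complex.conj_tsum]
  congr 1
  ext k
  simp [lambertTerm, map_zpow₀]

/-! ### A Liouville theorem for elliptic functions with removable singularities -/

/-- `H` has a removable singularity at `u` (the value `H u` is irrelevant). -/
def IsRemovable (H : ℂ → ℂ) (u : ℂ) : Prop := ∃ g : ℂ → ℂ, AnalyticAt ℂ g u ∧ H =ᶠ[𝓝[≠] u] g

theorem isRemovable_of_analyticAt {H : ℂ → ℂ} {u : ℂ} (h : AnalyticAt ℂ H u) : IsRemovable H u :=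
  ⟨H, h, EventuallyEq.rfl⟩

theorem tendsto_add_const_punctured (u a : ℂ) :
    Tendsto (fun v => v + a) (𝓝[≠] u) (𝓝[≠] (u + a)) := by
  refine tendsto_nhdsWithin_of_tendsto_nhds_of_eventually_within _ ?_ ?_
  · exact ((continuous_id.add continuous_const).tendsto u).mono_left nhdsWithin_le_nhds
  · filter_upwards [self_mem_nhdsWithin] with v hv h
    exact hv (by simpa using h)

theorem IsRemovable.of_shift {H : ℂ → ℂ} {u a : ℂ} (h : IsRemovable H (u + a))
    (ha : ∀ᶠ v in 𝓝[≠] u, H (v + a) = H v) : IsRemovable H u := by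
  obtain ⟨g, hg, hHg⟩ := h
  refine ⟨fun v => g (v + a), ?_, ?_⟩
  · exact AnalyticAt.fun_comp (f := fun v => v + a) hg (analyticAt_id.add analyticAt_const)
  · filter_upwards [(tendsto_add_const_punctured u a).eventually hHg, ha] with v h1 h2
    rw [← h2, h1]

/-- Punctured limits give a canonical value at every point, so the local analytic extensions of a
function with removable singularities glue together. -/
theorem limUnder_eventuallyEq {H g : ℂ → ℂ} {u : ℂ} (hg : AnalyticAt ℂ g u)
    (h : H =ᶠ[𝓝[≠] u] g) : (fun v => limUnder (𝓝[≠] v) H) =ᶠ[𝓝 u] g := by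
  have key : ∀ v, AnalyticAt ℂ g v → H =ᶠ[𝓝[≠] v] g → limUnder (𝓝[≠] v) H = g v := by
    intro v hv hHv
    refine Tendsto.limUnder_eq ?_
    exact (hv.continuousAt.tendsto.mono_left nhdsWithin_le_nhds).congr' hHv.symm
  have h1 : ∀ᶠ v in 𝓝 u, v ≠ u → H v = g v := eventually_nhdsWithin_iff.1 h
  filter_upwards [hg.eventually_analyticAt, h1.eventually_nhds] with v hv1 hv2
  refine key v hv1 ?_
  by_cases hvu : v = u
  · rw [hvu]; exact h
  · have h3 : ∀ᶠ w in 𝓝 v, w ≠ u := isOpen_ne.mem_nhds hvu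
    refine EventuallyEq.filter_mono ?_ nhdsWithin_le_nhds
    filter_upwards [hv2, h3] with w h4 h5 using h4 h5

/-- Replacing values by punctured limits produces an entire function with the same periods, bounded
by its values on a compact period rectangle, so Liouville applies. Removability is only asked on one
closed period strip, since translation covers the rest. The conclusion is punctured because `H` may
carry junk values at its singularities. -/
theorem exists_const_of_doubly_periodic {H : ℂ → ℂ} {p α : ℝ} (hp : 0 < p)
    (h1 : ∀ u, H (u + p) = H u) (h2 : ∀ u, H (u + 2 * Real.pi * Complex.I) = H u)
    (hrem : ∀ u : ℂ, α ≤ u.re → u.re ≤ α + p → IsRemovable H u) :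
    ∃ c, ∀ u : ℂ, ∀ᶠ v in 𝓝[≠] u, H v = c := by
  have hP1 : Function.Periodic H (p : ℂ) := h1
  have hP2 : Function.Periodic H (2 * Real.pi * Complex.I) := h2
  have hpi := Real.two_pi_pos
  have hreduce : ∀ u : ℂ, ∃ a : ℂ, (∀ v, H (v + a) = H v) ∧
      (α ≤ (u + a).re ∧ (u + a).re ≤ α + p) ∧ (0 ≤ (u + a).im ∧ (u + a).im ≤ 2 * Real.pi) := by
    intro u
    set n := ⌊(u.re - α) / p⌋
    set m := ⌊u.im / (2 * Real.pi)⌋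
    refine ⟨-(n * p) - m * (2 * Real.pi * Complex.I), ?_, ?_, ?_⟩
    · intro v
      rw [← add_sub_assoc, hP2.sub_int_mul_eq, ← sub_eq_add_neg, hP1.sub_int_mul_eq]
    · have e1 := (le_div_iff₀ hp).1 (Int.floor_le ((u.re - α) / p))
      have e2 := (div_lt_iff₀ hp).1 (Int.lt_floor_add_one ((u.re - α) / p))
      have : (u + (-(n * p) - m * (2 * Real.pi * Complex.I))).re = u.re - n * p := by
        simp; ring
      rw [this]
      constructor <;> linarith
    · have e1 := (le_div_iff₀ hpi).1 (Int.floor_le (u.im / (2 * Real.pi)))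
      have e2 := (div_lt_iff₀ hpi).1 (Int.lt_floor_add_one (u.im / (2 * Real.pi)))
      have : (u + (-(n * p) - m * (2 * Real.pi * Complex.I))).im = u.im - m * (2 * Real.pi) := by
        simp; ring
      rw [this]
      constructor <;> linarith
  have hrem' : ∀ u : ℂ, IsRemovable H u := by
    intro u
    obtain ⟨a, ha, hb, -⟩ := hreduce u
    exact (hrem _ hb.1 hb.2).of_shift (Eventually.of_forall ha)
  set K : ℂ → ℂ := fun v => limUnder (𝓝[≠] v) H with hK
  have hKd : Differentiable ℂ K := by
    intro u
    obtain ⟨g, hg, hHg⟩ := hrem' u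
    exact (limUnder_eventuallyEq hg hHg).differentiableAt_iff.2 hg.differentiableAt
  have hKper : ∀ a : ℂ, (∀ v, H (v + a) = H v) → ∀ u, K (u + a) = K u := by
    intro a ha u
    obtain ⟨g, hg, hHg⟩ := hrem' (u + a)
    have e1 : K (u + a) = g (u + a) := (limUnder_eventuallyEq hg hHg).eq_of_nhds
    rw [e1]
    symm
    refine Tendsto.limUnder_eq ?_
    have e2 : Tendsto g (𝓝[≠] (u + a)) (𝓝 (g (u + a))) :=
      hg.continuousAt.tendsto.mono_left nhdsWithin_le_nhds
    have e3 := (e2.congr' hHg.symm).comp (tendsto_add_const_punctured u a)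
    exact e3.congr ha
  have hbdd : Bornology.IsBounded (range K) := by
    have hc : IsCompact (Icc α (α + p) ×ℂ Icc 0 (2 * Real.pi)) :=
      isCompact_Icc.reProdIm isCompact_Icc
    refine (hc.image hKd.continuous).isBounded.subset ?_
    rintro _ ⟨u, rfl⟩
    obtain ⟨a, ha, hb, hb'⟩ := hreduce u
    exact ⟨u + a, ⟨hb, hb'⟩, hKper a ha u⟩
  obtain ⟨c, hc⟩ := hKd.exists_eq_const_of_bounded hbdd
  refine ⟨c, fun u => ?_⟩
  obtain ⟨g, hg, hHg⟩ := hrem' u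
  filter_upwards [hHg, (limUnder_eventuallyEq hg hHg).filter_mono nhdsWithin_le_nhds] with v e1 e2
  have : K v = c := by rw [hc]; rfl
  rw [e1, ← e2, ← this]

/-! ### The elliptic function attached to the Lambert series -/

/-- `F(u) = e^{u/2} s(e^u)` with `s` the Lambert series. -/
def ellF (q : ℝ) (u : ℂ) : ℂ := Complex.exp (u / 2) * lambert q (Complex.exp u)

/-- The half period `log q + π i`, which is the zero of `ellF q`. -/
def omega (q : ℝ) : ℂ := (Real.log q : ℂ) + Real.pi * Complex.I

theorem exp_log_ofReal {q : ℝ} (hq0 : 0 < q) : Complex.exp (Real.log q : ℂ) = q := by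
  rw [← Complex.ofReal_exp, Real.exp_log hq0]

theorem exp_half_log_sq {q : ℝ} (hq0 : 0 < q) : Complex.exp ((2 * Real.log q : ℂ)) = q ^ 2 := by
  rw [two_mul, Complex.exp_add, exp_log_ofReal hq0, sq]

theorem exp_omega {q : ℝ} (hq0 : 0 < q) : Complex.exp (omega q) = -q := by
  rw [omega, Complex.exp_add, exp_log_ofReal hq0, Complex.exp_pi_mul_I]; ring

theorem norm_exp_gt {q : ℝ} (hq0 : 0 < q) {n : ℕ} {u : ℂ} (h : n * Real.log q < u.re) :
    q ^ n < ‖Complex.exp u‖ := by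
  rw [Complex.norm_exp, ← Real.exp_log (pow_pos hq0 n), Real.log_pow]
  exact Real.exp_lt_exp.2 h

theorem norm_exp_mul_lt {q : ℝ} (hq0 : 0 < q) {n : ℕ} {u : ℂ} (h : u.re < -(n * Real.log q)) :
    ‖Complex.exp u‖ * q ^ n < 1 := by
  rw [Complex.norm_exp, ← Real.exp_log (pow_pos hq0 n), Real.log_pow, ← Real.exp_add,
    Real.exp_lt_one_iff]
  linarith

/-- The factor q gained by e^{u/2} cancels the 1/q in `lambert_sq_mul`. The shift is written as -2
log q because the Liouville lemma wants a positive real period. -/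
theorem ellF_add_two_log {q : ℝ} (hq0 : 0 < q) (u : ℂ) :
    ellF q (u + (-2 * Real.log q : ℝ)) = -ellF q u := by
  have hq : (q : ℂ) ≠ 0 := by exact_mod_cast hq0.ne'
  have key : ∀ v : ℂ, ellF q (v + 2 * Real.log q) = - ellF q v := by
    intro v
    have h1 : Complex.exp ((v + 2 * Real.log q) / 2) = Complex.exp (v / 2) * q := by
      rw [add_div, Complex.exp_add, mul_div_cancel_left₀ _ two_ne_zero, exp_log_ofReal hq0]
    rw [ellF, ellF, Complex.exp_add v, exp_half_log_sq hq0, mul_comm _ ((q : ℂ) ^ 2),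
      lambert_sq_mul hq0, h1]
    field_simp
  have := key (u + (-2 * Real.log q : ℝ))
  rw [eq_comm, neg_eq_iff_eq_neg] at this
  rw [this]
  congr 2
  push_cast; ring

theorem ellF_add_two_pi (q : ℝ) (u : ℂ) : ellF q (u + 2 * Real.pi * Complex.I) = -ellF q u := by
  have h1 : Complex.exp ((u + 2 * Real.pi * Complex.I) / 2) = -Complex.exp (u / 2) := by
    rw [add_div, Complex.exp_add, mul_assoc, mul_div_cancel_left₀ _ two_ne_zero,
      Complex.exp_pi_mul_I]
    ring
  rw [ellF, ellF, h1, Complex.exp_add u, Complex.exp_two_pi_mul_I, mul_one]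
  ring

theorem ellF_add_two_omega {q : ℝ} (hq0 : 0 < q) (u : ℂ) : ellF q (u + 2 * omega q) = ellF q u := by
  have h := ellF_add_two_log hq0 (u + 2 * omega q)
  have h2 : u + 2 * omega q + (-2 * Real.log q : ℝ) = u + 2 * Real.pi * Complex.I := by
    rw [omega]; push_cast; ring
  rw [h2, ellF_add_two_pi] at h
  exact (neg_inj.1 h).symm

theorem ellF_neg {q : ℝ} (hq0 : 0 < q) (u : ℂ) : ellF q (-u) = -ellF q u := by
  have h1 : Complex.exp (u / 2) = Complex.exp (-u / 2) * Complex.exp u := by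
    rw [← Complex.exp_add]; congr 1; ring
  rw [ellF, ellF, Complex.exp_neg u, lambert_inv hq0 (Complex.exp_ne_zero _), h1]
  ring

/-- Oddness together with the period 2ω forces F(ω) = F(-ω) = -F(ω). -/
theorem ellF_omega {q : ℝ} (hq0 : 0 < q) : ellF q (omega q) = 0 := by
  have h := ellF_add_two_omega hq0 (-omega q)
  have h2 : -omega q + 2 * omega q = omega q := by ring
  rw [h2, ellF_neg hq0] at h
  exact self_eq_neg.1 h

theorem analyticAt_ellF {q : ℝ} (hq0 : 0 < q) (hq1 : q < 1) {u : ℂ} (h1 : 2 * Real.log q < u.re)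
    (h2 : u.re < -(2 * Real.log q)) (h3 : Complex.exp u ≠ 1) : AnalyticAt ℂ (ellF q) u := by
  have h4 := analyticAt_lambert hq0 hq1 (norm_exp_gt hq0 (n := 2) (by exact_mod_cast h1))
    (norm_exp_mul_lt hq0 (n := 2) (by exact_mod_cast h2)) h3
  have h5 : AnalyticAt ℂ (fun u => lambert q (Complex.exp u)) u := h4.fun_comp (g := lambert q) (by fun_prop)
  have h6 : AnalyticAt ℂ (fun u : ℂ => Complex.exp (u / 2)) u := by fun_prop
  exact h6.mul h5

/-- The Laurent expansion of `ellF q` at its pole `0`: there `u F(u)` is an even analytic function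
with value `-1`. -/
theorem exists_ellF_eq_div {q : ℝ} (hq0 : 0 < q) (hq1 : q < 1) : ∃ p : ℂ → ℂ, AnalyticAt ℂ p 0 ∧
    p 0 = -1 ∧ deriv p 0 = 0 ∧ ∀ᶠ u in 𝓝[≠] 0, ellF q u = p u / u := by
  have hL : Real.log q < 0 := Real.log_neg hq0 hq1
  set e : ℂ → ℂ := dslope Complex.exp 0 with he
  have he0 : e 0 = 1 := by simp [he]
  have hea : AnalyticAt ℂ e 0 := by
    have : Differentiable ℂ e := by
      rw [← differentiableOn_univ]
      exact (Complex.differentiableOn_dslope (by simp)).2 Complex.differentiable_exp.differentiableOn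
    exact this.analyticAt 0
  have hreg : AnalyticAt ℂ (fun u => lambertReg q (Complex.exp u)) 0 :=
    (analyticAt_lambertReg hq0 hq1 (by simpa [abs_of_pos hq0] using hq1)
      (by simpa [abs_of_pos hq0] using hq1)).fun_comp
      (g := lambertReg q) (by fun_prop)
  set p : ℂ → ℂ := fun u => Complex.exp (u / 2) *
    (-1 / e u + u * lambertReg q (Complex.exp u)) with hp
  have hpa : AnalyticAt ℂ p 0 := by
    have h6 : AnalyticAt ℂ (fun u : ℂ => Complex.exp (u / 2)) 0 := by fun_prop
    exact h6.mul ((analyticAt_const.div hea (by simp [he0])).add (analyticAt_id.mul hreg))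
  have hev : ∀ᶠ u in 𝓝[≠] (0 : ℂ), ellF q u = p u / u := by
    have hnhds : ∀ᶠ u : ℂ in 𝓝 0, 2 * Real.log q < u.re ∧ u.re < -(2 * Real.log q) := by
      refine (Complex.continuous_re.tendsto 0).eventually
        (p := fun y => 2 * Real.log q < y ∧ y < -(2 * Real.log q)) ?_
      exact Ioo_mem_nhds (by rw [Complex.zero_re]; linarith) (by rw [Complex.zero_re]; linarith)
    filter_upwards [hnhds.filter_mono nhdsWithin_le_nhds, self_mem_nhdsWithin] with u hu hu0
    have hu0' : u ≠ 0 := hu0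
    rw [ellF, lambert_eq hq0 hq1 (norm_exp_gt hq0 (n := 2) (by exact_mod_cast hu.1))
      (norm_exp_mul_lt hq0 (n := 2) (by exact_mod_cast hu.2)), hp]
    have : e u = (Complex.exp u - 1) / u := by
      rw [he, dslope_of_ne _ hu0', slope_def_field]; simp
    simp only
    rw [this, div_div_eq_mul_div, mul_div_assoc, add_div, mul_div_cancel_left₀ _ hu0']
    congr 2
    rw [div_div, mul_comm (Complex.exp u - 1), neg_mul, one_mul, ← div_div, neg_div, div_self hu0',
      ← neg_sub, div_neg, neg_div]
  refine ⟨p, hpa, by simp [hp, he0], ?_, hev⟩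
  -- F is odd, so p = uF is even off 0, which kills p'(0).
  have heven : (fun u => p (-u)) =ᶠ[𝓝 0] p := by
    have hneg : Tendsto (fun u : ℂ => -u) (𝓝[≠] 0) (𝓝[≠] 0) := by
      refine tendsto_nhdsWithin_of_tendsto_nhds_of_eventually_within _ ?_ ?_
      · simpa using (continuous_neg.tendsto (0 : ℂ)).mono_left nhdsWithin_le_nhds
      · filter_upwards [self_mem_nhdsWithin] with v hv
        simpa using hv
    have : ∀ᶠ u in 𝓝[≠] (0 : ℂ), p (-u) = p u := by
      filter_upwards [hev, hneg.eventually hev, self_mem_nhdsWithin] with u h1 h2 h3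
      have hu0 : u ≠ 0 := h3
      rw [ellF_neg hq0, h1] at h2
      field_simp at h2
      simpa using h2.symm
    rw [eventually_nhdsWithin_iff] at this
    filter_upwards [this] with u hu
    by_cases h : u = 0
    · simp [h]
    · exact hu h
  have hd := heven.deriv_eq
  rw [deriv_comp_neg, neg_zero] at hd
  exact self_eq_neg.1 hd.symm

theorem exp_sub_omega_eq_one_iff {q : ℝ} (hq0 : 0 < q) (u : ℂ) :
    Complex.exp (u - omega q) = 1 ↔ Complex.exp u = -q := by
  have hq : (-q : ℂ) ≠ 0 := by simpa using hq0.ne'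
  rw [Complex.exp_sub, exp_omega hq0, div_eq_one_iff_eq hq]

theorem eventually_exp_ne {u c : ℂ} : ∀ᶠ v in 𝓝[≠] u, Complex.exp v ≠ c := by
  have h : AnalyticAt ℂ (fun v => Complex.exp v - c) u := by fun_prop
  rcases h.eventually_eq_zero_or_eventually_ne_zero with h0 | h0
  · have := EventuallyEq.deriv_eq (f₁ := fun v => Complex.exp v - c) (f := fun _ => 0) h0
    simp at this
  · filter_upwards [h0] with v hv h2
    exact hv (by simp [h2])

theorem omega_re (q : ℝ) : (omega q).re = Real.log q := by simp [omega]

theorem eventually_re_mem_Ioo {u : ℂ} {a b : ℝ} (h1 : a < u.re) (h2 : u.re < b) :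
    ∀ᶠ v : ℂ in 𝓝 u, a < v.re ∧ v.re < b :=
  (Complex.continuous_re.tendsto u).eventually (p := fun y => a < y ∧ y < b) (Ioo_mem_nhds h1 h2)

theorem ellF_eventually_ne_zero {q : ℝ} (hq0 : 0 < q) (hq1 : q < 1) :
    ∀ᶠ u in 𝓝[≠] (0 : ℂ), ellF q u ≠ 0 := by
  obtain ⟨p, hp, hp0, -, hev⟩ := exists_ellF_eq_div hq0 hq1
  have : ∀ᶠ u in 𝓝 (0 : ℂ), p u ≠ 0 := hp.continuousAt.eventually_ne (by simp [hp0])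
  filter_upwards [hev, this.filter_mono nhdsWithin_le_nhds, self_mem_nhdsWithin] with u h1 h2 h3
  rw [h1]
  exact div_ne_zero h2 h3

/-- Identity theorem: the poles of F on either side lie on Re u = 2 log q and Re u = 0, so F is
analytic on the convex strip between them. -/
theorem ellF_eqOn_strip {q : ℝ} (hq0 : 0 < q) (hq1 : q < 1) {c : ℂ} {u : ℂ}
    (h1 : 2 * Real.log q < u.re) (h2 : u.re < 0) (h : ∀ᶠ v in 𝓝 u, ellF q v = c) (v : ℂ)
    (h3 : 2 * Real.log q < v.re) (h4 : v.re < 0) : ellF q v = c := by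
  set T : Set ℂ := {u | 2 * Real.log q < u.re ∧ u.re < 0} with hT
  have hTc : Convex ℝ T := (convex_halfSpace_re_gt _).inter (convex_halfSpace_re_lt _)
  have hTa : AnalyticOnNhd ℂ (ellF q) T := by
    intro w hw
    have hL : Real.log q < 0 := Real.log_neg hq0 hq1
    refine analyticAt_ellF hq0 hq1 hw.1 (by linarith [hw.2]) ?_
    intro h
    have := Complex.norm_exp w
    rw [h, norm_one, eq_comm, Real.exp_eq_one_iff] at this
    linarith [hw.2]
  exact hTa.eqOn_of_preconnected_of_eventuallyEq (analyticOnNhd_const (v := c))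
    hTc.isPreconnected (z₀ := u) ⟨h1, h2⟩ h ⟨h3, h4⟩

/-- The product of `ellF q` with its translate by the half period is constant. -/
theorem exists_ellF_mul_eq {q : ℝ} (hq0 : 0 < q) (hq1 : q < 1) : ∃ C : ℂ, C ≠ 0 ∧
    ∀ u : ℂ, 2 * Real.log q < u.re → u.re < -Real.log q → Complex.exp u ≠ 1 →
      Complex.exp u ≠ -q → ellF q u * ellF q (u - omega q) = C := by
  have hL : Real.log q < 0 := Real.log_neg hq0 hq1
  set E : ℂ → ℂ := fun u => ellF q u * ellF q (u - omega q) with hE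
  have hana : ∀ u : ℂ, 2 * Real.log q < u.re → u.re < -Real.log q → Complex.exp u ≠ 1 →
      Complex.exp u ≠ -q → AnalyticAt ℂ E u := by
    intro u h1 h2 h3 h4
    refine (analyticAt_ellF hq0 hq1 h1 (by linarith) h3).mul ?_
    refine AnalyticAt.fun_comp (f := fun v => v - omega q) (analyticAt_ellF hq0 hq1 ?_ ?_ ?_)
      (by fun_prop)
    · rw [Complex.sub_re, omega_re]; linarith
    · rw [Complex.sub_re, omega_re]; linarith
    · rwa [Ne, exp_sub_omega_eq_one_iff hq0]
  have hper1 : ∀ u, E (u + (-2 * Real.log q : ℝ)) = E u := by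
    intro u
    simp only [hE]
    rw [add_sub_right_comm, ellF_add_two_log hq0, ellF_add_two_log hq0]
    ring
  have hper2 : ∀ u, E (u + 2 * Real.pi * Complex.I) = E u := by
    intro u
    simp only [hE]
    rw [add_sub_right_comm, ellF_add_two_pi, ellF_add_two_pi]
    ring
  have hper2' : Function.Periodic E (2 * Real.pi * Complex.I) := hper2
  -- The translate by ω swaps the two factors, up to a period 2ω. This carries removability at 0
  -- over to the pole of the second factor at ω.
  have hper3 : ∀ u, E (u + omega q) = E u := by
    intro u
    simp only [hE]
    rw [add_sub_cancel_right, mul_comm, ← ellF_add_two_omega hq0 (u - omega q)]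
    congr 2
    ring
  have hrem0 : IsRemovable E 0 := by
    obtain ⟨p, hp, hp0, -, hev⟩ := exists_ellF_eq_div hq0 hq1
    have hG : AnalyticAt ℂ (fun u => ellF q (u - omega q)) 0 := by
      refine AnalyticAt.fun_comp (f := fun v => v - omega q) (analyticAt_ellF hq0 hq1 ?_ ?_ ?_)
        (by fun_prop)
      · rw [Complex.sub_re, omega_re, Complex.zero_re]; linarith
      · rw [Complex.sub_re, omega_re, Complex.zero_re]; linarith
      · rw [Ne, exp_sub_omega_eq_one_iff hq0, Complex.exp_zero]
        intro h
        have := congrArg Complex.re h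
        simp at this
        linarith
    have hG0 : ellF q (0 - omega q) = 0 := by
      rw [zero_sub, ellF_neg hq0, ellF_omega hq0, neg_zero]
    obtain ⟨g, hg, hgev⟩ := (natCast_le_analyticOrderAt hG (n := 1)).1
      (by
        rw [Nat.cast_one, Order.one_le_iff_ne_zero]
        exact hG.analyticOrderAt_ne_zero.2 hG0)
    refine ⟨fun u => p u * g u, hp.mul hg, ?_⟩
    filter_upwards [hev, hgev.filter_mono nhdsWithin_le_nhds, self_mem_nhdsWithin] with u h1 h2 h3
    have hu : u ≠ 0 := h3
    simp only [hE]
    rw [h1, h2]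
    simp only [sub_zero, pow_one, smul_eq_mul]
    field_simp
  -- The period strip from 3/2 log q to -1/2 log q lies inside the range (2 log q, -log q) covered
  -- by `hana`.
  obtain ⟨C, hC⟩ := exists_const_of_doubly_periodic (H := E) (p := -2 * Real.log q)
    (α := 3 / 2 * Real.log q) (by linarith) hper1 hper2 (by
      intro u h1 h2
      by_cases h3 : Complex.exp u = 1
      · obtain ⟨n, rfl⟩ := Complex.exp_eq_one_iff.1 h3
        refine IsRemovable.of_shift (a := -(n * (2 * Real.pi * Complex.I))) (by simpa using hrem0)
          (Eventually.of_forall fun v => ?_)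
        rw [← sub_eq_add_neg, hper2'.sub_int_mul_eq]
      by_cases h4 : Complex.exp u = -q
      · obtain ⟨n, hn⟩ := Complex.exp_eq_one_iff.1 ((exp_sub_omega_eq_one_iff hq0 u).2 h4)
        refine IsRemovable.of_shift (a := -omega q - n * (2 * Real.pi * Complex.I)) ?_
          (Eventually.of_forall fun v => ?_)
        · rw [← hn, show u + (-omega q - (u - omega q)) = 0 by ring]
          exact hrem0
        · rw [← add_sub_assoc, hper2'.sub_int_mul_eq, ← hper3]
          congr 1; ring
      exact isRemovable_of_analyticAt (hana u (by linarith) (by linarith) h3 h4))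
  refine ⟨C, ?_, fun u h1 h2 h3 h4 => ?_⟩
  -- If the constant were 0, then F(· - ω) would vanish near 0, hence F near ω and then on the whole
  -- strip, contradicting the pole at 0.
  · rintro rfl
    have hz : ∀ᶠ u in 𝓝[≠] (0 : ℂ), ellF q (u - omega q) = 0 := by
      filter_upwards [hC 0, ellF_eventually_ne_zero hq0 hq1] with u h1 h2
      exact (mul_eq_zero.1 h1).resolve_left h2
    have hz2 : ∀ᶠ u in 𝓝 (omega q), ellF q u = 0 := by
      have h1 : ∀ᶠ u in 𝓝[≠] (omega q), ellF q u = 0 := by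
        have ht := tendsto_add_const_punctured (omega q) (-omega q)
        rw [add_neg_cancel] at ht
        filter_upwards [ht.eventually hz] with u hu
        rw [← hu, ← ellF_add_two_omega hq0 (u + -omega q - omega q)]
        congr 1; ring
      rw [eventually_nhdsWithin_iff] at h1
      filter_upwards [h1] with u hu
      by_cases h : u = omega q
      · rw [h, ellF_omega hq0]
      · exact hu h
    have hz3 := ellF_eqOn_strip hq0 hq1 (by rw [omega_re]; linarith) (by rw [omega_re]; linarith) hz2
    have ht : Tendsto (fun ε : ℝ => ((-ε : ℝ) : ℂ)) (𝓝[>] 0) (𝓝[≠] 0) := by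
      refine tendsto_nhdsWithin_of_tendsto_nhds_of_eventually_within _ ?_ ?_
      · have : Continuous fun ε : ℝ => ((-ε : ℝ) : ℂ) := by fun_prop
        simpa using (this.tendsto 0).mono_left nhdsWithin_le_nhds
      · filter_upwards [self_mem_nhdsWithin] with ε hε
        have : ε ≠ 0 := ne_of_gt hε
        simpa using this
    obtain ⟨ε, h1, h2⟩ := ((ht.eventually (ellF_eventually_ne_zero hq0 hq1)).and
      (Ioo_mem_nhdsGT (show (0 : ℝ) < -Real.log q by linarith))).exists
    refine h1 (hz3 _ ?_ ?_)
    · rw [Complex.ofReal_re]; linarith [h2.2]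
    · rw [Complex.ofReal_re]; linarith [h2.1]
  · have h5 := (hana u h1 h2 h3 h4).continuousAt.tendsto.mono_left
      (nhdsWithin_le_nhds (s := {u}ᶜ))
    exact tendsto_nhds_unique_of_eventuallyEq h5 tendsto_const_nhds (hC u)

theorem ellF_ne_zero {q : ℝ} (hq0 : 0 < q) (hq1 : q < 1) {u : ℂ}
    (h1 : 2 * Real.log q < u.re) (h2 : u.re < -Real.log q) (h3 : Complex.exp u ≠ 1)
    (h4 : Complex.exp u ≠ -q) : ellF q u ≠ 0 := by
  obtain ⟨C, hC0, hC⟩ := exists_ellF_mul_eq hq0 hq1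
  exact left_ne_zero_of_mul ((hC u h1 h2 h3 h4).symm ▸ hC0)

/-! ### The differential equation of the elliptic function -/

/-- With F = p/u one has F'/F = p'/p - 1/u, so the polar part is (1 - p²)/u² - 2p'/(up). Both pieces
are analytic because p(0)² = 1 and p'(0) = 0; A/F² = Au²/p² is harmless for any A. -/
theorem isRemovable_ellF_quartic_zero {q : ℝ} (hq0 : 0 < q) (hq1 : q < 1) (A : ℂ) :
    IsRemovable (fun u => (deriv (ellF q) u / ellF q u) ^ 2 + A / ellF q u ^ 2 - ellF q u ^ 2) 0 := by
  obtain ⟨p, hp, hp0, hp', hev⟩ := exists_ellF_eq_div hq0 hq1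
  obtain ⟨p₁, hp₁, hev₁⟩ := (natCast_le_analyticOrderAt hp.deriv (n := 1)).1 (by
    rw [Nat.cast_one, Order.one_le_iff_ne_zero]
    exact hp.deriv.analyticOrderAt_ne_zero.2 hp')
  have hsq : AnalyticAt ℂ (fun u => p u ^ 2 - 1) 0 := (hp.pow 2).sub analyticAt_const
  obtain ⟨p₂, hp₂, hev₂⟩ : ∃ g : ℂ → ℂ, AnalyticAt ℂ g 0 ∧
      ∀ᶠ u in 𝓝 0, p u ^ 2 - 1 = u ^ 2 * g u := by
    obtain ⟨g, hg, hgev⟩ := (natCast_le_analyticOrderAt hsq (n := 1)).1 (by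
      rw [Nat.cast_one, Order.one_le_iff_ne_zero]
      exact hsq.analyticOrderAt_ne_zero.2 (by simp [hp0]))
    simp only [sub_zero, pow_one, smul_eq_mul] at hgev
    have hg0 : g 0 = 0 := by
      have e1 : deriv (fun u => p u ^ 2 - 1) 0 = 0 := by
        have := ((hp.differentiableAt.hasDerivAt.pow 2).sub_const 1).deriv
        simpa [hp'] using this
      have e2 : deriv (fun u => u * g u) 0 = g 0 := by
        have := ((hasDerivAt_id (0 : ℂ)).mul hg.differentiableAt.hasDerivAt).deriv
        simp only [id, one_mul, zero_mul, add_zero] at this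
        exact this
      exact e2.symm.trans ((EventuallyEq.deriv_eq hgev).symm.trans e1)
    obtain ⟨k, hk, hkev⟩ := (natCast_le_analyticOrderAt hg (n := 1)).1 (by
      rw [Nat.cast_one, Order.one_le_iff_ne_zero]
      exact hg.analyticOrderAt_ne_zero.2 hg0)
    refine ⟨k, hk, ?_⟩
    filter_upwards [hgev, hkev] with u h1 h2
    rw [h1, h2]
    simp only [sub_zero, pow_one, smul_eq_mul]
    ring
  have hpne : ∀ᶠ u in 𝓝 (0 : ℂ), p u ≠ 0 := hp.continuousAt.eventually_ne (by simp [hp0])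
  refine ⟨fun u => (deriv p u / p u) ^ 2 - 2 * p₁ u / p u + A * u ^ 2 / p u ^ 2 - p₂ u, ?_, ?_⟩
  · have hne : p 0 ≠ 0 := by simp [hp0]
    exact ((((hp.deriv.div hp hne).pow 2).sub ((analyticAt_const.mul hp₁).div hp hne)).add
      ((analyticAt_const.mul (analyticAt_id.pow 2)).div (hp.pow 2) (pow_ne_zero 2 hne))).sub hp₂
  have hev' : ∀ᶠ u in 𝓝 (0 : ℂ), u ≠ 0 → ellF q u = p u / u := eventually_nhdsWithin_iff.1 hev
  have hnh : ∀ {P : ℂ → Prop}, (∀ᶠ u in 𝓝 (0 : ℂ), P u) → ∀ᶠ u in 𝓝[≠] (0 : ℂ), P u :=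
    fun h => h.filter_mono nhdsWithin_le_nhds
  filter_upwards [hnh hev'.eventually_nhds, hnh hp.eventually_analyticAt, hnh hev₁, hnh hev₂,
    hnh hpne, self_mem_nhdsWithin] with u h1 h2 h3 h4 h5 h6
  have hu : u ≠ 0 := h6
  have hF : ellF q =ᶠ[𝓝 u] fun v => p v / v := by
    filter_upwards [h1, isOpen_ne.mem_nhds hu] with v hv hv0 using hv hv0
  have hd : deriv (ellF q) u = (deriv p u * u - p u) / u ^ 2 := by
    rw [hF.deriv_eq]
    have := (h2.differentiableAt.hasDerivAt.div (hasDerivAt_id u) hu).deriv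
    simp only [id, mul_one] at this
    exact this
  simp only [sub_zero, pow_one, smul_eq_mul] at h3
  have h7 : p₂ u = (p u ^ 2 - 1) / u ^ 2 := by
    rw [h4]; field_simp
  have h8 : p₁ u = deriv p u / u := by
    rw [h3]; field_simp
  rw [hd, hF.eq_of_nhds, h7, h8]
  field_simp
  ring

/-- The elliptic function `ellF q` satisfies `F'² = F⁴ + β F² - A`. -/
theorem exists_ellF_ode {q : ℝ} (hq0 : 0 < q) (hq1 : q < 1) : ∃ C β : ℂ,
    (∀ u : ℂ, 2 * Real.log q < u.re → u.re < -Real.log q → Complex.exp u ≠ 1 →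
      Complex.exp u ≠ -q → ellF q u * ellF q (u - omega q) = C) ∧
    (∀ u : ℂ, 2 * Real.log q < u.re → u.re < -Real.log q → Complex.exp u ≠ 1 →
      Complex.exp u ≠ -q → deriv (ellF q) u ^ 2 = ellF q u ^ 4 + β * ellF q u ^ 2 + C ^ 2) := by
  have hL : Real.log q < 0 := Real.log_neg hq0 hq1
  obtain ⟨C, hC0, hC⟩ := exists_ellF_mul_eq hq0 hq1
  have hne : ∀ u : ℂ, 2 * Real.log q < u.re → u.re < -Real.log q → Complex.exp u ≠ 1 →
      Complex.exp u ≠ -q → ellF q u ≠ 0 := fun u h1 h2 h3 h4 => ellF_ne_zero hq0 hq1 h1 h2 h3 h4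
  -- This is the differential equation divided by F² and solved for β, so the goal is that it is
  -- constant.
  set H : ℂ → ℂ := fun u => (deriv (ellF q) u / ellF q u) ^ 2 + -C ^ 2 / ellF q u ^ 2 -
    ellF q u ^ 2 with hH
  have hana : ∀ u : ℂ, 2 * Real.log q < u.re → u.re < -Real.log q → Complex.exp u ≠ 1 →
      Complex.exp u ≠ -q → AnalyticAt ℂ H u := by
    intro u h1 h2 h3 h4
    have hF := analyticAt_ellF hq0 hq1 h1 (by linarith) h3
    have h0 := hne u h1 h2 h3 h4
    exact (((hF.deriv.div hF h0).pow 2).add (analyticAt_const.div (hF.pow 2)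
      (pow_ne_zero 2 h0))).sub (hF.pow 2)
  have hper : ∀ a : ℂ, (∀ v, ellF q (v + a) = -ellF q v) → ∀ v, H (v + a) = H v := by
    intro a ha v
    have hd : deriv (ellF q) (v + a) = -deriv (ellF q) v := by
      rw [← deriv_comp_add_const]
      have : (fun x => ellF q (x + a)) = fun x => -ellF q x := funext ha
      rw [this, deriv.fun_neg]
    simp only [hH, hd, ha, neg_div_neg_eq, neg_sq]
  have hper2 : Function.Periodic H (2 * Real.pi * Complex.I) := hper _ (ellF_add_two_pi q)
  -- Translation by -ω replaces F by C/F, which negates F'/F and exchanges C²/F² with F². So `H` is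
  -- unchanged, and its singularity at ω is removable because the one at 0 is.
  have hshift : ∀ u : ℂ, 2 * Real.log q < u.re → u.re < -Real.log q → Complex.exp u ≠ 1 →
      Complex.exp u ≠ -q → H (u + -omega q) = H u := by
    intro u h1 h2 h3 h4
    have hF := analyticAt_ellF hq0 hq1 h1 (by linarith) h3
    have h0 := hne u h1 h2 h3 h4
    have hn1 : ∀ᶠ v in 𝓝 u, Complex.exp v ≠ 1 ∧ Complex.exp v ≠ -q :=
      (Complex.continuous_exp.continuousAt.eventually_ne h3).and
        (Complex.continuous_exp.continuousAt.eventually_ne h4)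
    have hev : (fun v => ellF q (v + -omega q)) =ᶠ[𝓝 u] fun v => C / ellF q v := by
      filter_upwards [eventually_re_mem_Ioo h1 h2, hn1] with v hv1 hv2
      rw [eq_div_iff (hne v hv1.1 hv1.2 hv2.1 hv2.2), mul_comm, ← sub_eq_add_neg]
      exact hC v hv1.1 hv1.2 hv2.1 hv2.2
    have hd : deriv (ellF q) (u + -omega q) = -C * deriv (ellF q) u / ellF q u ^ 2 := by
      rw [← deriv_comp_add_const, hev.deriv_eq]
      have := ((hasDerivAt_const u C).div hF.differentiableAt.hasDerivAt h0).deriv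
      rw [zero_mul, zero_sub, ← neg_mul] at this
      exact this
    have he : ellF q (u + -omega q) = C / ellF q u := hev.eq_of_nhds
    simp only [hH]
    rw [hd, he]
    field_simp
    ring
  have hrem0 : IsRemovable H 0 := isRemovable_ellF_quartic_zero hq0 hq1 (-C ^ 2)
  obtain ⟨β, hβ⟩ := exists_const_of_doubly_periodic (H := H) (p := -2 * Real.log q)
    (α := 3 / 2 * Real.log q) (by linarith) (hper _ (ellF_add_two_log hq0)) hper2 (by
      intro u h1 h2
      by_cases h3 : Complex.exp u = 1
      · obtain ⟨n, rfl⟩ := Complex.exp_eq_one_iff.1 h3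
        refine IsRemovable.of_shift (a := -(n * (2 * Real.pi * Complex.I))) (by simpa using hrem0)
          (Eventually.of_forall fun v => ?_)
        rw [← sub_eq_add_neg, hper2.sub_int_mul_eq]
      by_cases h4 : Complex.exp u = -q
      · obtain ⟨n, hn⟩ := Complex.exp_eq_one_iff.1 ((exp_sub_omega_eq_one_iff hq0 u).2 h4)
        refine IsRemovable.of_shift (a := -omega q - n * (2 * Real.pi * Complex.I)) ?_ ?_
        · rw [← hn, show u + (-omega q - (u - omega q)) = 0 by ring]
          exact hrem0
        · have hr := eventually_re_mem_Ioo (u := u) (a := 2 * Real.log q) (b := -Real.log q)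
            (by linarith) (by linarith)
          filter_upwards [hr.filter_mono nhdsWithin_le_nhds, eventually_exp_ne (u := u) (c := 1),
            eventually_exp_ne (u := u) (c := -q)] with v h5 h6 h7
          rw [← add_sub_assoc, hper2.sub_int_mul_eq, hshift v h5.1 h5.2 h6 h7]
      exact isRemovable_of_analyticAt (hana u (by linarith) (by linarith) h3 h4))
  refine ⟨C, β, hC, fun u h1 h2 h3 h4 => ?_⟩
  have h5 := (hana u h1 h2 h3 h4).continuousAt.tendsto.mono_left
    (nhdsWithin_le_nhds (s := {u}ᶜ))
  have h6 : H u = β := tendsto_nhds_unique_of_eventuallyEq h5 tendsto_const_nhds (hβ u)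
  have h0 := hne u h1 h2 h3 h4
  rw [← h6]
  simp only [hH]
  field_simp
  ring

/-! ### Restriction to the real axis and the constants of the differential equation -/

/-- The Lambert series at a real point. -/
def lambertR (q t : ℝ) : ℝ := (lambert q t).re

/-- The restriction of `ellF q` to the real axis. -/
def ellR (q u : ℝ) : ℝ := (ellF q u).re

/-- The derivative of `ellF q` on the real axis. -/
def ellR' (q u : ℝ) : ℝ := (deriv (ellF q) u).re

/-- The constant `A` in `F'² = F⁴ + β F² - A`. -/
def ellA (q : ℝ) : ℝ := q * lambertR q q ^ 2 * lambertR q (-1) ^ 2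

/-- The constant `β` in `F'² = F⁴ + β F² - A`. -/
def ellB (q : ℝ) : ℝ := lambertR q (-1) ^ 2 - q * lambertR q q ^ 2

theorem lambert_ofReal (q t : ℝ) : lambert q t = lambertR q t := by
  rw [lambertR, eq_comm, ← Complex.conj_eq_iff_re, ← lambert_conj, Complex.conj_ofReal]

theorem ellF_ofReal (q u : ℝ) :
    ellF q u = (Real.exp (u / 2) * lambertR q (Real.exp u) : ℝ) := by
  rw [ellF, ← Complex.ofReal_exp, lambert_ofReal]
  push_cast
  rfl

theorem ellR_eq (q u : ℝ) : ellR q u = Real.exp (u / 2) * lambertR q (Real.exp u) := by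
  rw [ellR, ellF_ofReal, Complex.ofReal_re]

theorem ellF_eq_ellR (q u : ℝ) : ellF q u = ellR q u := by
  rw [ellR_eq, ellF_ofReal]

/-- Oddness combined with the antiperiod 2 log q. It makes log q a critical point of F, where the
constant β can be read off. -/
theorem ellF_reflect {q : ℝ} (hq0 : 0 < q) (u : ℂ) : ellF q (2 * Real.log q - u) = ellF q u := by
  have h := ellF_add_two_log hq0 (2 * Real.log q - u)
  rw [show (2 * Real.log q - u + (-2 * Real.log q : ℝ) : ℂ) = -u by push_cast; ring,
    ellF_neg hq0] at h
  exact (neg_inj.1 h).symm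

section
variable {q u : ℝ}

theorem exp_ofReal_ne_neg (hq0 : 0 < q) : Complex.exp (u : ℂ) ≠ -q := by
  rw [← Complex.ofReal_exp, ← Complex.ofReal_neg]
  intro h
  have := Complex.ofReal_injective h
  linarith [Real.exp_pos u]

theorem exp_ofReal_ne_one (hu : u < 0) : Complex.exp (u : ℂ) ≠ 1 := by
  rw [← Complex.ofReal_exp, ← Complex.ofReal_one]
  intro h
  have := Complex.ofReal_injective h
  rw [Real.exp_eq_one_iff] at this
  linarith

theorem analyticAt_ellF_ofReal (hq0 : 0 < q) (hq1 : q < 1) (h1 : 2 * Real.log q < u) (h2 : u < 0) :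
    AnalyticAt ℂ (ellF q) u := by
  have hL : Real.log q < 0 := Real.log_neg hq0 hq1
  exact analyticAt_ellF hq0 hq1 (by rwa [Complex.ofReal_re])
    (by rw [Complex.ofReal_re]; linarith) (exp_ofReal_ne_one h2)

theorem ellR_ne_zero (hq0 : 0 < q) (hq1 : q < 1) (h1 : 2 * Real.log q < u) (h2 : u < 0) :
    ellR q u ≠ 0 := by
  have hL : Real.log q < 0 := Real.log_neg hq0 hq1
  have := ellF_ne_zero hq0 hq1 (u := u) (by rwa [Complex.ofReal_re])
    (by rw [Complex.ofReal_re]; linarith) (exp_ofReal_ne_one h2) (exp_ofReal_ne_neg hq0)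
  rw [ellF_eq_ellR] at this
  exact_mod_cast this

theorem lambertR_ne_zero (hq0 : 0 < q) (hq1 : q < 1) {t : ℝ} (h1 : q ^ 2 < t) (h2 : t < 1) :
    lambertR q t ≠ 0 := by
  have ht : 0 < t := lt_trans (by positivity) h1
  have := ellR_ne_zero hq0 hq1 (u := Real.log t) (by
    have := Real.log_lt_log (by positivity) h1
    rw [Real.log_pow] at this
    exact_mod_cast this) (Real.log_neg ht h2)
  rw [ellR_eq, Real.exp_log ht] at this
  exact right_ne_zero_of_mul this

theorem hasDerivAt_ellR (hq0 : 0 < q) (hq1 : q < 1) (h1 : 2 * Real.log q < u) (h2 : u < 0) :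
    HasDerivAt (ellR q) (ellR' q u) u :=
  (analyticAt_ellF_ofReal hq0 hq1 h1 h2).differentiableAt.hasDerivAt.real_of_complex

theorem deriv_ellF_ofReal (hq0 : 0 < q) (hq1 : q < 1) (h1 : 2 * Real.log q < u) (h2 : u < 0) :
    deriv (ellF q) u = ellR' q u := by
  have e1 := (analyticAt_ellF_ofReal hq0 hq1 h1 h2).differentiableAt.hasDerivAt.comp_ofReal
  have e2 := (hasDerivAt_ellR hq0 hq1 h1 h2).ofReal_comp
  have : (fun y : ℝ => ellF q y) = fun y : ℝ => (ellR q y : ℂ) := funext (ellF_eq_ellR q)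
  rw [this] at e1
  exact e1.unique e2

/-- The real form of the differential equation `F'² = F⁴ + β F² - A`, together with its
derivative. -/
theorem deriv_ellF_sq (hq0 : 0 < q) (hq1 : q < 1) {u : ℂ} (h1 : 2 * Real.log q < u.re)
    (h2 : u.re < -Real.log q) (h3 : Complex.exp u ≠ 1) (h4 : Complex.exp u ≠ -q) :
    deriv (ellF q) u ^ 2 = ellF q u ^ 4 + ellB q * ellF q u ^ 2 - ellA q := by
  have hL : Real.log q < 0 := Real.log_neg hq0 hq1
  obtain ⟨C, β, hC, hβ⟩ := exists_ellF_ode hq0 hq1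
  have a1 : 2 * Real.log q < ((Real.log q : ℝ) : ℂ).re := by rw [Complex.ofReal_re]; linarith
  have a2 : ((Real.log q : ℝ) : ℂ).re < -Real.log q := by rw [Complex.ofReal_re]; linarith
  have a3 := exp_ofReal_ne_one hL
  have a4 := exp_ofReal_ne_neg (u := Real.log q) hq0
  have hF2 : ellF q (Real.log q) ^ 2 = q * lambertR q q ^ 2 := by
    rw [ellF, exp_log_ofReal hq0, lambert_ofReal, mul_pow, ← Complex.exp_nat_mul]
    congr 1
    rw [show ((2 : ℕ) : ℂ) * (Real.log q / 2) = Real.log q by push_cast; ring, exp_log_ofReal hq0]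
  have hF0 : ellF q (Real.log q) ≠ 0 := ellF_ne_zero hq0 hq1 a1 a2 a3 a4
  -- The product relation is evaluated at u = log q, where the translated argument is -πi and
  -- e^{-πi} = -1.
  have hC2 : C ^ 2 = -(ellF q (Real.log q) ^ 2 * lambertR q (-1) ^ 2) := by
    rw [← hC _ a1 a2 a3 a4, omega, sub_add_cancel_left, mul_pow]
    have : ellF q (-(Real.pi * Complex.I)) ^ 2 = -(lambertR q (-1) : ℂ) ^ 2 := by
      have e : Complex.exp (-(Real.pi * Complex.I)) = -1 := by
        rw [Complex.exp_neg, Complex.exp_pi_mul_I]; norm_num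
      rw [ellF, e, mul_pow, ← Complex.exp_nat_mul]
      have : ((2 : ℕ) : ℂ) * (-(Real.pi * Complex.I) / 2) = -(Real.pi * Complex.I) := by
        push_cast; ring
      rw [this, e, ← lambert_ofReal]
      push_cast; ring
    rw [this]; ring
  have hd0 : deriv (ellF q) (Real.log q) = 0 := by
    have e : (fun v : ℂ => ellF q (2 * Real.log q - v)) = ellF q := funext (ellF_reflect hq0)
    have e2 := deriv_comp_const_sub (ellF q) (2 * Real.log q : ℂ) (Real.log q : ℂ)
    rw [e, show (2 * Real.log q - Real.log q : ℂ) = Real.log q by ring] at e2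
    exact self_eq_neg.1 e2
  -- At the critical point log q the equation reads 0 = F⁴ + βF² - F² s(-1)², and F² ≠ 0 can be
  -- divided out.
  have hβ' : β = ellB q := by
    have e := hβ _ a1 a2 a3 a4
    rw [hd0, hC2] at e
    have e2 : ellF q (Real.log q) ^ 2 * (ellF q (Real.log q) ^ 2 + β - lambertR q (-1) ^ 2) = 0 := by
      linear_combination -e
    have e3 := (mul_eq_zero.1 e2).resolve_left (pow_ne_zero 2 hF0)
    rw [hF2] at e3
    rw [ellB]
    push_cast
    linear_combination e3
  rw [hβ u h1 h2 h3 h4, hC2, hF2, hβ', ellA]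
  push_cast
  ring

theorem ellR'_sq (hq0 : 0 < q) (hq1 : q < 1) (h1 : 2 * Real.log q < u) (h2 : u < 0) :
    ellR' q u ^ 2 = ellR q u ^ 4 + ellB q * ellR q u ^ 2 - ellA q := by
  have hL : Real.log q < 0 := Real.log_neg hq0 hq1
  have h := deriv_ellF_sq hq0 hq1 (u := u) (by rwa [Complex.ofReal_re])
    (by rw [Complex.ofReal_re]; linarith) (exp_ofReal_ne_one h2) (exp_ofReal_ne_neg hq0)
  rw [deriv_ellF_ofReal hq0 hq1 h1 h2, ellF_eq_ellR] at h
  exact_mod_cast h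

/-- Differentiating the equation gives F'(F'' - βF - 2F³) = 0. If F' vanished near u, then F would
be constant on the strip, yet it is zero at ω and nonzero at real points. So the zeros of F' are
isolated, and continuity removes the factor F'. -/
theorem hasDerivAt_ellR' (hq0 : 0 < q) (hq1 : q < 1) (h1 : 2 * Real.log q < u) (h2 : u < 0) :
    HasDerivAt (ellR' q) (ellB q * ellR q u + 2 * ellR q u ^ 3) u := by
  have hL : Real.log q < 0 := Real.log_neg hq0 hq1
  have hF := analyticAt_ellF_ofReal hq0 hq1 h1 h2
  have hr := eventually_re_mem_Ioo (u := (u : ℂ)) (a := 2 * Real.log q) (b := 0)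
    (by rwa [Complex.ofReal_re]) (by rwa [Complex.ofReal_re])
  have key : ∀ᶠ v in 𝓝 (u : ℂ), deriv (ellF q) v *
      (deriv (deriv (ellF q)) v - (ellB q * ellF q v + 2 * ellF q v ^ 3)) = 0 := by
    have hev : (fun v => deriv (ellF q) v ^ 2) =ᶠ[𝓝 (u : ℂ)]
        fun v => ellF q v ^ 4 + ellB q * ellF q v ^ 2 - ellA q := by
      filter_upwards [hr, Complex.continuous_exp.continuousAt.eventually_ne (exp_ofReal_ne_one h2),
        Complex.continuous_exp.continuousAt.eventually_ne (exp_ofReal_ne_neg hq0)] with v hv h3 h4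
      exact deriv_ellF_sq hq0 hq1 hv.1 (by linarith) h3 h4
    filter_upwards [hev.eventuallyEq_nhds, hF.eventually_analyticAt] with v hv hFv
    have e := hv.deriv_eq
    have d1 := hFv.differentiableAt.hasDerivAt
    have d2 := hFv.deriv.differentiableAt.hasDerivAt
    rw [(d2.fun_pow 2).deriv,
      (((d1.fun_pow 4).fun_add ((d1.fun_pow 2).const_mul (ellB q : ℂ))).sub_const (ellA q : ℂ)).deriv] at e
    push_cast at e
    simp only [pow_one] at e
    linear_combination e / 2
  have hX : deriv (deriv (ellF q)) u = ellB q * ellF q u + 2 * ellF q u ^ 3 := by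
    rcases hF.deriv.eventually_eq_zero_or_eventually_ne_zero with h0 | h0
    · exfalso
      have hconst : ∀ᶠ v in 𝓝 (u : ℂ), ellF q v = ellF q u := by
        obtain ⟨ε, hε, hb⟩ := Metric.eventually_nhds_iff_ball.1 (h0.and hF.eventually_analyticAt)
        filter_upwards [Metric.ball_mem_nhds (u : ℂ) hε] with v hv
        exact (Metric.isOpen_ball.is_const_of_deriv_eq_zero
          (convex_ball (u : ℂ) ε).isPreconnected
          (fun w hw => (hb w hw).2.differentiableAt.differentiableWithinAt)
          (fun w hw => (hb w hw).1) hv (Metric.mem_ball_self hε))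
      have := ellF_eqOn_strip hq0 hq1 (by rwa [Complex.ofReal_re]) (by rwa [Complex.ofReal_re])
        hconst (omega q) (by rw [omega_re]; linarith) (by rw [omega_re]; linarith)
      rw [ellF_omega hq0, ellF_eq_ellR, eq_comm, Complex.ofReal_eq_zero] at this
      exact ellR_ne_zero hq0 hq1 h1 h2 this
    · have hc : ContinuousAt (fun v => deriv (deriv (ellF q)) v -
          (ellB q * ellF q v + 2 * ellF q v ^ 3)) (u : ℂ) :=
        (hF.deriv.deriv.sub ((analyticAt_const.mul hF).add
          (analyticAt_const.mul (hF.pow 3)))).continuousAt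
      have hz : ∀ᶠ v in 𝓝[≠] (u : ℂ), deriv (deriv (ellF q)) v -
          (ellB q * ellF q v + 2 * ellF q v ^ 3) = 0 := by
        filter_upwards [key.filter_mono nhdsWithin_le_nhds, h0] with v h3 h4
        exact (mul_eq_zero.1 h3).resolve_left h4
      exact sub_eq_zero.1 (tendsto_nhds_unique_of_eventuallyEq
        (hc.tendsto.mono_left nhdsWithin_le_nhds) tendsto_const_nhds hz)
  have := hF.deriv.differentiableAt.hasDerivAt.real_of_complex
  rw [hX, ellF_eq_ellR] at this
  refine HasDerivAt.congr_deriv this ?_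
  rw [← Complex.ofReal_re (ellB q * ellR q u + 2 * ellR q u ^ 3)]
  push_cast
  rfl

theorem ellA_pos (hq0 : 0 < q) (hq1 : q < 1) : 0 < ellA q := by
  have hL : Real.log q < 0 := Real.log_neg hq0 hq1
  have h1 : lambertR q (-1) ≠ 0 := by
    have h := ellF_ne_zero hq0 hq1 (u := Real.pi * Complex.I)
      (by rw [Complex.re_ofReal_mul, Complex.I_re]; linarith)
      (by rw [Complex.re_ofReal_mul, Complex.I_re]; linarith) (by rw [Complex.exp_pi_mul_I]; norm_num)
      (by
        rw [Complex.exp_pi_mul_I]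
        intro h
        have := congrArg Complex.re h
        simp only [Complex.neg_re, Complex.one_re, Complex.ofReal_re] at this
        linarith)
    rw [ellF, Complex.exp_pi_mul_I] at h
    have h2 := right_ne_zero_of_mul h
    rw [show (-1 : ℂ) = ((-1 : ℝ) : ℂ) by norm_num, lambert_ofReal] at h2
    exact_mod_cast h2
  have h2 : lambertR q q ≠ 0 := lambertR_ne_zero hq0 hq1 (by nlinarith) hq1
  unfold ellA
  positivity

end

/-! ### Cauchy's formula on an annulus -/

/-- The closed annulus `{w : ρ ≤ |w| ≤ R}`. -/
def closedAnnulus (ρ R : ℝ) : Set ℂ := {w | ρ ≤ ‖w‖ ∧ ‖w‖ ≤ R}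

theorem closedAnnulus_eq (ρ R : ℝ) :
    closedAnnulus ρ R = Metric.closedBall 0 R \ Metric.ball 0 ρ := by
  ext w
  simp [closedAnnulus, and_comm]

theorem isClosed_closedAnnulus (ρ R : ℝ) : IsClosed (closedAnnulus ρ R) := by
  rw [closedAnnulus_eq]
  exact Metric.isClosed_closedBall.sdiff Metric.isOpen_ball

theorem isCompact_closedAnnulus (ρ R : ℝ) : IsCompact (closedAnnulus ρ R) := by
  rw [closedAnnulus_eq]
  exact (isCompact_closedBall 0 R).diff Metric.isOpen_ball

theorem circleIntegral_sub_inv_eq_zero {ρ : ℝ} (hρ : 0 < ρ) {z : ℂ} (hz : ρ < ‖z‖) :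
    (∮ w in C(0, ρ), (w - z)⁻¹) = 0 := by
  have hne : ∀ w ∈ Metric.closedBall (0 : ℂ) ρ, w - z ≠ 0 := by
    intro w hw h
    rw [sub_eq_zero.1 h, mem_closedBall_zero_iff] at hw
    linarith
  refine Complex.circleIntegral_eq_zero_of_differentiable_on_off_countable hρ.le
    (s := ∅) countable_empty ?_ ?_
  · exact (continuousOn_id.sub continuousOn_const).inv₀ hne
  · intro w hw
    exact (differentiableAt_id.sub_const z).inv (hne w (Metric.ball_subset_closedBall hw.1))

/-- The slope of f at z extends analytically across z, so its integrals over the two circles agree.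
The leftover f(z)/(w - z) integrates to 2πi f(z) on the outer circle and to 0 on the inner one. -/
theorem circleIntegral_annulus_cauchy {ρ R : ℝ} (hρ : 0 < ρ) {z : ℂ} (h1 : ρ < ‖z‖)
    (h2 : ‖z‖ < R) {f : ℂ → ℂ} (hc : ContinuousOn f (closedAnnulus ρ R))
    (hd : ∀ w : ℂ, ρ < ‖w‖ → ‖w‖ < R → DifferentiableAt ℂ f w) :
    (∮ w in C(0, R), f w / (w - z)) - (∮ w in C(0, ρ), f w / (w - z)) =
      2 * Real.pi * Complex.I * f z := by
  have hR : 0 < R := hρ.trans (h1.trans h2)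
  have hU : IsOpen {w : ℂ | ρ < ‖w‖ ∧ ‖w‖ < R} :=
    (isOpen_lt continuous_const continuous_norm).inter (isOpen_lt continuous_norm continuous_const)
  have hUz : {w : ℂ | ρ < ‖w‖ ∧ ‖w‖ < R} ∈ 𝓝 z := hU.mem_nhds ⟨h1, h2⟩
  have hsub : {w : ℂ | ρ < ‖w‖ ∧ ‖w‖ < R} ⊆ closedAnnulus ρ R := fun w hw => ⟨hw.1.le, hw.2.le⟩
  have hcz : ContinuousOn (dslope f z) (closedAnnulus ρ R) :=
    (continuousOn_dslope (mem_of_superset hUz hsub)).2 ⟨hc, hd z h1 h2⟩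
  have hdz : DifferentiableOn ℂ (dslope f z) {w : ℂ | ρ < ‖w‖ ∧ ‖w‖ < R} :=
    (Complex.differentiableOn_dslope hUz).2
      fun w hw => (hd w hw.1 hw.2).differentiableWithinAt
  have hcirc := Complex.circleIntegral_eq_of_differentiable_on_annulus_off_countable hρ
    (h1.trans h2).le (c := 0) (f := dslope f z) (s := ∅) countable_empty
    (by rwa [← closedAnnulus_eq]) (by
      rintro w ⟨⟨hw1, hw2⟩, -⟩
      simp only [Metric.mem_ball, Metric.mem_closedBall, dist_zero_right, not_le] at hw1 hw2
      exact (hdz w ⟨hw2, hw1⟩).differentiableAt (hU.mem_nhds ⟨hw2, hw1⟩))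
  have key : ∀ t : ℝ, 0 < t → ρ ≤ t → t ≤ R → t ≠ ‖z‖ → (∮ w in C(0, t), dslope f z w) =
      (∮ w in C(0, t), f w / (w - z)) - f z * ∮ w in C(0, t), (w - z)⁻¹ := by
    intro t ht ht1 ht2 htz
    have hne : ∀ w ∈ Metric.sphere (0 : ℂ) t, w - z ≠ 0 := by
      intro w hw h
      rw [mem_sphere_zero_iff_norm, sub_eq_zero.1 h] at hw
      exact htz hw.symm
    have hinv : ContinuousOn (fun w => (w - z)⁻¹) (Metric.sphere (0 : ℂ) t) :=
      (continuousOn_id.sub continuousOn_const).inv₀ hne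
    have hcs : ContinuousOn f (Metric.sphere (0 : ℂ) t) := hc.mono fun w hw => by
      rw [mem_sphere_zero_iff_norm] at hw
      exact ⟨by rwa [hw], by rwa [hw]⟩
    rw [← circleIntegral.integral_const_mul, ← circleIntegral.integral_sub]
    · refine circleIntegral.integral_congr ht.le fun w hw => ?_
      have hwz : w ≠ z := sub_ne_zero.1 (hne w hw)
      rw [dslope_of_ne _ hwz, slope_def_field]
      field_simp
    · exact (hcs.div (continuousOn_id.sub continuousOn_const) hne).circleIntegrable ht.le
    · exact (continuousOn_const.mul hinv).circleIntegrable ht.le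
  rw [key R hR (h1.trans h2).le le_rfl h2.ne', key ρ hρ le_rfl (h1.trans h2).le h1.ne,
    circleIntegral_sub_inv_eq_zero hρ h1,
    circleIntegral.integral_sub_inv_of_mem_ball (by simpa using h2)] at hcirc
  linear_combination hcirc

/-! ### The arc length measure on the boundary of the annulus -/

theorem closure_annulus {r : ℝ} (hr0 : 0 < r) (hr1 : r < 1) :
    closure (annulus r) = closedAnnulus r 1 := by
  apply Subset.antisymm
  · exact closure_minimal (fun w hw => ⟨hw.1.le, hw.2.le⟩) (isClosed_closedAnnulus r 1)
  · intro w hw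
    have hw0 : 0 < ‖w‖ := hr0.trans_le hw.1
    -- The point of the mid-circle on the ray through `w`; moving `w` slightly towards it enters the
    -- open annulus.
    set m : ℂ := (((r + 1) / 2 / ‖w‖ : ℝ) : ℂ) * w with hm
    have hmn : ‖m‖ = (r + 1) / 2 := by
      rw [hm, norm_mul, Complex.norm_real, Real.norm_of_nonneg (by positivity)]
      field_simp
    have ht : Tendsto (fun ε : ℝ => (1 - ε : ℂ) * w + ε * m) (𝓝[>] 0) (𝓝 w) := by
      have : Continuous fun ε : ℝ => (1 - ε : ℂ) * w + ε * m := by fun_prop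
      simpa using (this.tendsto 0).mono_left (nhdsWithin_le_nhds (s := Ioi 0))
    refine mem_closure_of_tendsto ht ?_
    filter_upwards [Ioo_mem_nhdsGT (show (0 : ℝ) < 1 by norm_num)] with ε hε
    have hn : ‖(1 - ε : ℂ) * w + ε * m‖ = (1 - ε) * ‖w‖ + ε * ((r + 1) / 2) := by
      have : (1 - ε : ℂ) * w + ε * m = ((1 - ε + ε * ((r + 1) / 2 / ‖w‖) : ℝ) : ℂ) * w := by
        rw [hm]; push_cast; ring
      have h2 : 0 ≤ 1 - ε := by linarith [hε.2]
      have h3 : 0 ≤ ε := hε.1.le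
      rw [this, norm_mul, Complex.norm_real, Real.norm_of_nonneg (by positivity)]
      field_simp
    have h1 := hw.1
    have h2 := hw.2
    constructor
    · rw [hn]; nlinarith [hε.1, hε.2]
    · rw [hn]; nlinarith [hε.1, hε.2]

instance isFiniteMeasure_circleArcLength (ρ : ℝ) : IsFiniteMeasure (circleArcLength ρ) :=
  Measure.smul_finite _ ENNReal.ofReal_ne_top

instance isFiniteMeasure_annulusArcLength (r : ℝ) : IsFiniteMeasure (annulusArcLength r) := by
  unfold annulusArcLength
  infer_instance

theorem ae_mem_sphere (ρ : ℝ) : ∀ᵐ w ∂circleArcLength ρ, w ∈ Metric.sphere (0 : ℂ) |ρ| := by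
  refine Measure.ae_smul_measure ?_ _
  exact (ae_map_iff (p := fun w => w ∈ Metric.sphere (0 : ℂ) |ρ|)
    (measurable_circleMap 0 ρ).aemeasurable Metric.isClosed_sphere.measurableSet).2
    (Eventually.of_forall fun θ => circleMap_mem_sphere' 0 ρ θ)

theorem ae_mem_closedAnnulus {r : ℝ} (hr0 : 0 < r) (hr1 : r < 1) :
    ∀ᵐ w ∂annulusArcLength r, w ∈ closedAnnulus r 1 := by
  rw [annulusArcLength, ae_add_measure_iff]
  constructor
  · filter_upwards [ae_mem_sphere r] with w hw
    rw [mem_sphere_zero_iff_norm, abs_of_pos hr0] at hw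
    exact ⟨hw.ge, hw ▸ hr1.le⟩
  · filter_upwards [ae_mem_sphere 1] with w hw
    rw [mem_sphere_zero_iff_norm, abs_one] at hw
    exact ⟨hw ▸ hr1.le, hw.le⟩

theorem aestronglyMeasurable_of_continuousOn {r : ℝ} (hr0 : 0 < r) (hr1 : r < 1) {g : ℂ → ℂ}
    (hg : ContinuousOn g (closedAnnulus r 1)) : AEStronglyMeasurable g (annulusArcLength r) := by
  rw [← Measure.restrict_eq_self_of_ae_mem (ae_mem_closedAnnulus hr0 hr1)]
  exact hg.aestronglyMeasurable (isClosed_closedAnnulus r 1).measurableSet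

theorem memLp_of_continuousOn {r : ℝ} (hr0 : 0 < r) (hr1 : r < 1) {g : ℂ → ℂ}
    (hg : ContinuousOn g (closedAnnulus r 1)) (p : ℝ≥0∞) : MemLp g p (annulusArcLength r) := by
  obtain ⟨B, hB⟩ := (isCompact_closedAnnulus r 1).exists_bound_of_continuousOn hg
  refine MemLp.of_bound (aestronglyMeasurable_of_continuousOn hr0 hr1 hg) B ?_
  filter_upwards [ae_mem_closedAnnulus hr0 hr1] with w hw using hB w hw

theorem integral_circleArcLength {ρ : ℝ} (hρ : 0 ≤ ρ) {g : ℂ → ℂ}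
    (hg : AEStronglyMeasurable g (circleArcLength ρ)) (hρ0 : ρ ≠ 0) :
    ∫ w, g w ∂circleArcLength ρ = ρ * ∫ θ in (0 : ℝ)..2 * Real.pi, g (circleMap 0 ρ θ) := by
  have hg' : AEStronglyMeasurable g
      ((volume.restrict (Ioc (0 : ℝ) (2 * Real.pi))).map (circleMap 0 ρ)) := by
    refine hg.mono_ac ?_
    refine Measure.absolutelyContinuous_smul ?_
    simpa using lt_of_le_of_ne hρ hρ0.symm
  rw [circleArcLength, integral_smul_measure, ENNReal.toReal_ofReal hρ,
    integral_map (measurable_circleMap 0 ρ).aemeasurable hg',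
    intervalIntegral.integral_of_le Real.two_pi_pos.le, Complex.real_smul]

theorem integral_annulusArcLength {r : ℝ} (hr0 : 0 < r) (hr1 : r < 1) {g : ℂ → ℂ}
    (hg : ContinuousOn g (closedAnnulus r 1)) :
    ∫ w, g w ∂annulusArcLength r = r * (∫ θ in (0 : ℝ)..2 * Real.pi, g (circleMap 0 r θ)) +
      ∫ θ in (0 : ℝ)..2 * Real.pi, g (circleMap 0 1 θ) := by
  have hm := aestronglyMeasurable_of_continuousOn hr0 hr1 hg
  have hi : Integrable g (annulusArcLength r) :=
    (memLp_of_continuousOn hr0 hr1 hg 1).integrable le_rfl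
  rw [annulusArcLength] at hm hi ⊢
  rw [integral_add_measure (hi.left_of_add_measure) (hi.right_of_add_measure),
    integral_circleArcLength hr0.le (hm.mono_measure (Measure.le_add_right le_rfl)) hr0.ne',
    integral_circleArcLength zero_le_one (hm.mono_measure (Measure.le_add_left le_rfl)) one_ne_zero,
    Complex.ofReal_one, one_mul]

/-! ### The Szegő kernel of the annulus -/

/-- `2π (w - z) L(w, z)`, where `L(w, z)`, with `2π L(w, z) = s(z / w) / w`, is the Garabedian
kernel of the annulus; it is analytic in `w` near the closed annulus. -/
def garabedianReg (q : ℝ) (z w : ℂ) : ℂ := 1 + (w - z) * (lambertReg q (z / w) / w)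

theorem garabedianReg_self (q : ℝ) (z : ℂ) : garabedianReg q z z = 1 := by simp [garabedianReg]

section
variable {q : ℝ} {z w : ℂ}

theorem norm_div_gt (hq0 : 0 < q) (hz : z ∈ annulus q) (hw : w ∈ closedAnnulus q 1) :
    q < ‖z / w‖ := by
  have hw0 : 0 < ‖w‖ := hq0.trans_le hw.1
  rw [norm_div, lt_div_iff₀ hw0]
  nlinarith [hz.1, hz.2, hw.1, hw.2]

theorem norm_div_mul_lt (hq0 : 0 < q) (hz : z ∈ annulus q) (hw : w ∈ closedAnnulus q 1) :
    ‖z / w‖ * q < 1 := by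
  have hw0 : 0 < ‖w‖ := hq0.trans_le hw.1
  rw [norm_div, div_mul_eq_mul_div, div_lt_one hw0]
  nlinarith [hz.1, hz.2, hw.1, hw.2]

theorem ne_zero_of_mem_closedAnnulus (hq0 : 0 < q) (hw : w ∈ closedAnnulus q 1) : w ≠ 0 :=
  norm_pos_iff.1 (hq0.trans_le hw.1)

theorem annulus_subset : annulus q ⊆ closedAnnulus q 1 := fun _ hw => ⟨hw.1.le, hw.2.le⟩

theorem sq_lt_norm_div (hq0 : 0 < q) (hq1 : q < 1) (hz : z ∈ annulus q)
    (hw : w ∈ closedAnnulus q 1) : q ^ 2 < ‖z / w‖ := by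
  nlinarith [norm_div_gt hq0 hz hw]

theorem norm_div_mul_sq_lt (hq0 : 0 < q) (hq1 : q < 1) (hz : z ∈ annulus q)
    (hw : w ∈ closedAnnulus q 1) : ‖z / w‖ * q ^ 2 < 1 := by
  nlinarith [norm_div_mul_lt hq0 hz hw, norm_nonneg (z / w)]

theorem analyticAt_garabedianReg (hq0 : 0 < q) (hq1 : q < 1) (hz : z ∈ annulus q)
    (hw : w ∈ closedAnnulus q 1) : AnalyticAt ℂ (garabedianReg q z) w := by
  have hw0 := ne_zero_of_mem_closedAnnulus hq0 hw
  have h1 : AnalyticAt ℂ (fun w => lambertReg q (z / w)) w :=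
    (analyticAt_lambertReg hq0 hq1 (sq_lt_norm_div hq0 hq1 hz hw)
      (norm_div_mul_sq_lt hq0 hq1 hz hw)).fun_comp (g := lambertReg q) (analyticAt_const.div analyticAt_id hw0)
  exact analyticAt_const.add ((analyticAt_id.sub analyticAt_const).mul (h1.div analyticAt_id hw0))

theorem garabedianReg_div (hq0 : 0 < q) (hq1 : q < 1) (hz : z ∈ annulus q)
    (hw : w ∈ closedAnnulus q 1) (hwz : w ≠ z) :
    garabedianReg q z w / (w - z) = lambert q (z / w) / w := by
  have hw0 := ne_zero_of_mem_closedAnnulus hq0 hw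
  have h := sub_ne_zero.2 hwz
  rw [lambert_eq hq0 hq1 (sq_lt_norm_div hq0 hq1 hz hw) (norm_div_mul_sq_lt hq0 hq1 hz hw),
    garabedianReg]
  have h1 : 1 - z / w = (w - z) / w := by field_simp
  rw [h1]
  field_simp

/-- With `lambert_conj_mul_inner` this is the boundary relation between the Szegő and Garabedian
kernels: conj w is 1/w on the unit circle and q²/w on the inner circle. -/
theorem lambert_conj_mul_outer (hw : ‖w‖ = 1) : lambert q (conj w * z) = lambert q (z / w) := by
  congr 1
  have : conj w = w⁻¹ := by
    rw [Complex.inv_def, Complex.normSq_eq_norm_sq, hw]; simp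
  rw [this, div_eq_inv_mul]

theorem lambert_conj_mul_inner (hq0 : 0 < q) (hw : ‖w‖ = q) :
    lambert q (conj w * z) = -lambert q (z / w) / q := by
  rw [← lambert_sq_mul hq0]
  congr 1
  have hq : (q : ℂ) ≠ 0 := by exact_mod_cast hq0.ne'
  have : conj w = q ^ 2 * w⁻¹ := by
    rw [Complex.inv_def, Complex.normSq_eq_norm_sq, hw]
    push_cast
    field_simp
  rw [this, div_eq_inv_mul, mul_assoc]

/-- The Szegő kernel of the annulus as a Lambert series. -/
def szegoFun (q : ℝ) (w z : ℂ) : ℂ := lambert q (w * conj z) / (2 * Real.pi)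

theorem szegoFun_conj (q : ℝ) (w z : ℂ) : szegoFun q w z = conj (szegoFun q z w) := by
  rw [szegoFun, szegoFun, map_div₀, ← lambert_conj, ← Complex.ofReal_ofNat, ← Complex.ofReal_mul,
    Complex.conj_ofReal, map_mul, Complex.conj_conj, mul_comm]

theorem analyticAt_szegoFun (hq0 : 0 < q) (hq1 : q < 1) (hz : z ∈ annulus q)
    (hw : w ∈ closedAnnulus q 1) : AnalyticAt ℂ (fun w => szegoFun q w z) w := by
  have h0 : ‖w * conj z‖ = ‖w‖ * ‖z‖ := by rw [norm_mul, Complex.norm_conj]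
  have hz0 : 0 < ‖z‖ := hq0.trans hz.1
  have hlt : ‖w * conj z‖ < 1 := by
    rw [h0]; nlinarith [hz.1, hz.2, hw.1, hw.2]
  have h1 : AnalyticAt ℂ (fun w => lambert q (w * conj z)) w := by
    refine (analyticAt_lambert hq0 hq1 ?_ ?_ ?_).fun_comp (g := lambert q) (by fun_prop)
    · rw [h0]; nlinarith [hz.1, hz.2, hw.1, hw.2]
    · nlinarith [norm_nonneg (w * conj z)]
    · intro h
      rw [h, norm_one] at hlt
      exact lt_irrefl _ hlt
  exact h1.div_const

theorem continuousOn_szegoFun (hq0 : 0 < q) (hq1 : q < 1) (hz : z ∈ annulus q) :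
    ContinuousOn (fun w => szegoFun q w z) (closedAnnulus q 1) := fun _ hw =>
  (analyticAt_szegoFun hq0 hq1 hz hw).continuousAt.continuousWithinAt

theorem isHolSmooth_szegoFun (hq0 : 0 < q) (hq1 : q < 1) (hz : z ∈ annulus q) :
    IsHolSmooth (annulus q) (fun w => szegoFun q w z) := by
  constructor
  · exact fun w hw => (analyticAt_szegoFun hq0 hq1 hz
      (annulus_subset hw)).differentiableAt.differentiableWithinAt
  · rw [closure_annulus hq0 hq1]
    intro w hw
    exact ((analyticAt_szegoFun hq0 hq1 hz hw).contDiffAt.restrict_scalars ℝ).contDiffWithinAt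

/-- The reproducing property of the Szegő kernel on functions continuous up to the boundary. -/
theorem szego_reproducing (hq0 : 0 < q) (hq1 : q < 1) (hz : z ∈ annulus q) {f : ℂ → ℂ}
    (hc : ContinuousOn f (closedAnnulus q 1)) (hd : DifferentiableOn ℂ f (annulus q)) :
    ∫ w, conj (szegoFun q w z) * f w ∂annulusArcLength q = f z := by
  have hq : (q : ℂ) ≠ 0 := by exact_mod_cast hq0.ne'
  have hpi : (Real.pi : ℂ) ≠ 0 := by exact_mod_cast Real.pi_ne_zero
  have hU : IsOpen (annulus q) :=
    (isOpen_lt continuous_const continuous_norm).inter (isOpen_lt continuous_norm continuous_const)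
  rw [integral_annulusArcLength hq0 hq1 (g := fun w => conj (szegoFun q w z) * f w)
    ((Complex.continuous_conj.comp_continuousOn (continuousOn_szegoFun hq0 hq1 hz)).mul hc)]
  have hgc : ContinuousOn (garabedianReg q z) (closedAnnulus q 1) := fun w hw =>
    (analyticAt_garabedianReg hq0 hq1 hz hw).continuousAt.continuousWithinAt
  have hC := circleIntegral_annulus_cauchy (z := z) hq0 hz.1 hz.2 (f := fun w => garabedianReg q z w * f w)
    (hgc.mul hc) (fun w h1 h2 => (analyticAt_garabedianReg hq0 hq1 hz
      (annulus_subset ⟨h1, h2⟩)).differentiableAt.mul (hd.differentiableAt (hU.mem_nhds ⟨h1, h2⟩)))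
  rw [garabedianReg_self, one_mul] at hC
  -- Used with c = 1 outside and c = -q inside: the sign turns the difference of contour integrals
  -- into a sum, and q is the arc length density of the inner circle.
  have key : ∀ (t : ℝ) (c : ℂ), 0 < t → t ≠ ‖z‖ → (∀ w : ℂ, ‖w‖ = t → w ∈ closedAnnulus q 1) →
      (∀ w : ℂ, ‖w‖ = t → lambert q (z / w) = c * lambert q (conj w * z)) →
      (∮ w in C(0, t), garabedianReg q z w * f w / (w - z)) = 2 * Real.pi * Complex.I * c *
        ∫ θ in (0 : ℝ)..2 * Real.pi,
          conj (szegoFun q (circleMap 0 t θ) z) * f (circleMap 0 t θ) := by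
    intro t c ht htz hmem hl
    rw [circleIntegral, ← intervalIntegral.integral_const_mul]
    refine intervalIntegral.integral_congr fun θ _ => ?_
    simp only [deriv_circleMap, smul_eq_mul]
    set w := circleMap 0 t θ with hw
    have hwt : ‖w‖ = t := by rw [hw, norm_circleMap_zero, abs_of_pos ht]
    have hwz : w ≠ z := by
      rintro h
      rw [h] at hwt
      exact htz hwt.symm
    have hw0 := ne_zero_of_mem_closedAnnulus hq0 (hmem w hwt)
    rw [mul_div_right_comm, garabedianReg_div hq0 hq1 hz (hmem w hwt) hwz, hl w hwt,
      ← szegoFun_conj, szegoFun, mul_comm z]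
    field_simp
  rw [key 1 1 one_pos hz.2.ne' (fun w hw => ⟨hw ▸ hq1.le, hw.le⟩)
      (fun w hw => by rw [one_mul, lambert_conj_mul_outer hw]),
    key q (-q) hq0 hz.1.ne (fun w hw => ⟨hw.ge, hw ▸ hq1.le⟩)
      (fun w hw => by rw [lambert_conj_mul_inner hq0 hw]; field_simp)] at hC
  have h2 : 2 * Real.pi * Complex.I ≠ 0 := Complex.two_pi_I_ne_zero
  refine mul_left_cancel₀ h2 ?_
  rw [← hC]
  ring

end

/-- The kernel functions are smooth up to the boundary, so constant sequences witness their
extensions. The reproducing property passes to L² limits by continuity of the inner product on one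
side and locally uniform convergence on the other. -/
theorem isSzegoKernel_szegoFun {q : ℝ} (hq0 : 0 < q) (hq1 : q < 1) :
    IsSzegoKernel (annulus q) (annulusArcLength q) (szegoFun q) := by
  have hL : ∀ z ∈ annulus q, MemLp (fun w => szegoFun q w z) 2 (annulusArcLength q) :=
    fun z hz => memLp_of_continuousOn hq0 hq1 (continuousOn_szegoFun hq0 hq1 hz) 2
  classical
  refine ⟨fun z => if hz : z ∈ annulus q then (hL z hz).toLp _ else 0, ?_, ?_, ?_⟩
  · intro z hz
    simp only [dif_pos hz]
    refine ⟨subset_closure ⟨_, isHolSmooth_szegoFun hq0 hq1 hz, (hL z hz).coeFn_toLp⟩,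
      fun _ w => szegoFun q w z, fun _ => isHolSmooth_szegoFun hq0 hq1 hz, ?_, ?_⟩
    · have : eLpNorm (fun w => szegoFun q w z - (hL z hz).toLp _ w) 2 (annulusArcLength q) = 0 := by
        rw [← eLpNorm_zero (ε := ℂ) (p := 2) (μ := annulusArcLength q)]
        refine eLpNorm_congr_ae ?_
        filter_upwards [(hL z hz).coeFn_toLp] with w hw
        simp [hw]
      simpa only [this] using tendsto_const_nhds
    · intro u hu x hx
      exact ⟨univ, univ_mem, Eventually.of_forall fun _ _ _ => refl_mem_uniformity hu⟩
  · exact fun z _ w _ => szegoFun_conj q z w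
  · rintro h - F ⟨f, hf, hlim, hloc⟩ z hz
    simp only [dif_pos hz]
    have hfc : ∀ n, ContinuousOn (f n) (closedAnnulus q 1) := fun n => by
      rw [← closure_annulus hq0 hq1]
      exact (hf n).2.continuousOn
    have hfL : ∀ n, MemLp (f n) 2 (annulusArcLength q) :=
      fun n => memLp_of_continuousOn hq0 hq1 (hfc n) 2
    have ht : Tendsto (fun n => (hfL n).toLp (f n)) atTop (𝓝 h) := by
      rw [← Lp.toLp_coeFn h (Lp.memLp h)]
      exact (Lp.tendsto_Lp_iff_tendsto_eLpNorm'' f hfL h (Lp.memLp h)).2 hlim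
    have hin : Tendsto (fun n => inner ℂ ((hL z hz).toLp _) ((hfL n).toLp (f n))) atTop
        (𝓝 (inner ℂ ((hL z hz).toLp _) h)) := tendsto_const_nhds.inner ht
    have hval : ∀ n, inner ℂ ((hL z hz).toLp _) ((hfL n).toLp (f n)) = f n z := by
      intro n
      rw [L2.inner_def, ← szego_reproducing hq0 hq1 hz (hfc n) (hf n).1]
      refine integral_congr_ae ?_
      filter_upwards [(hL z hz).coeFn_toLp, (hfL n).coeFn_toLp] with w h1 h2
      rw [h1, h2, RCLike.inner_apply, mul_comm]
    simp only [hval] at hin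
    rw [tendsto_nhds_unique (hloc.tendsto_at hz) hin, L2.inner_def]
    refine integral_congr_ae (Eventually.of_forall fun w => ?_)
    simp only [RCLike.inner_apply]
    rw [mul_comm]

/-- There is at most one Szegő kernel. -/
theorem IsSzegoKernel.unique {Ω : Set ℂ} {σ : Measure ℂ} {S S' : ℂ → ℂ → ℂ}
    (h : IsSzegoKernel Ω σ S) (h' : IsSzegoKernel Ω σ S') {z ζ : ℂ} (hz : z ∈ Ω) (hζ : ζ ∈ Ω) :
    S z ζ = S' z ζ := by
  obtain ⟨k, hk, hs, hr⟩ := h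
  obtain ⟨k', hk', hs', hr'⟩ := h'
  -- Each kernel reproduces the kernel function of the other, so both values are the same inner
  -- product up to conjugation.
  have e1 := hr (k' ζ) (hk' ζ hζ).1 _ (hk' ζ hζ).2 z hz
  have e2 := hr' (k z) (hk z hz).1 _ (hk z hz).2 ζ hζ
  rw [hs z hz ζ hζ, e2, e1, ← integral_conj]
  refine integral_congr_ae (Eventually.of_forall fun w => ?_)
  simp [mul_comm]

theorem SAnn_eq {q : ℝ} (hq0 : 0 < q) (hq1 : q < 1) {z : ℂ} (hz : z ∈ annulus q) :
    SAnn q z = lambertR q (‖z‖ ^ 2) / (2 * Real.pi) := by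
  have hex : ∃ S, IsSzegoKernel (annulus q) (annulusArcLength q) S :=
    ⟨_, isSzegoKernel_szegoFun hq0 hq1⟩
  have : szegoKernel (annulus q) (annulusArcLength q) z z = szegoFun q z z := by
    rw [szegoKernel, dif_pos hex]
    exact hex.choose_spec.unique (isSzegoKernel_szegoFun hq0 hq1) hz hz
  rw [SAnn, szegoDiag, this, szegoFun, Complex.mul_conj, Complex.normSq_eq_norm_sq, lambert_ofReal,
    ← Complex.ofReal_ofNat, ← Complex.ofReal_mul, ← Complex.ofReal_div, Complex.ofReal_re]

/-- The value is 2π times S(√t, √t), the squared L² norm of a kernel function, hence nonnegative;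
the elliptic function excludes zero. -/
theorem lambertR_pos {q : ℝ} (hq0 : 0 < q) (hq1 : q < 1) {t : ℝ} (h1 : q ^ 2 < t) (h2 : t < 1) :
    0 < lambertR q t := by
  have ht : 0 < t := lt_trans (by positivity) h1
  have hst : 0 < √t := Real.sqrt_pos.2 ht
  have hz : (√t : ℂ) ∈ annulus q := by
    constructor
    · rw [Complex.norm_real, Real.norm_of_nonneg hst.le]
      exact Real.lt_sqrt_of_sq_lt h1
    · rw [Complex.norm_real, Real.norm_of_nonneg hst.le, Real.sqrt_lt' one_pos]
      simpa using h2
  have h := szego_reproducing hq0 hq1 hz (continuousOn_szegoFun hq0 hq1 hz)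
    (isHolSmooth_szegoFun hq0 hq1 hz).1
  have h3 : szegoFun q (√t : ℂ) (√t : ℂ) = (lambertR q t / (2 * Real.pi) : ℝ) := by
    rw [szegoFun, Complex.conj_ofReal, ← Complex.ofReal_mul, Real.mul_self_sqrt ht.le, lambert_ofReal]
    push_cast
    rfl
  have h4 : ∀ w, conj (szegoFun q w (√t : ℂ)) * szegoFun q w (√t : ℂ) =
      ((‖szegoFun q w (√t : ℂ)‖ ^ 2 : ℝ) : ℂ) := fun w => by
    rw [mul_comm, Complex.mul_conj, Complex.normSq_eq_norm_sq]
  simp only [h4] at h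
  rw [integral_complex_ofReal, h3] at h
  have h5 : 0 ≤ lambertR q t / (2 * Real.pi) := by
    rw [← Complex.ofReal_injective h]
    exact integral_nonneg fun w => by positivity
  have h6 : 0 ≤ lambertR q t := by
    have := mul_nonneg h5 Real.two_pi_pos.le
    rwa [div_mul_cancel₀ _ Real.two_pi_pos.ne'] at this
  exact lt_of_le_of_ne h6 (lambertR_ne_zero hq0 hq1 h1 h2).symm

/-! ### The Carathéodory metric of the annulus -/

/-- This is `exists_ellF_mul_eq` at u = log x, where e^ω = -q turns the translation by ω into x ↦
-x/q. It expresses 1/s(x) through s, so that the quotient S/L can be written without division. -/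
theorem exists_lambert_mul_eq {q : ℝ} (hq0 : 0 < q) (hq1 : q < 1) : ∃ C : ℂ, C ≠ 0 ∧
    ∀ x : ℂ, q < ‖x‖ → ‖x‖ * q < 1 → x ≠ 1 → x * lambert q x * lambert q (-x / q) = C := by
  have hL : Real.log q < 0 := Real.log_neg hq0 hq1
  obtain ⟨C, hC0, hC⟩ := exists_ellF_mul_eq hq0 hq1
  refine ⟨C * Complex.exp (omega q / 2), mul_ne_zero hC0 (Complex.exp_ne_zero _), ?_⟩
  intro x h1 h2 h3
  have hx : 0 < ‖x‖ := hq0.trans h1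
  have hexp : Complex.exp (Complex.log x) = x := Complex.exp_log (norm_pos_iff.1 hx)
  have h4 : Real.log q < (Complex.log x).re := by
    rw [Complex.log_re]; exact Real.log_lt_log hq0 h1
  have h5 : (Complex.log x).re < -Real.log q := by
    rw [Complex.log_re, ← Real.log_inv]
    refine Real.log_lt_log hx ?_
    rwa [← one_div, lt_div_iff₀ hq0]
  have h := hC (Complex.log x) (by linarith) h5 (by rwa [hexp]) (by
    rw [hexp]
    rintro rfl
    rw [norm_neg, Complex.norm_real, Real.norm_of_nonneg hq0.le] at h1
    exact lt_irrefl _ h1)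
  rw [← h, ellF, ellF, Complex.exp_sub, exp_omega hq0, hexp, div_neg, ← neg_div, sub_div,
    Complex.exp_sub]
  have e := Complex.exp_ne_zero (omega q / 2)
  have e2 : Complex.exp (Complex.log x / 2) * Complex.exp (Complex.log x / 2) = x := by
    rw [← Complex.exp_add, add_halves, hexp]
  field_simp
  rw [sq, e2]
  ring

theorem lambert_neg_self {q : ℝ} (hq0 : 0 < q) : lambert q (-q) = 0 := by
  have h := ellF_omega hq0
  rw [ellF, exp_omega hq0] at h
  exact (mul_eq_zero.1 h).resolve_left (Complex.exp_ne_zero _)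

/-- Competitors in the extremal problem live on the open annulus only; estimates made on interior
circles are pushed to the boundary with this. -/
theorem tendsto_integral_circle {g : ℂ → ℂ} {α β t₀ : ℝ} (hα : 0 < α)
    (hg : ContinuousOn g (closedAnnulus α β)) (ht₀ : t₀ ∈ Icc α β) :
    Tendsto (fun t : ℝ => ∫ θ in (0 : ℝ)..2 * Real.pi, t * ‖g (circleMap 0 t θ)‖ ^ 2)
      (𝓝[Icc α β] t₀) (𝓝 (∫ θ in (0 : ℝ)..2 * Real.pi, t₀ * ‖g (circleMap 0 t₀ θ)‖ ^ 2)) := by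
  obtain ⟨B, hB⟩ := (isCompact_closedAnnulus α β).exists_bound_of_continuousOn hg
  have hmem : ∀ t ∈ Icc α β, ∀ θ : ℝ, circleMap 0 t θ ∈ closedAnnulus α β := by
    intro t ht θ
    have : ‖circleMap 0 t θ‖ = t := by rw [norm_circleMap_zero, abs_of_pos (hα.trans_le ht.1)]
    exact ⟨ht.1.trans this.ge, this.le.trans ht.2⟩
  refine intervalIntegral.tendsto_integral_filter_of_dominated_convergence (fun _ => β * B ^ 2)
    ?_ ?_ ?_ ?_
  · filter_upwards [self_mem_nhdsWithin] with t ht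
    have : Continuous fun θ : ℝ => g (circleMap 0 t θ) :=
      hg.comp_continuous (continuous_circleMap 0 t) (hmem t ht)
    exact (continuous_const.mul (this.norm.pow 2)).aestronglyMeasurable
  · filter_upwards [self_mem_nhdsWithin] with t ht
    refine Eventually.of_forall fun θ _ => ?_
    have h1 := hB _ (hmem t ht θ)
    have h2 : 0 ≤ t := hα.le.trans ht.1
    rw [Real.norm_of_nonneg (by positivity)]
    have := norm_nonneg (g (circleMap 0 t θ))
    have h3 := ht.2
    have h4 := h2.trans h3
    gcongr
  · exact intervalIntegrable_const
  · refine Eventually.of_forall fun θ _ => ?_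
    have h1 : Tendsto (fun t : ℝ => circleMap 0 t θ) (𝓝[Icc α β] t₀)
        (𝓝[closedAnnulus α β] (circleMap 0 t₀ θ)) := by
      refine tendsto_nhdsWithin_of_tendsto_nhds_of_eventually_within _ ?_ ?_
      · have : Continuous fun t : ℝ => circleMap 0 t θ := by
          unfold circleMap; fun_prop
        exact (this.tendsto t₀).mono_left nhdsWithin_le_nhds
      · filter_upwards [self_mem_nhdsWithin] with t ht using hmem t ht θ
    have h2 := (hg _ (hmem t₀ ht₀ θ)).tendsto.comp h1
    exact (tendsto_nhdsWithin_of_tendsto_nhds tendsto_id).mul (h2.norm.pow 2)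

section
variable {q : ℝ} {a : ℂ}

theorem isOpen_annulus (q : ℝ) : IsOpen (annulus q) :=
  (isOpen_lt continuous_const continuous_norm).inter (isOpen_lt continuous_norm continuous_const)

/-- The reproducing property applied to S(·, a) itself gives its L² norm, and the boundary relation
rewrites |S| as |L| on both circles. -/
theorem szego_norm_sq (hq0 : 0 < q) (hq1 : q < 1) (ha : a ∈ annulus q) :
    (∫ θ in (0 : ℝ)..2 * Real.pi, (1 : ℝ) *
      ‖lambert q (a / circleMap 0 1 θ) / circleMap 0 1 θ‖ ^ 2) +
    (∫ θ in (0 : ℝ)..2 * Real.pi, q *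
      ‖lambert q (a / circleMap 0 q θ) / circleMap 0 q θ‖ ^ 2) =
      2 * Real.pi * lambertR q (‖a‖ ^ 2) := by
  have hpi := Real.pi_pos
  have h := szego_reproducing hq0 hq1 ha (continuousOn_szegoFun hq0 hq1 ha)
    (isHolSmooth_szegoFun hq0 hq1 ha).1
  have h3 : szegoFun q a a = (lambertR q (‖a‖ ^ 2) / (2 * Real.pi) : ℝ) := by
    rw [szegoFun, Complex.mul_conj, Complex.normSq_eq_norm_sq, lambert_ofReal]
    push_cast
    rfl
  rw [integral_annulusArcLength hq0 hq1 (g := fun w => conj (szegoFun q w a) * szegoFun q w a)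
    ((Complex.continuous_conj.comp_continuousOn (continuousOn_szegoFun hq0 hq1 ha)).mul
    (continuousOn_szegoFun hq0 hq1 ha)), h3] at h
  have h4 : ∀ w, conj (szegoFun q w a) * szegoFun q w a =
      ((‖lambert q (conj w * a)‖ ^ 2 / (2 * Real.pi) ^ 2 : ℝ) : ℂ) := fun w => by
    rw [mul_comm, Complex.mul_conj, Complex.normSq_eq_norm_sq, szegoFun_conj, szegoFun,
      Complex.norm_conj, norm_div, div_pow, mul_comm a]
    congr 3
    rw [norm_mul, Complex.norm_real, Real.norm_of_nonneg hpi.le]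
    simp
  simp only [h4] at h
  rw [intervalIntegral.integral_ofReal, intervalIntegral.integral_ofReal, ← Complex.ofReal_mul,
    ← Complex.ofReal_add] at h
  have h5 := Complex.ofReal_injective h
  rw [intervalIntegral.integral_div, intervalIntegral.integral_div] at h5
  have e1 : (∫ θ in (0 : ℝ)..2 * Real.pi, (1 : ℝ) *
      ‖lambert q (a / circleMap 0 1 θ) / circleMap 0 1 θ‖ ^ 2) =
      ∫ θ in (0 : ℝ)..2 * Real.pi, ‖lambert q (conj (circleMap 0 1 θ) * a)‖ ^ 2 := by
    refine intervalIntegral.integral_congr fun θ _ => ?_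
    have hw : ‖circleMap 0 1 θ‖ = 1 := by rw [norm_circleMap_zero, abs_one]
    simp only [lambert_conj_mul_outer hw, norm_div, hw, div_one, one_mul]
  have e2 : (∫ θ in (0 : ℝ)..2 * Real.pi, q *
      ‖lambert q (a / circleMap 0 q θ) / circleMap 0 q θ‖ ^ 2) =
      q * ∫ θ in (0 : ℝ)..2 * Real.pi, ‖lambert q (conj (circleMap 0 q θ) * a)‖ ^ 2 := by
    rw [← intervalIntegral.integral_const_mul]
    refine intervalIntegral.integral_congr fun θ _ => ?_
    have hw : ‖circleMap 0 q θ‖ = q := by rw [norm_circleMap_zero, abs_of_pos hq0]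
    simp only [lambert_conj_mul_inner hq0 hw, norm_div, hw, norm_neg, Complex.norm_real,
      Real.norm_of_nonneg hq0.le]
  rw [e1, e2]
  set I₁ := ∫ θ in (0 : ℝ)..2 * Real.pi, ‖lambert q (conj (circleMap 0 1 θ) * a)‖ ^ 2
  set I₂ := ∫ θ in (0 : ℝ)..2 * Real.pi, ‖lambert q (conj (circleMap 0 q θ) * a)‖ ^ 2
  field_simp at h5
  linarith

/-- Cauchy's formula at `a` for the slope of f times `garabedianReg` squared produces f'(a), because
the regularised kernel is 1 there. On the circles the integrand is f g² with g = 2πL, and |f| ≤ 1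
leaves the integral of |g|², evaluated by `szego_norm_sq` in the limit. -/
theorem norm_deriv_le_of_mapsTo_ball (hq0 : 0 < q) (hq1 : q < 1) (ha : a ∈ annulus q) {f : ℂ → ℂ}
    (hf : DifferentiableOn ℂ f (annulus q)) (hm : MapsTo f (annulus q) (Metric.ball 0 1))
    (hfa : f a = 0) : ‖deriv f a‖ ≤ lambertR q (‖a‖ ^ 2) := by
  have hpi := Real.two_pi_pos
  set g : ℂ → ℂ := fun w => lambert q (a / w) / w with hg
  set J : ℝ → ℝ := fun t => ∫ θ in (0 : ℝ)..2 * Real.pi, t * ‖g (circleMap 0 t θ)‖ ^ 2 with hJ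
  have hgc : ∀ {ρ R : ℝ}, q ≤ ρ → R ≤ 1 → (R < ‖a‖ ∨ ‖a‖ < ρ) →
      ContinuousOn g (closedAnnulus ρ R) := by
    intro ρ R h1 h2 h3 w hw
    have hw' : w ∈ closedAnnulus q 1 := ⟨h1.trans hw.1, hw.2.trans h2⟩
    have hw0 := ne_zero_of_mem_closedAnnulus hq0 hw'
    have hwa : a / w ≠ 1 := by
      intro h
      rw [div_eq_one_iff_eq hw0] at h
      rcases h3 with h3 | h3
      · exact absurd hw.2 (by rw [← h]; exact not_le.2 h3)
      · exact absurd hw.1 (by rw [← h]; exact not_le.2 h3)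
    exact ((((analyticAt_lambert hq0 hq1 (sq_lt_norm_div hq0 hq1 ha hw')
      (norm_div_mul_sq_lt hq0 hq1 ha hw') hwa).fun_comp (g := lambert q)
      (analyticAt_const.div analyticAt_id hw0)).div
      analyticAt_id hw0).continuousAt).continuousWithinAt
  set d : ℂ → ℂ := dslope f a with hd
  have hdd : DifferentiableOn ℂ d (annulus q) :=
    (Complex.differentiableOn_dslope ((isOpen_annulus q).mem_nhds ha)).2 hf
  have hbound : ∀ ρ R : ℝ, q < ρ → ρ < ‖a‖ → ‖a‖ < R → R < 1 →
      2 * Real.pi * ‖deriv f a‖ ≤ J R + J ρ := by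
    intro ρ R h1 h2 h3 h4
    have hsub : closedAnnulus ρ R ⊆ annulus q := fun w hw =>
      ⟨h1.trans_le hw.1, hw.2.trans_lt h4⟩
    have hφd : ∀ w ∈ annulus q, DifferentiableAt ℂ (fun w => d w * garabedianReg q a w ^ 2) w :=
      fun w hw => (hdd.differentiableAt ((isOpen_annulus q).mem_nhds hw)).mul
        ((analyticAt_garabedianReg hq0 hq1 ha (annulus_subset hw)).differentiableAt.pow 2)
    have hC := circleIntegral_annulus_cauchy (hq0.trans h1) h2 h3
      (f := fun w => d w * garabedianReg q a w ^ 2)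
      (fun w hw => (hφd w (hsub hw)).continuousAt.continuousWithinAt)
      (fun w hw1 hw2 => hφd w (hsub ⟨hw1.le, hw2.le⟩))
    rw [garabedianReg_self, one_pow, mul_one, hd, dslope_same] at hC
    have hcirc : ∀ t : ℝ, q < t → t < 1 → t ≠ ‖a‖ → ContinuousOn g (closedAnnulus t t) →
        ‖∮ w in C(0, t), d w * garabedianReg q a w ^ 2 / (w - a)‖ ≤ J t := by
      intro t ht1 ht2 hta htc
      rw [circleIntegral]
      refine intervalIntegral.norm_integral_le_of_norm_le hpi.le
        (Eventually.of_forall fun θ _ => ?_) ?_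
      · have ht0 := hq0.trans ht1
        set w := circleMap 0 t θ with hw
        have hwt : ‖w‖ = t := by rw [hw, norm_circleMap_zero, abs_of_pos ht0]
        have hwa : w ≠ a := by
          rintro h
          rw [h] at hwt
          exact hta hwt.symm
        have hwm : w ∈ annulus q := ⟨hwt ▸ ht1, hwt ▸ ht2⟩
        -- One factor w - a comes from the slope, the other from the Cauchy kernel.
        have e : d w * garabedianReg q a w ^ 2 / (w - a) = f w * g w ^ 2 := by
          have hne := sub_ne_zero.2 hwa
          have e2 := garabedianReg_div hq0 hq1 ha (annulus_subset hwm) hwa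
          simp only [hg]
          rw [← e2, hd, dslope_of_ne _ hwa, slope_def_field, hfa, sub_zero]
          field_simp
        rw [e, deriv_circleMap, norm_smul, norm_mul, norm_mul, norm_pow, ← hw, hwt,
          Complex.norm_I, mul_one]
        have hf1 : ‖f w‖ ≤ 1 := (mem_ball_zero_iff.1 (hm hwm)).le
        have : ‖f w‖ * ‖g w‖ ^ 2 ≤ ‖g w‖ ^ 2 := mul_le_of_le_one_left (by positivity) hf1
        gcongr
      · have : Continuous fun θ : ℝ => g (circleMap 0 t θ) :=
          htc.comp_continuous (continuous_circleMap 0 t) fun θ => by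
            have : ‖circleMap 0 t θ‖ = t := by rw [norm_circleMap_zero, abs_of_pos (hq0.trans ht1)]
            exact ⟨this.ge, this.le⟩
        exact (continuous_const.mul (this.norm.pow 2)).intervalIntegrable _ _
    have e : ‖2 * Real.pi * Complex.I * deriv f a‖ = 2 * Real.pi * ‖deriv f a‖ := by
      rw [norm_mul, norm_mul, norm_mul, Complex.norm_real, Complex.norm_I,
        Real.norm_of_nonneg Real.pi_pos.le]
      simp
    rw [← e, ← hC]
    exact (norm_sub_le _ _).trans (add_le_add
      (hcirc R (h1.trans (h2.trans h3)) h4 h3.ne' (hgc (h1.trans (h2.trans h3)).le h4.le (Or.inr h3)))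
      (hcirc ρ h1 ((h2.trans h3).trans h4) h2.ne
        (hgc h1.le ((h2.trans h3).trans h4).le (Or.inl h2))))
  obtain ⟨ρ₀, hρ1, hρ2⟩ := exists_between ha.1
  obtain ⟨R₀, hR1, hR2⟩ := exists_between ha.2
  have hlim1 : Tendsto J (𝓝[>] q) (𝓝 (J q)) := by
    refine (tendsto_integral_circle hq0 (hgc le_rfl (hρ2.trans ha.2).le (Or.inl hρ2))
      (left_mem_Icc.2 hρ1.le)).mono_left ?_
    rw [← nhdsWithin_Ioc_eq_nhdsGT hρ1]
    exact nhdsWithin_mono _ Ioc_subset_Icc_self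
  have hlim2 : Tendsto J (𝓝[<] 1) (𝓝 (J 1)) := by
    refine (tendsto_integral_circle ((hq0.trans ha.1).trans hR1)
      (hgc (ha.1.trans hR1).le le_rfl (Or.inr hR1)) (right_mem_Icc.2 hR2.le)).mono_left ?_
    rw [← nhdsWithin_Ico_eq_nhdsLT hR2]
    exact nhdsWithin_mono _ Ico_subset_Icc_self
  have hb1 : ∀ ρ : ℝ, q < ρ → ρ < ‖a‖ → 2 * Real.pi * ‖deriv f a‖ ≤ J 1 + J ρ := by
    intro ρ h1 h2
    refine ge_of_tendsto (hlim2.add_const (J ρ)) ?_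
    filter_upwards [Ioo_mem_nhdsLT ha.2] with R hR using hbound ρ R h1 h2 hR.1 hR.2
  have hb2 : 2 * Real.pi * ‖deriv f a‖ ≤ J 1 + J q := by
    refine ge_of_tendsto (hlim1.const_add (J 1)) ?_
    filter_upwards [Ioo_mem_nhdsGT ha.1] with ρ hρ using hb1 ρ hρ.1 hρ.2
  have hs : J 1 + J q = 2 * Real.pi * lambertR q (‖a‖ ^ 2) := szego_norm_sq hq0 hq1 ha
  rw [hs] at hb2
  exact le_of_mul_le_mul_left hb2 hpi

/-- The Ahlfors function of the annulus: a holomorphic function bounded by `1` which vanishes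
at `a` and has derivative `s(|a|²)` there. -/
theorem exists_ahlfors (hq0 : 0 < q) (hq1 : q < 1) (ha : a ∈ annulus q) : ∃ f : ℂ → ℂ,
    DifferentiableOn ℂ f (annulus q) ∧ (∀ w ∈ annulus q, ‖f w‖ ≤ 1) ∧ f a = 0 ∧
      deriv f a = lambertR q (‖a‖ ^ 2) := by
  obtain ⟨C, hC0, hC⟩ := exists_lambert_mul_eq hq0 hq1
  have hpi : (Real.pi : ℂ) ≠ 0 := by exact_mod_cast Real.pi_ne_zero
  have hq : (q : ℂ) ≠ 0 := by exact_mod_cast hq0.ne'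
  have ha0 : a ≠ 0 := norm_pos_iff.1 (hq0.trans ha.1)
  -- The quotient S/L, with the reciprocal of s(a/w)/w replaced by (a/C) s(-(a/w)/q).
  set f : ℂ → ℂ := fun w => a / C * lambert q (w * conj a) * lambert q (-(a / w) / q) with hf
  have hla : ∀ w ∈ closedAnnulus q 1, AnalyticAt ℂ (fun w => lambert q (w * conj a)) w := by
    intro w hw
    have := (analyticAt_szegoFun hq0 hq1 ha hw).mul (analyticAt_const (v := 2 * (Real.pi : ℂ)))
    refine this.congr (Eventually.of_forall fun v => ?_)
    simp only [Pi.mul_apply, szegoFun]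
    field_simp
  have hfa : ∀ w ∈ closedAnnulus q 1, AnalyticAt ℂ f w := by
    intro w hw
    have hw0 := ne_zero_of_mem_closedAnnulus hq0 hw
    have hn : ‖-(a / w) / q‖ = ‖a / w‖ / q := by
      rw [norm_div, norm_neg, Complex.norm_real, Real.norm_of_nonneg hq0.le]
    have h1 : 1 < ‖-(a / w) / q‖ := by
      rw [hn, one_lt_div hq0]; exact norm_div_gt hq0 ha hw
    have h2 : ‖-(a / w) / q‖ * q ^ 2 < 1 := by
      rw [hn]
      have : ‖a / w‖ / q * q ^ 2 = ‖a / w‖ * q := by field_simp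
      rw [this]
      exact norm_div_mul_lt hq0 ha hw
    have h3 : AnalyticAt ℂ (fun w => lambert q (-(a / w) / q)) w := by
      have hin : AnalyticAt ℂ (fun w => -(a / w) / (q : ℂ)) w :=
        (analyticAt_const.div analyticAt_id hw0).neg.div_const
      refine AnalyticAt.fun_comp (g := lambert q) (analyticAt_lambert hq0 hq1 ?_ h2 ?_) hin
      · nlinarith
      · intro h
        rw [h, norm_one] at h1
        exact lt_irrefl _ h1
    exact (analyticAt_const.mul (hla w hw)).mul h3
  have hquot : ∀ w ∈ closedAnnulus q 1, w ≠ a →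
      f w * (lambert q (a / w) / w) = lambert q (w * conj a) := by
    intro w hw hwa
    have hw0 := ne_zero_of_mem_closedAnnulus hq0 hw
    have h := hC (a / w) (norm_div_gt hq0 ha hw) (norm_div_mul_lt hq0 ha hw)
      (by rw [Ne, div_eq_one_iff_eq hw0]; exact hwa.symm)
    simp only [hf]
    calc a / C * lambert q (w * conj a) * lambert q (-(a / w) / q) * (lambert q (a / w) / w)
        = (a / w * lambert q (a / w) * lambert q (-(a / w) / q)) / C * lambert q (w * conj a) := by
          ring
      _ = _ := by rw [h, div_self hC0, one_mul]
  have hne : ∀ w ∈ closedAnnulus q 1, w ≠ a → lambert q (a / w) ≠ 0 := by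
    intro w hw hwa h0
    have hw0 := ne_zero_of_mem_closedAnnulus hq0 hw
    have h := hC (a / w) (norm_div_gt hq0 ha hw) (norm_div_mul_lt hq0 ha hw)
      (by rw [Ne, div_eq_one_iff_eq hw0]; exact hwa.symm)
    rw [h0, mul_zero, zero_mul] at h
    exact hC0 h.symm
  have hconj : ∀ w, ‖lambert q (w * conj a)‖ = ‖lambert q (conj w * a)‖ := by
    intro w
    rw [← Complex.norm_conj, ← lambert_conj, map_mul, Complex.conj_conj]
  have hfa0 : f a = 0 := by
    simp only [hf]
    have : lambert q (-(a / a) / q) = 0 := by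
      have e : -(a / a) / (q : ℂ) = (-q : ℂ)⁻¹ := by
        rw [div_self ha0, inv_neg, neg_div, one_div]
      rw [e, lambert_inv hq0 (neg_ne_zero.2 hq), lambert_neg_self hq0, mul_zero]
    rw [this, mul_zero]
  refine ⟨f, fun w hw => (hfa w (annulus_subset hw)).differentiableAt.differentiableWithinAt,
    ?_, hfa0, ?_⟩
  · intro w hw
    -- Maximum principle: on both boundary circles numerator and denominator of S/L have equal
    -- modulus.
    refine Complex.norm_le_of_forall_mem_frontier_norm_le (U := annulus q) ?_ ?_ ?_
      (subset_closure hw)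
    · exact (isCompact_closedAnnulus q 1).isBounded.subset annulus_subset
    · constructor
      · exact fun w hw => (hfa w (annulus_subset hw)).differentiableAt.differentiableWithinAt
      · rw [closure_annulus hq0 hq1]
        exact fun w hw => (hfa w hw).continuousAt.continuousWithinAt
    · intro w hw
      rw [(isOpen_annulus q).frontier_eq, closure_annulus hq0 hq1] at hw
      obtain ⟨hw1, hw2⟩ := hw
      have hwa : w ≠ a := fun h => hw2 (h ▸ ha)
      have h1 := congrArg norm (hquot w hw1 hwa)
      rw [norm_mul, norm_div, hconj] at h1
      have h2 : 0 < ‖lambert q (a / w)‖ := norm_pos_iff.2 (hne w hw1 hwa)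
      have h3 : ‖w‖ = 1 ∨ ‖w‖ = q := by
        by_contra! h
        exact hw2 ⟨lt_of_le_of_ne hw1.1 h.2.symm, lt_of_le_of_ne hw1.2 h.1⟩
      rcases h3 with h3 | h3
      · rw [lambert_conj_mul_outer h3, h3, div_one] at h1
        exact (mul_eq_right₀ h2.ne').1 h1 |>.le
      · rw [lambert_conj_mul_inner hq0 h3, h3, norm_div, norm_neg, Complex.norm_real,
          Real.norm_of_nonneg hq0.le] at h1
        exact (mul_eq_right₀ (div_pos h2 hq0).ne').1 h1 |>.le
  · have ha' := annulus_subset ha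
    have hG := analyticAt_garabedianReg hq0 hq1 ha ha'
    -- Both sides are differentiated at `a`, where f vanishes and the regularised kernel equals 1.
    have hev : (fun w => f w * garabedianReg q a w) =ᶠ[𝓝 a]
        fun w => (w - a) * lambert q (w * conj a) := by
      filter_upwards [(isOpen_annulus q).mem_nhds ha] with w hw
      by_cases hwa : w = a
      · rw [hwa, hfa0]; ring
      · have hw' := annulus_subset hw
        rw [← hquot w hw' hwa, ← garabedianReg_div hq0 hq1 ha hw' hwa]
        have := sub_ne_zero.2 hwa
        field_simp
    have h1 := ((hfa a ha').differentiableAt.hasDerivAt.mul hG.differentiableAt.hasDerivAt).deriv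
    have h2 := (((hasDerivAt_id a).sub_const a).mul
      (hla a ha').differentiableAt.hasDerivAt).deriv
    simp only [hfa0, garabedianReg_self, mul_one, zero_mul, add_zero] at h1
    simp only [id, sub_self, zero_mul, add_zero, one_mul] at h2
    have h3 := hev.deriv_eq
    rw [← lambert_ofReal]
    rw [← h1]
    refine h3.trans (h2.trans ?_)
    rw [Complex.mul_conj, Complex.normSq_eq_norm_sq]

/-- The Ahlfors function is only known to satisfy |f| ≤ 1, while competitors must map into the open
disc; it is scaled by c < 1 and then c → 1. -/
theorem cAnn_eq (hq0 : 0 < q) (hq1 : q < 1) (ha : a ∈ annulus q) :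
    cAnn q a = lambertR q (‖a‖ ^ 2) := by
  have hub : ∀ t ∈ {t : ℝ | ∃ f : ℂ → ℂ, DifferentiableOn ℂ f (annulus q) ∧
      MapsTo f (annulus q) (Metric.ball (0 : ℂ) 1) ∧ f a = 0 ∧ t = ‖deriv f a‖},
      t ≤ lambertR q (‖a‖ ^ 2) := by
    rintro t ⟨f, h1, h2, h3, rfl⟩
    exact norm_deriv_le_of_mapsTo_ball hq0 hq1 ha h1 h2 h3
  obtain ⟨f, h1, h2, h3, h4⟩ := exists_ahlfors hq0 hq1 ha
  have hpos : 0 < lambertR q (‖a‖ ^ 2) := by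
    refine lambertR_pos hq0 hq1 ?_ ?_
    · have := ha.1
      gcongr
    · have := ha.2
      have := norm_nonneg a
      nlinarith
  have hlow : ∀ c : ℝ, 0 < c → c < 1 → c * lambertR q (‖a‖ ^ 2) ≤ cAnn q a := by
    intro c hc0 hc1
    refine le_csSup ⟨_, hub⟩ ⟨fun w => c * f w, h1.const_mul _, ?_, by simp [h3], ?_⟩
    · intro w hw
      rw [mem_ball_zero_iff, norm_mul, Complex.norm_real, Real.norm_of_nonneg hc0.le]
      nlinarith [h2 w hw, norm_nonneg (f w)]
    · rw [deriv_const_mul_field, h4, norm_mul, Complex.norm_real, Complex.norm_real,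
        Real.norm_of_nonneg hc0.le, Real.norm_of_nonneg hpos.le]
  apply le_antisymm
  · exact csSup_le ⟨_, fun _ => 0, differentiableOn_const 0,
      fun w _ => by simp, rfl, rfl⟩ hub
  · have ht : Tendsto (fun c : ℝ => c * lambertR q (‖a‖ ^ 2)) (𝓝[<] 1)
        (𝓝 (1 * lambertR q (‖a‖ ^ 2))) :=
      (tendsto_nhdsWithin_of_tendsto_nhds tendsto_id).mul_const _
    rw [one_mul] at ht
    refine le_of_tendsto ht ?_
    filter_upwards [Ioo_mem_nhdsLT (zero_lt_one' ℝ)] with c hc using hlow c hc.1 hc.2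

end

/-! ### Second derivatives of radial functions -/

theorem hasFDerivAt_norm_sq (w : ℂ) : HasFDerivAt (fun w : ℂ => ‖w‖ ^ 2)
    ((2 * w.re) • Complex.reCLM + (2 * w.im) • Complex.imCLM) w := by
  have h1 := (hasDerivAt_pow 2 (Complex.reCLM w)).comp_hasFDerivAt w
    (Complex.reCLM.hasFDerivAt (x := w))
  have h2 := (hasDerivAt_pow 2 (Complex.imCLM w)).comp_hasFDerivAt w
    (Complex.imCLM.hasFDerivAt (x := w))
  have h := h1.fun_add h2
  have e : (fun w : ℂ => ‖w‖ ^ 2) = fun w : ℂ => Complex.reCLM w ^ 2 + Complex.imCLM w ^ 2 := by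
    ext w
    rw [Complex.sq_norm, Complex.normSq_apply, Complex.reCLM_apply, Complex.imCLM_apply]
    ring
  rw [e]
  refine h.congr_fderiv ?_
  ext
  simp

/-- The computation shared by the Laplacian and the Wirtinger derivatives: both use the trace of the
second derivative, and log |z|² is harmonic, so only g'' remains. -/
theorem exists_fderiv_radial {g g₁ : ℝ → ℝ} {g₂ : ℝ} {z : ℂ} (hz : z ≠ 0)
    (hg : ∀ᶠ x in 𝓝 (Real.log (‖z‖ ^ 2)), HasDerivAt g (g₁ x) x)
    (hg₁ : HasDerivAt g₁ g₂ (Real.log (‖z‖ ^ 2))) :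
    ∃ (A B : ℂ → ℝ) (A' B' : ℂ →L[ℝ] ℝ),
      (∀ᶠ w in 𝓝 z, HasFDerivAt (fun w : ℂ => g (Real.log (‖w‖ ^ 2)))
        (A w • Complex.reCLM + B w • Complex.imCLM) w) ∧
      HasFDerivAt A A' z ∧ HasFDerivAt B B' z ∧
      A' 1 + B' Complex.I = 4 * g₂ / ‖z‖ ^ 2 := by
  have hlog : ∀ w : ℂ, w ≠ 0 → HasFDerivAt (fun w : ℂ => Real.log (‖w‖ ^ 2))
      ((‖w‖ ^ 2)⁻¹ • ((2 * w.re) • Complex.reCLM + (2 * w.im) • Complex.imCLM)) w := fun w hw =>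
    (hasFDerivAt_norm_sq w).log (by simpa using hw)
  have hn : ‖z‖ ^ 2 ≠ 0 := by simpa using hz
  have hinv := (hasDerivAt_inv hn).comp_hasFDerivAt z (hasFDerivAt_norm_sq z)
  have hg1 := hg₁.comp_hasFDerivAt z (hlog z hz)
  have hre := (Complex.reCLM.hasFDerivAt (x := z)).const_mul 2
  have him := (Complex.imCLM.hasFDerivAt (x := z)).const_mul 2
  have hA := hg1.mul (hinv.mul hre)
  have hB := hg1.mul (hinv.mul him)
  refine ⟨fun w => g₁ (Real.log (‖w‖ ^ 2)) * ((‖w‖ ^ 2)⁻¹ * (2 * w.re)),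
    fun w => g₁ (Real.log (‖w‖ ^ 2)) * ((‖w‖ ^ 2)⁻¹ * (2 * w.im)), _, _, ?_, hA, hB, ?_⟩
  · filter_upwards [(hlog z hz).continuousAt.eventually hg, isOpen_ne.mem_nhds hz] with w h1 h2
    refine (h1.comp_hasFDerivAt w (hlog w h2)).congr_fderiv ?_
    ext
    simp
    ring
  · have e : z.re ^ 2 + z.im ^ 2 = ‖z‖ ^ 2 := by
      rw [Complex.sq_norm, Complex.normSq_apply]; ring
    simp [-Real.log_pow]
    field_simp
    linear_combination (4 * g₂ - 4 * g₁ (Real.log (‖z‖ ^ 2))) * e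

theorem laplacian_radial {g g₁ : ℝ → ℝ} {g₂ : ℝ} {z : ℂ} (hz : z ≠ 0)
    (hg : ∀ᶠ x in 𝓝 (Real.log (‖z‖ ^ 2)), HasDerivAt g (g₁ x) x)
    (hg₁ : HasDerivAt g₁ g₂ (Real.log (‖z‖ ^ 2))) :
    (Δ fun w : ℂ => g (Real.log (‖w‖ ^ 2))) z = 4 * g₂ / ‖z‖ ^ 2 := by
  obtain ⟨A, B, A', B', hψ, hA, hB, hAB⟩ := exists_fderiv_radial hz hg hg₁
  have hev : fderiv ℝ (fun w : ℂ => g (Real.log (‖w‖ ^ 2))) =ᶠ[𝓝 z]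
      fun w => A w • Complex.reCLM + B w • Complex.imCLM := hψ.mono fun w hw => hw.fderiv
  have hd := ((hA.smul_const Complex.reCLM).fun_add (hB.smul_const Complex.imCLM)).fderiv
  rw [InnerProductSpace.laplacian_eq_iteratedFDeriv_complexPlane]
  simp only [iteratedFDeriv_two_apply]
  rw [hev.fderiv_eq, hd, ← hAB]
  simp

theorem wirtinger_radial {g g₁ : ℝ → ℝ} {g₂ : ℝ} {z : ℂ} (hz : z ≠ 0)
    (hg : ∀ᶠ x in 𝓝 (Real.log (‖z‖ ^ 2)), HasDerivAt g (g₁ x) x)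
    (hg₁ : HasDerivAt g₁ g₂ (Real.log (‖z‖ ^ 2))) {φ : ℂ → ℂ}
    (hφ : φ =ᶠ[𝓝 z] fun w => (g (Real.log (‖w‖ ^ 2)) : ℂ)) :
    (wirtinger (wirtingerBar φ) z).re = g₂ / ‖z‖ ^ 2 := by
  obtain ⟨A, B, A', B', hψ, hA, hB, hAB⟩ := exists_fderiv_radial hz hg hg₁
  have hev : wirtingerBar φ =ᶠ[𝓝 z] fun w => ((A w : ℂ) + Complex.I * (B w : ℂ)) / 2 := by
    filter_upwards [hψ, hφ.eventuallyEq_nhds] with w h1 h2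
    have h3 := Complex.ofRealCLM.hasFDerivAt.comp w h1
    have h4 : fderiv ℝ φ w = _ := h2.fderiv_eq.trans h3.fderiv
    rw [wirtingerBar, h4]
    simp
  have hA' := Complex.ofRealCLM.hasFDerivAt.comp z hA
  have hB' := Complex.ofRealCLM.hasFDerivAt.comp z hB
  have hd := ((hA'.fun_add (hB'.const_mul Complex.I)).mul_const (2⁻¹ : ℂ))
  have hfun : (fun w => ((A w : ℂ) + Complex.I * (B w : ℂ)) / 2) = fun w =>
      ((Complex.ofRealCLM ∘ A) w + Complex.I * (Complex.ofRealCLM ∘ B) w) * (2⁻¹ : ℂ) := by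
    ext w
    simp [div_eq_mul_inv]
  rw [wirtinger, hev.fderiv_eq, hfun, hd.fderiv]
  have e : g₂ / ‖z‖ ^ 2 = (A' 1 + B' Complex.I) / 4 := by rw [hAB]; ring
  rw [e]
  simp
  ring

/-! ### Curvature in terms of the elliptic function -/

/-- The second logarithmic derivative of `ellR q`. -/
def ellW (q u : ℝ) : ℝ := ellR q u ^ 2 + ellA q / ellR q u ^ 2

section
variable {q u : ℝ} {z : ℂ}

theorem ellR_pos (hq0 : 0 < q) (hq1 : q < 1) (h1 : 2 * Real.log q < u) (h2 : u < 0) :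
    0 < ellR q u := by
  rw [ellR_eq]
  refine mul_pos (Real.exp_pos _) (lambertR_pos hq0 hq1 ?_ ?_)
  · rw [← Real.exp_log (pow_pos hq0 2), Real.log_pow]
    exact Real.exp_lt_exp.2 (by exact_mod_cast h1)
  · exact Real.exp_lt_one_iff.2 h2

theorem ellW_pos (hq0 : 0 < q) (hq1 : q < 1) (h1 : 2 * Real.log q < u) (h2 : u < 0) :
    0 < ellW q u := by
  have := ellR_pos hq0 hq1 h1 h2
  have := ellA_pos hq0 hq1
  unfold ellW
  positivity

theorem log_norm_sq_mem (hq0 : 0 < q) (hz : z ∈ annulus q) :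
    Real.log (‖z‖ ^ 2) ∈ Ioo (2 * Real.log q) 0 := by
  have h0 : 0 < ‖z‖ := hq0.trans hz.1
  have h1 := Real.log_lt_log hq0 hz.1
  have h2 := Real.log_neg h0 hz.2
  rw [Real.log_pow]
  push_cast
  exact ⟨by linarith, by linarith⟩

theorem hasDerivAt_log_ellR (hq0 : 0 < q) (hq1 : q < 1) (h1 : 2 * Real.log q < u) (h2 : u < 0)
    (c : ℝ) : HasDerivAt (fun u => Real.log (ellR q u) - u / 2 - c)
      (ellR' q u / ellR q u - 1 / 2) u :=
  (((hasDerivAt_ellR hq0 hq1 h1 h2).log (ellR_ne_zero hq0 hq1 h1 h2)).sub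
    ((hasDerivAt_id u).div_const 2)).sub_const c

/-- In F F'' - F'² the terms with β cancel and F⁴ + A is left. -/
theorem hasDerivAt_logDeriv_ellR (hq0 : 0 < q) (hq1 : q < 1) (h1 : 2 * Real.log q < u)
    (h2 : u < 0) : HasDerivAt (fun u => ellR' q u / ellR q u - 1 / 2) (ellW q u) u := by
  have h0 := ellR_ne_zero hq0 hq1 h1 h2
  refine (((hasDerivAt_ellR' hq0 hq1 h1 h2).div (hasDerivAt_ellR hq0 hq1 h1 h2)
    h0).sub_const (1 / 2)).congr_deriv ?_
  have := ellR'_sq hq0 hq1 h1 h2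
  rw [ellW]
  field_simp
  linear_combination -this

theorem eventually_Ioo {P : ℝ → Prop} {a b : ℝ} (hu : u ∈ Ioo a b)
    (h : ∀ v, a < v → v < b → P v) : ∀ᶠ v in 𝓝 u, P v := by
  filter_upwards [isOpen_Ioo.mem_nhds hu] with v hv using h v hv.1 hv.2

theorem lambertR_norm_sq_pos (hq0 : 0 < q) (hq1 : q < 1) (hz : z ∈ annulus q) :
    0 < lambertR q (‖z‖ ^ 2) := by
  have h1 := hz.1
  have h2 := hz.2
  have h3 := norm_nonneg z
  exact lambertR_pos hq0 hq1 (by gcongr) (by nlinarith)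

theorem log_lambertR_norm_sq (hq0 : 0 < q) (hq1 : q < 1) (hz : z ∈ annulus q) :
    Real.log (lambertR q (‖z‖ ^ 2)) =
      Real.log (ellR q (Real.log (‖z‖ ^ 2))) - Real.log (‖z‖ ^ 2) / 2 := by
  have h0 : 0 < ‖z‖ := hq0.trans hz.1
  rw [ellR_eq, Real.exp_log (by positivity), Real.log_mul (Real.exp_pos _).ne'
    (lambertR_norm_sq_pos hq0 hq1 hz).ne', Real.log_exp]
  ring

theorem ellR_log_norm_sq (hq0 : 0 < q) (hz : z ∈ annulus q) :
    ellR q (Real.log (‖z‖ ^ 2)) ^ 2 = ‖z‖ ^ 2 * lambertR q (‖z‖ ^ 2) ^ 2 := by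
  have h0 : 0 < ‖z‖ := hq0.trans hz.1
  rw [ellR_eq, Real.exp_log (by positivity), mul_pow, ← Real.exp_nat_mul]
  congr 1
  rw [show ((2 : ℕ) : ℝ) * (Real.log (‖z‖ ^ 2) / 2) = Real.log (‖z‖ ^ 2) by push_cast; ring,
    Real.exp_log (by positivity)]

/-- Here log c = log F - u/2 with u = log |z|². The linear term is harmonic and c² = F²/|z|², so the
curvature is -4(log F)''/F². -/
theorem gaussCurvature_cAnn (hq0 : 0 < q) (hq1 : q < 1) (hz : z ∈ annulus q) :
    gaussCurvature (cAnn q) z = -4 * (1 + ellA q / (‖z‖ ^ 2 * lambertR q (‖z‖ ^ 2) ^ 2) ^ 2) := by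
  have hz0 : z ≠ 0 := norm_pos_iff.1 (hq0.trans hz.1)
  have hu := log_norm_sq_mem hq0 hz
  have hev : (fun w => Real.log (cAnn q w)) =ᶠ[𝓝 z] fun w =>
      (fun u => Real.log (ellR q u) - u / 2 - 0) (Real.log (‖w‖ ^ 2)) := by
    filter_upwards [(isOpen_annulus q).mem_nhds hz] with w hw
    rw [cAnn_eq hq0 hq1 hw, log_lambertR_norm_sq hq0 hq1 hw, sub_zero]
  rw [gaussCurvature, (InnerProductSpace.laplacian_congr_nhds hev).eq_of_nhds,
    laplacian_radial hz0
      (eventually_Ioo hu fun v h1 h2 => hasDerivAt_log_ellR hq0 hq1 h1 h2 0)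
      (hasDerivAt_logDeriv_ellR hq0 hq1 hu.1 hu.2), cAnn_eq hq0 hq1 hz, ellW,
    ellR_log_norm_sq hq0 hz]
  have h1 : ‖z‖ ≠ 0 := norm_ne_zero_iff.2 hz0
  have h2 := (lambertR_norm_sq_pos hq0 hq1 hz).ne'
  field_simp

theorem sAnn_eq (hq0 : 0 < q) (hq1 : q < 1) (hz : z ∈ annulus q) :
    sAnn q z = √(ellW q (Real.log (‖z‖ ^ 2)) / ‖z‖ ^ 2) := by
  have hz0 : z ≠ 0 := norm_pos_iff.1 (hq0.trans hz.1)
  have hu := log_norm_sq_mem hq0 hz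
  have hpi := Real.two_pi_pos
  rw [sAnn, szegoMetric]
  congr 1
  refine wirtinger_radial hz0
      (eventually_Ioo hu fun v h1 h2 => hasDerivAt_log_ellR hq0 hq1 h1 h2 (Real.log (2 * Real.pi)))
      (hasDerivAt_logDeriv_ellR hq0 hq1 hu.1 hu.2) ?_
  filter_upwards [(isOpen_annulus q).mem_nhds hz] with w hw
  have h1 : szegoDiag (annulus q) (annulusArcLength q) w = lambertR q (‖w‖ ^ 2) / (2 * Real.pi) :=
    SAnn_eq hq0 hq1 hw
  rw [h1, Real.log_div (lambertR_norm_sq_pos hq0 hq1 hw).ne' hpi.ne',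
    log_lambertR_norm_sq hq0 hq1 hw]

/-- The derivative of `ellW q`. -/
def ellW' (q u : ℝ) : ℝ := 2 * ellR' q u * (ellR q u - ellA q / ellR q u ^ 3)

theorem hasDerivAt_ellW (hq0 : 0 < q) (hq1 : q < 1) (h1 : 2 * Real.log q < u) (h2 : u < 0) :
    HasDerivAt (ellW q) (ellW' q u) u := by
  have h0 := ellR_ne_zero hq0 hq1 h1 h2
  have hd := (hasDerivAt_ellR hq0 hq1 h1 h2).fun_pow 2
  refine (hd.fun_add ((hasDerivAt_const u (ellA q)).fun_div hd (pow_ne_zero 2 h0))).congr_deriv ?_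
  rw [ellW']
  field_simp
  ring

theorem hasDerivAt_ellW' (hq0 : 0 < q) (hq1 : q < 1) (h1 : 2 * Real.log q < u) (h2 : u < 0) :
    HasDerivAt (ellW' q) (2 * (ellB q * ellR q u + 2 * ellR q u ^ 3) *
      (ellR q u - ellA q / ellR q u ^ 3) +
      2 * (ellR q u ^ 4 + ellB q * ellR q u ^ 2 - ellA q) * (1 + 3 * ellA q / ellR q u ^ 4)) u := by
  have h0 := ellR_ne_zero hq0 hq1 h1 h2
  have hf := hasDerivAt_ellR hq0 hq1 h1 h2
  refine (((hasDerivAt_ellR' hq0 hq1 h1 h2).const_mul 2).fun_mul (hf.fun_sub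
    ((hasDerivAt_const u (ellA q)).fun_div (hf.fun_pow 3) (pow_ne_zero 3 h0)))).congr_deriv ?_
  rw [← ellR'_sq hq0 hq1 h1 h2]
  field_simp
  ring

/-- With W = F² + A/F² the metric is √(W/|z|²), so the curvature is -2(log W)''/W. Eliminating F'²
by the differential equation leaves only even powers of F, hence a rational function of w = F². -/
theorem gaussCurvature_sAnn (hq0 : 0 < q) (hq1 : q < 1) (hz : z ∈ annulus q) {A β w : ℝ}
    (hA : A = ellA q) (hβ : β = ellB q) (hw : w = ‖z‖ ^ 2 * lambertR q (‖z‖ ^ 2) ^ 2) :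
    gaussCurvature (sAnn q) z =
      -2 * (2 * w ^ 6 + 18 * A * w ^ 4 + 16 * A * β * w ^ 3 - 18 * A ^ 2 * w ^ 2 - 2 * A ^ 3) /
        (w ^ 2 + A) ^ 3 := by
  have hz0 : z ≠ 0 := norm_pos_iff.1 (hq0.trans hz.1)
  have hn : ‖z‖ ≠ 0 := norm_ne_zero_iff.2 hz0
  have hu := log_norm_sq_mem hq0 hz
  have hev : (fun w => Real.log (sAnn q w)) =ᶠ[𝓝 z] fun w =>
      (fun u => (Real.log (ellW q u) - u) / 2) (Real.log (‖w‖ ^ 2)) := by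
    filter_upwards [(isOpen_annulus q).mem_nhds hz] with w hw
    have hw0 : 0 < ‖w‖ := hq0.trans hw.1
    have hu' := log_norm_sq_mem hq0 hw
    have hW := ellW_pos hq0 hq1 hu'.1 hu'.2
    rw [sAnn_eq hq0 hq1 hw, Real.log_sqrt (by positivity),
      Real.log_div hW.ne' (by positivity)]
  have hd2 := (((hasDerivAt_ellW' hq0 hq1 hu.1 hu.2).fun_div (hasDerivAt_ellW hq0 hq1 hu.1 hu.2)
    (ellW_pos hq0 hq1 hu.1 hu.2).ne').sub_const 1).div_const 2
  have hd1 : ∀ v, 2 * Real.log q < v → v < 0 →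
      HasDerivAt (fun u => (Real.log (ellW q u) - u) / 2) ((ellW' q v / ellW q v - 1) / 2) v :=
    fun v h1 h2 => (((hasDerivAt_ellW hq0 hq1 h1 h2).log
      (ellW_pos hq0 hq1 h1 h2).ne').sub (hasDerivAt_id v)).div_const 2
  rw [gaussCurvature, (InnerProductSpace.laplacian_congr_nhds hev).eq_of_nhds,
    laplacian_radial hz0 (eventually_Ioo hu hd1) hd2, sAnn_eq hq0 hq1 hz, Real.sq_sqrt (by
        have := ellW_pos hq0 hq1 hu.1 hu.2
        positivity)]
  have hf := ellR_pos hq0 hq1 hu.1 hu.2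
  have hsq := ellR'_sq hq0 hq1 hu.1 hu.2
  rw [← ellR_log_norm_sq hq0 hz] at hw
  have hA0 := ellA_pos hq0 hq1
  have hW' : ellW' q (Real.log (‖z‖ ^ 2)) ^ 2 = 4 * (ellR q (Real.log (‖z‖ ^ 2)) ^ 4 +
      ellB q * ellR q (Real.log (‖z‖ ^ 2)) ^ 2 - ellA q) *
      (ellR q (Real.log (‖z‖ ^ 2)) - ellA q / ellR q (Real.log (‖z‖ ^ 2)) ^ 3) ^ 2 := by
    rw [ellW', mul_pow, mul_pow, hsq]; ring
  rw [← sq, hW', ellW, hw, hA, hβ]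
  generalize ellR q (Real.log (‖z‖ ^ 2)) = f at *
  generalize ellA q = a at *
  generalize ellB q = b at *
  have hfa : f ^ 4 + a ≠ 0 := by positivity
  have hfa' : (f ^ 2) ^ 2 + a ≠ 0 := by positivity
  have hfa2 : f ^ 2 + a / f ^ 2 ≠ 0 := by positivity
  field_simp
  ring

end

/-! ### Asymptotics as `r → 0` -/

/-- Dominated convergence: for q ≤ |x| ≤ 1 the terms k = 0 and k = -1 give `a` and `b`, and every
other term is O(q). -/
theorem tendsto_lambert {x : ℝ → ℂ} {a b : ℂ} (hx : ∀ᶠ q : ℝ in 𝓝[>] 0, q ≤ ‖x q‖ ∧ ‖x q‖ ≤ 1)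
    (ha : Tendsto (fun q => 1 / (1 - x q)) (𝓝[>] 0) (𝓝 a))
    (hb : Tendsto (fun q : ℝ => (q : ℂ) / (x q - q ^ 2)) (𝓝[>] 0) (𝓝 b)) :
    Tendsto (fun q => lambert q (x q)) (𝓝[>] 0) (𝓝 (a + b)) := by
  have hsum : (∑' k : ℤ, if k = 0 then a else if k = -1 then b else 0) = a + b := by
    rw [tsum_eq_sum (s := {0, -1})]
    · simp
    · intro k hk
      simp only [Finset.mem_insert, Finset.mem_singleton, not_or] at hk
      simp [hk.1, hk.2]
  rw [← hsum]
  have hsmall : ∀ᶠ q : ℝ in 𝓝[>] 0, 0 < q ∧ q ≤ 1 / 4 := by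
    filter_upwards [Ioc_mem_nhdsGT (show (0 : ℝ) < 1 / 4 by norm_num)] with q hq using hq
  -- The constant is 4/3 · (1/4 + 1), from c = 1/4, q ≤ 1/4 and q/|x| ≤ 1. The factor 1/|x| costs
  -- one power of q.
  have hterm : ∀ᶠ q : ℝ in 𝓝[>] 0, ∀ k : ℤ, k ≠ 0 →
      ‖lambertTerm q k (x q)‖ ≤ 5 / 3 * q ^ (k.natAbs - 1) := by
    filter_upwards [hx, hsmall] with q h1 h2 k hk
    have hxp : 0 < ‖x q‖ := h2.1.trans_le h1.1
    have h := norm_lambertTerm_le (c := 1 / 4) h2.1 (by linarith [h2.2]) (by norm_num)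
      (norm_pos_iff.1 hxp) (by nlinarith [h2.1, h2.2, h1.2]) (by nlinarith [h2.1, h2.2, h1.1]) hk
    refine h.trans ?_
    have hk' : q ^ k.natAbs = q * q ^ (k.natAbs - 1) := by
      rw [← pow_succ']; congr 1; omega
    have h3 : 1 / ‖x q‖ ≤ 1 / q := one_div_le_one_div_of_le h2.1 h1.1
    rw [hk', ← mul_assoc]
    have hq0 := h2.1
    gcongr
    have h4 : 1 / ‖x q‖ * q ≤ 1 := by
      calc 1 / ‖x q‖ * q ≤ 1 / q * q := by gcongr
        _ = 1 := by field_simp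
    have h5 : (1 + 1 / ‖x q‖) / (1 - 1 / 4) * q = 4 / 3 * (q + 1 / ‖x q‖ * q) := by ring
    rw [h5]
    linarith [h2.2]
  refine tendsto_tsum_of_dominated_convergence
    -- 20/3 is 4 · 5/3, repaying the lost power at q ≤ 1/4; it also exceeds the 1 needed for k = 0.
    (bound := fun k : ℤ => (‖a‖ + 20 / 3) * (1 / 4) ^ k.natAbs)
    ((summable_pow_natAbs (by norm_num) (by norm_num)).mul_left _) ?_ ?_
  · intro k
    by_cases hk : k = 0
    · subst hk
      simpa [lambertTerm] using ha
    by_cases hk1 : k = -1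
    · subst hk1
      simp only [neg_eq_zero, one_ne_zero, if_false, if_true]
      refine hb.congr' ?_
      filter_upwards [hsmall] with q hq
      have hq0 : (q : ℂ) ≠ 0 := by exact_mod_cast hq.1.ne'
      have e : (q : ℂ) ^ (2 * (-1) : ℤ) = ((q : ℂ) ^ 2)⁻¹ := by
        rw [mul_neg, zpow_neg]; norm_cast
      rw [lambertTerm, e, zpow_neg_one]
      have h3 : 1 - x q * ((q : ℂ) ^ 2)⁻¹ = -(x q - q ^ 2) / q ^ 2 := by field_simp; ring
      rw [h3, div_div_eq_mul_div, inv_neg, neg_mul, neg_div_neg_eq]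
      congr 1
      field_simp
    simp only [hk, hk1, if_false]
    by_cases hk2 : k = 1
    · subst hk2
      have hlim : Tendsto (fun q : ℝ => 2 * q) (𝓝[>] 0) (𝓝 0) := by
        have : Continuous fun q : ℝ => 2 * q := by fun_prop
        simpa using (this.tendsto 0).mono_left nhdsWithin_le_nhds
      refine squeeze_zero_norm' ?_ hlim
      filter_upwards [hx, hsmall] with q h1 h2
      have e : (q : ℂ) ^ (2 * 1 : ℤ) = (q : ℂ) ^ 2 := by norm_cast
      rw [lambertTerm, e, zpow_one, norm_div, norm_neg, Complex.norm_real,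
        Real.norm_of_nonneg h2.1.le]
      have h3 := norm_sub_norm_le (1 : ℂ) (x q * (q : ℂ) ^ 2)
      rw [norm_one, norm_mul, norm_pow, Complex.norm_real, Real.norm_of_nonneg h2.1.le] at h3
      have h4 : 1 / 2 ≤ ‖1 - x q * (q : ℂ) ^ 2‖ := by
        have : ‖x q‖ * q ^ 2 ≤ 1 * q ^ 2 := by gcongr; exact h1.2
        nlinarith [h2.1, h2.2]
      rw [div_le_iff₀ (by linarith)]
      nlinarith [h2.1]
    · have hlim : Tendsto (fun q : ℝ => 5 / 3 * q) (𝓝[>] 0) (𝓝 0) := by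
        have : Continuous fun q : ℝ => 5 / 3 * q := by fun_prop
        simpa using (this.tendsto 0).mono_left nhdsWithin_le_nhds
      refine squeeze_zero_norm' ?_ hlim
      filter_upwards [hterm, hsmall] with q h1 h2
      refine (h1 k hk).trans ?_
      gcongr
      have := pow_le_pow_of_le_one h2.1.le (by linarith [h2.2]) (show 1 ≤ k.natAbs - 1 by omega)
      simpa using this
  · have ha' : ∀ᶠ q in 𝓝[>] 0, ‖1 / (1 - x q)‖ < ‖a‖ + 1 :=
      ha.norm.eventually_lt_const (by linarith)
    filter_upwards [hterm, hsmall, ha'] with q h1 h2 h3 k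
    by_cases hk : k = 0
    · subst hk
      simp only [Int.natAbs_zero, pow_zero, mul_one]
      simp only [lambertTerm, mul_zero, zpow_zero, mul_one]
      linarith
    · refine (h1 k hk).trans ?_
      have h4 : q ^ (k.natAbs - 1) ≤ (1 / 4) ^ (k.natAbs - 1) := by
        have := h2.1.le
        gcongr
        exact h2.2
      have h5 : (1 / 4 : ℝ) ^ k.natAbs = 1 / 4 * (1 / 4) ^ (k.natAbs - 1) := by
        rw [← pow_succ']; congr 1; omega
      have h6 : (0 : ℝ) < (1 / 4) ^ (k.natAbs - 1) := by positivity
      rw [h5]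
      nlinarith [norm_nonneg a, mul_nonneg (norm_nonneg a) h6.le]

theorem tendsto_lambertR {x : ℝ → ℝ} {a b : ℝ}
    (hx : ∀ᶠ q : ℝ in 𝓝[>] 0, q ≤ |x q| ∧ |x q| ≤ 1)
    (ha : Tendsto (fun q => 1 / (1 - x q)) (𝓝[>] 0) (𝓝 a))
    (hb : Tendsto (fun q : ℝ => q / (x q - q ^ 2)) (𝓝[>] 0) (𝓝 b)) :
    Tendsto (fun q => lambertR q (x q)) (𝓝[>] 0) (𝓝 (a + b)) := by
  have h := tendsto_lambert (x := fun q => (x q : ℂ)) (a := a) (b := b) (by simpa using hx)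
    (by
      refine ((Complex.continuous_ofReal.tendsto a).comp ha).congr fun q => ?_
      simp)
    (by
      refine ((Complex.continuous_ofReal.tendsto b).comp hb).congr fun q => ?_
      simp)
  simpa [lambertR, Function.comp_def] using (Complex.continuous_re.tendsto _).comp h

theorem tendsto_rpow_zero {e : ℝ} (he : 0 < e) : Tendsto (fun r : ℝ => r ^ e) (𝓝[>] 0) (𝓝 0) := by
  have := (Real.continuousAt_rpow_const 0 e (Or.inr he.le)).tendsto
  rw [Real.zero_rpow he.ne'] at this
  exact this.mono_left nhdsWithin_le_nhds

theorem eventually_mem_Ioo_zero_one : ∀ᶠ r : ℝ in 𝓝[>] 0, 0 < r ∧ r < 1 := by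
  filter_upwards [Ioo_mem_nhdsGT (zero_lt_one' ℝ)] with r hr using hr

theorem rpow_two_mul_le {r l : ℝ} (h : 0 < r ∧ r < 1) (hl0 : 0 < l) (hl : l ≤ 1 / 2) :
    r ≤ r ^ (2 * l) ∧ r ^ (2 * l) ≤ 1 := by
  constructor
  · calc r = r ^ (1 : ℝ) := (Real.rpow_one r).symm
      _ ≤ r ^ (2 * l) := Real.rpow_le_rpow_of_exponent_ge h.1 h.2.le (by linarith)
  · exact Real.rpow_le_one h.1.le h.2.le (by linarith)

theorem tendsto_lambertR_rpow {l : ℝ} (hl0 : 0 < l) (hl : l < 1 / 2) :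
    Tendsto (fun r : ℝ => lambertR r (r ^ (2 * l))) (𝓝[>] 0) (𝓝 1) := by
  have h1 : Tendsto (fun r : ℝ => 1 / (1 - r ^ (2 * l))) (𝓝[>] 0) (𝓝 1) := by
    have := (tendsto_const_nhds (x := (1 : ℝ))).div
      ((tendsto_const_nhds (x := (1 : ℝ))).sub (tendsto_rpow_zero (e := 2 * l) (by linarith)))
      (by norm_num)
    simpa [Pi.div_def] using this
  have h2 : Tendsto (fun r : ℝ => r / (r ^ (2 * l) - r ^ 2)) (𝓝[>] 0) (𝓝 0) := by
    have := (tendsto_rpow_zero (e := 1 - 2 * l) (by linarith)).div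
      ((tendsto_const_nhds (x := (1 : ℝ))).sub (tendsto_rpow_zero (e := 2 - 2 * l) (by linarith)))
      (by norm_num)
    simp only [sub_zero, div_one] at this
    refine this.congr' ?_
    filter_upwards [eventually_mem_Ioo_zero_one] with r hr
    have ht := Real.rpow_pos_of_pos hr.1 (2 * l)
    simp only [Pi.div_apply]
    rw [Real.rpow_sub hr.1, Real.rpow_sub hr.1, Real.rpow_one, Real.rpow_two]
    field_simp
  have := tendsto_lambertR (x := fun r => r ^ (2 * l)) (by
    filter_upwards [eventually_mem_Ioo_zero_one] with r hr
    rw [abs_of_pos (Real.rpow_pos_of_pos hr.1 _)]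
    exact rpow_two_mul_le hr hl0 hl.le) h1 h2
  simpa using this

theorem tendsto_id_nhdsGT_zero : Tendsto (fun r : ℝ => r) (𝓝[>] 0) (𝓝 0) :=
  tendsto_nhdsWithin_of_tendsto_nhds tendsto_id

theorem tendsto_lambertR_self : Tendsto (fun r : ℝ => lambertR r r) (𝓝[>] 0) (𝓝 2) := by
  have h1 : Tendsto (fun r : ℝ => 1 / (1 - r)) (𝓝[>] 0) (𝓝 1) := by
    have := (tendsto_const_nhds (x := (1 : ℝ))).div
      ((tendsto_const_nhds (x := (1 : ℝ))).sub tendsto_id_nhdsGT_zero) (by norm_num)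
    simpa [Pi.div_def] using this
  have h2 : Tendsto (fun r : ℝ => r / (r - r ^ 2)) (𝓝[>] 0) (𝓝 1) := by
    refine h1.congr' ?_
    filter_upwards [eventually_mem_Ioo_zero_one] with r hr
    have h := hr.1.ne'
    have h3 : 1 - r ≠ 0 := by linarith [hr.2]
    have : r - r ^ 2 = r * (1 - r) := by ring
    rw [this]
    field_simp
  have := tendsto_lambertR (x := fun r => r) (by
    filter_upwards [eventually_mem_Ioo_zero_one] with r hr
    rw [abs_of_pos hr.1]
    exact ⟨le_rfl, hr.2.le⟩) h1 h2
  norm_num at this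
  exact this

theorem tendsto_lambertR_neg_one :
    Tendsto (fun r : ℝ => lambertR r (-1)) (𝓝[>] 0) (𝓝 (1 / 2)) := by
  have h2 : Tendsto (fun r : ℝ => r / (-1 - r ^ 2)) (𝓝[>] 0) (𝓝 0) := by
    have := tendsto_id_nhdsGT_zero.div ((tendsto_const_nhds (x := (-1 : ℝ))).sub
      (tendsto_id_nhdsGT_zero.pow 2)) (by norm_num)
    simpa [Pi.div_def] using this
  have := tendsto_lambertR (x := fun _ => -1) (a := 1 / 2) (by
    filter_upwards [eventually_mem_Ioo_zero_one] with r hr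
    rw [abs_neg, abs_one]
    exact ⟨hr.2.le, le_rfl⟩) (by norm_num) h2
  simpa using this

/-- The quotient is s(r)² s(-1)², with limit 2² · (1/2)². -/
theorem tendsto_ellA_div : Tendsto (fun r : ℝ => ellA r / r) (𝓝[>] 0) (𝓝 1) := by
  have h := (tendsto_lambertR_self.pow 2).mul (tendsto_lambertR_neg_one.pow 2)
  norm_num at h
  refine h.congr' ?_
  filter_upwards [eventually_mem_Ioo_zero_one] with r hr
  have := hr.1.ne'
  rw [ellA]
  field_simp

theorem tendsto_ellB : Tendsto ellB (𝓝[>] 0) (𝓝 (1 / 4)) := by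
  have h := (tendsto_lambertR_neg_one.pow 2).sub
    (tendsto_id_nhdsGT_zero.mul (tendsto_lambertR_self.pow 2))
  norm_num at h
  exact h

/-! ### The metrics at the point `r ^ l` -/

/-- `F²` at the point `r ^ l`. -/
def ellSq (r l : ℝ) : ℝ := r ^ (2 * l) * lambertR r (r ^ (2 * l)) ^ 2

section
variable {r l : ℝ}

theorem norm_pt_sq (hr : 0 < r ∧ r < 1) : ‖pt r l‖ ^ 2 = r ^ (2 * l) := by
  rw [pt, Complex.norm_real, Real.norm_of_nonneg (Real.rpow_nonneg hr.1.le _), mul_comm,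
    Real.rpow_mul hr.1.le, Real.rpow_two]

theorem pt_mem_annulus (hr : 0 < r ∧ r < 1) (hl0 : 0 < l) (hl1 : l < 1) : pt r l ∈ annulus r := by
  have h : ‖pt r l‖ = r ^ l := by
    rw [pt, Complex.norm_real, Real.norm_of_nonneg (Real.rpow_nonneg hr.1.le _)]
  constructor
  · rw [h]
    calc r = r ^ (1 : ℝ) := (Real.rpow_one r).symm
      _ < r ^ l := Real.rpow_lt_rpow_of_exponent_gt hr.1 hr.2 hl1
  · rw [h]
    exact Real.rpow_lt_one hr.1.le hr.2 hl0

theorem lambertR_reflect {q t : ℝ} (hq0 : 0 < q) (ht : t ≠ 0) :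
    lambertR q (q ^ 2 / t) = t / q * lambertR q t := by
  have h := lambert_sq_mul hq0 (t⁻¹ : ℂ)
  rw [lambert_inv hq0 (by exact_mod_cast ht), lambert_ofReal,
    show ((q : ℂ) ^ 2 * (t : ℂ)⁻¹) = ((q ^ 2 / t : ℝ) : ℂ) by push_cast; rfl, lambert_ofReal] at h
  have h2 : ((lambertR q (q ^ 2 / t) : ℝ) : ℂ) = ((t / q * lambertR q t : ℝ) : ℂ) := by
    rw [h]; push_cast; ring
  exact_mod_cast h2

theorem rpow_reflect (hr : 0 < r) : r ^ (2 * (1 - l)) = r ^ 2 / r ^ (2 * l) := by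
  rw [mul_sub, Real.rpow_sub hr, mul_one, Real.rpow_two]

theorem lambertR_rpow_reflect (hr : 0 < r) :
    lambertR r (r ^ (2 * (1 - l))) = r ^ (2 * l - 1) * lambertR r (r ^ (2 * l)) := by
  rw [rpow_reflect hr, lambertR_reflect hr (Real.rpow_pos_of_pos hr _).ne', Real.rpow_sub hr,
    Real.rpow_one]

/-- This is the symmetry of F about log q. The metrics are not symmetric under λ ↦ 1 - λ, but their
curvatures depend on the point only through F². -/
theorem ellSq_reflect (hr : 0 < r) : ellSq r (1 - l) = ellSq r l := by
  have ht := Real.rpow_pos_of_pos hr (2 * l)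
  rw [ellSq, ellSq, rpow_reflect hr, lambertR_reflect hr ht.ne']
  field_simp

theorem lambertR_rpow_pos (hr : 0 < r ∧ r < 1) (hl0 : 0 < l) (hl1 : l < 1) :
    0 < lambertR r (r ^ (2 * l)) := by
  rw [← norm_pt_sq hr]
  exact lambertR_norm_sq_pos hr.1 hr.2 (pt_mem_annulus hr hl0 hl1)

theorem ellSq_pos (hr : 0 < r ∧ r < 1) (hl0 : 0 < l) (hl1 : l < 1) : 0 < ellSq r l :=
  mul_pos (Real.rpow_pos_of_pos hr.1 _) (pow_pos (lambertR_rpow_pos hr hl0 hl1) 2)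

theorem cAnn_pt (hr : 0 < r ∧ r < 1) (hl0 : 0 < l) (hl1 : l < 1) :
    cAnn r (pt r l) = lambertR r (r ^ (2 * l)) := by
  rw [cAnn_eq hr.1 hr.2 (pt_mem_annulus hr hl0 hl1), norm_pt_sq hr]

theorem cAnn_pt_eq_SAnn (hr : 0 < r ∧ r < 1) (hl0 : 0 < l) (hl1 : l < 1) :
    cAnn r (pt r l) = 2 * Real.pi * SAnn r (pt r l) := by
  rw [cAnn_eq hr.1 hr.2 (pt_mem_annulus hr hl0 hl1), SAnn_eq hr.1 hr.2 (pt_mem_annulus hr hl0 hl1),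
    mul_div_cancel₀ _ Real.two_pi_pos.ne']

theorem rpow_one_sub (hr : 0 < r) (n : ℕ) :
    r ^ (1 - n * (2 * l)) = r / (r ^ (2 * l)) ^ n := by
  rw [Real.rpow_sub hr, Real.rpow_one, mul_comm (n : ℝ), Real.rpow_mul hr.le, Real.rpow_natCast]

theorem sAnn_pt (hr : 0 < r ∧ r < 1) (hl0 : 0 < l) (hl1 : l < 1) :
    sAnn r (pt r l) = √(lambertR r (r ^ (2 * l)) ^ 2 +
      ellA r / r * r ^ (1 - 4 * l) / lambertR r (r ^ (2 * l)) ^ 2) := by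
  have hz := pt_mem_annulus hr hl0 hl1
  have hs := (lambertR_rpow_pos hr hl0 hl1).ne'
  have ht := (Real.rpow_pos_of_pos hr.1 (2 * l)).ne'
  have hr0 := hr.1.ne'
  rw [sAnn_eq hr.1 hr.2 hz, ellW, ellR_log_norm_sq hr.1 hz, norm_pt_sq hr,
    show 1 - 4 * l = 1 - (2 : ℕ) * (2 * l) by push_cast; ring, rpow_one_sub hr.1]
  congr 1
  field_simp

theorem gaussCurvature_cAnn_pt (hr : 0 < r ∧ r < 1) (hl0 : 0 < l) (hl1 : l < 1) :
    gaussCurvature (cAnn r) (pt r l) = -4 * (1 + ellA r / ellSq r l ^ 2) := by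
  rw [gaussCurvature_cAnn hr.1 hr.2 (pt_mem_annulus hr hl0 hl1), norm_pt_sq hr, ellSq]

theorem gaussCurvature_sAnn_pt (hr : 0 < r ∧ r < 1) (hl0 : 0 < l) (hl1 : l < 1) :
    gaussCurvature (sAnn r) (pt r l) = -2 * (2 * ellSq r l ^ 6 + 18 * ellA r * ellSq r l ^ 4 +
      16 * ellA r * ellB r * ellSq r l ^ 3 - 18 * ellA r ^ 2 * ellSq r l ^ 2 - 2 * ellA r ^ 3) /
        (ellSq r l ^ 2 + ellA r) ^ 3 :=
  gaussCurvature_sAnn hr.1 hr.2 (pt_mem_annulus hr hl0 hl1) rfl rfl (by rw [norm_pt_sq hr, ellSq])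

theorem gaussCurvature_cAnn_reflect (hr : 0 < r ∧ r < 1) (hl0 : 0 < l) (hl1 : l < 1) :
    gaussCurvature (cAnn r) (pt r (1 - l)) = gaussCurvature (cAnn r) (pt r l) := by
  rw [gaussCurvature_cAnn_pt hr hl0 hl1, gaussCurvature_cAnn_pt hr (by linarith) (by linarith),
    ellSq_reflect hr.1]

theorem gaussCurvature_sAnn_reflect (hr : 0 < r ∧ r < 1) (hl0 : 0 < l) (hl1 : l < 1) :
    gaussCurvature (sAnn r) (pt r (1 - l)) = gaussCurvature (sAnn r) (pt r l) := by
  rw [gaussCurvature_sAnn_pt hr hl0 hl1, gaussCurvature_sAnn_pt hr (by linarith) (by linarith),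
    ellSq_reflect hr.1]

/-- Separates the factors with a finite limit from a pure power of r, whose exponent produces the
thresholds in λ. -/
theorem ellA_div_ellSq_pow (hr : 0 < r ∧ r < 1) (n : ℕ) : ellA r / ellSq r l ^ n =
    ellA r / r / lambertR r (r ^ (2 * l)) ^ (2 * n) * r ^ (1 - n * (2 * l)) := by
  have hr0 := hr.1.ne'
  rw [rpow_one_sub hr.1, ellSq, mul_pow, ← pow_mul]
  field_simp

theorem ellSq_pow_div_ellA (hr : 0 < r ∧ r < 1) (n m : ℕ) : ellSq r l ^ n / ellA r ^ m =
    lambertR r (r ^ (2 * l)) ^ (2 * n) / (ellA r / r) ^ m * r ^ (n * (2 * l) - m) := by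
  have hr0 := hr.1.ne'
  rw [Real.rpow_sub hr.1, Real.rpow_natCast, mul_comm (n : ℝ),
    Real.rpow_mul hr.1.le (2 * l), Real.rpow_natCast, ellSq, mul_pow, ← pow_mul, div_pow, div_div_eq_mul_div]
  field_simp

/-! ### Limits as `r → 0` -/

theorem exists_tendsto_lambertR (hl0 : 0 < l) (hl : l ≤ 1 / 2) : ∃ s : ℝ, 0 < s ∧
    (l < 1 / 2 → s = 1) ∧ Tendsto (fun r : ℝ => lambertR r (r ^ (2 * l))) (𝓝[>] 0) (𝓝 s) := by
  rcases hl.lt_or_eq with h | rfl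
  · exact ⟨1, one_pos, fun _ => rfl, tendsto_lambertR_rpow hl0 h⟩
  · refine ⟨2, two_pos, fun h => absurd h (lt_irrefl _), ?_⟩
    norm_num
    exact tendsto_lambertR_self

/-- By reflection the value is r^{1-2λ} times the value for 1 - λ < 1/2, which tends to 1. -/
theorem tendsto_lambertR_atTop (hl : 1 / 2 < l) (hl1 : l < 1) :
    Tendsto (fun r : ℝ => lambertR r (r ^ (2 * l))) (𝓝[>] 0) atTop := by
  have h := (tendsto_lambertR_rpow (l := 1 - l) (by linarith) (by linarith)).pos_mul_atTop one_pos
    (tendsto_rpow_neg_nhdsGT_zero (y := 2 * (1 - l) - 1) (by linarith))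
  refine h.congr' ?_
  filter_upwards [eventually_mem_Ioo_zero_one] with r hr
  rw [mul_comm, ← lambertR_rpow_reflect hr.1, sub_sub_cancel]

theorem tendsto_ellA_div_ellSq (n : ℕ) {s c : ℝ} (hs : 0 < s)
    (h : Tendsto (fun r : ℝ => lambertR r (r ^ (2 * l))) (𝓝[>] 0) (𝓝 s))
    (hc : Tendsto (fun r : ℝ => r ^ (1 - n * (2 * l))) (𝓝[>] 0) (𝓝 c)) :
    Tendsto (fun r => ellA r / ellSq r l ^ n) (𝓝[>] 0) (𝓝 (1 / s ^ (2 * n) * c)) := by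
  refine ((tendsto_ellA_div.div (h.pow (2 * n)) (by positivity)).mul hc).congr' ?_
  filter_upwards [eventually_mem_Ioo_zero_one] with r hr
  exact (ellA_div_ellSq_pow hr n).symm

theorem tendsto_ellA_div_ellSq_atTop (n : ℕ) {s : ℝ} (hs : 0 < s)
    (h : Tendsto (fun r : ℝ => lambertR r (r ^ (2 * l))) (𝓝[>] 0) (𝓝 s))
    (hc : 1 - n * (2 * l) < 0) :
    Tendsto (fun r => ellA r / ellSq r l ^ n) (𝓝[>] 0) atTop := by
  refine ((tendsto_ellA_div.div (h.pow (2 * n)) (by positivity)).pos_mul_atTop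
    (show 0 < 1 / s ^ (2 * n) by positivity) (tendsto_rpow_neg_nhdsGT_zero hc)).congr' ?_
  filter_upwards [eventually_mem_Ioo_zero_one] with r hr
  exact (ellA_div_ellSq_pow hr n).symm

theorem tendsto_ellSq_div_ellA (n m : ℕ) {s c : ℝ}
    (h : Tendsto (fun r : ℝ => lambertR r (r ^ (2 * l))) (𝓝[>] 0) (𝓝 s))
    (hc : Tendsto (fun r : ℝ => r ^ (n * (2 * l) - m)) (𝓝[>] 0) (𝓝 c)) :
    Tendsto (fun r => ellSq r l ^ n / ellA r ^ m) (𝓝[>] 0) (𝓝 (s ^ (2 * n) * c)) := by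
  have := ((h.pow (2 * n)).div (tendsto_ellA_div.pow m) (by simp)).mul hc
  rw [one_pow, div_one] at this
  refine this.congr' ?_
  filter_upwards [eventually_mem_Ioo_zero_one] with r hr
  exact (ellSq_pow_div_ellA hr n m).symm

theorem tendsto_ellSq_div_ellA_atTop (n m : ℕ) {s : ℝ} (hs : 0 < s)
    (h : Tendsto (fun r : ℝ => lambertR r (r ^ (2 * l))) (𝓝[>] 0) (𝓝 s))
    (hc : n * (2 * l) - m < 0) :
    Tendsto (fun r => ellSq r l ^ n / ellA r ^ m) (𝓝[>] 0) atTop := by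
  refine (((h.pow (2 * n)).div (tendsto_ellA_div.pow m) (by simp)).pos_mul_atTop
    (show 0 < s ^ (2 * n) / 1 ^ m by positivity) (tendsto_rpow_neg_nhdsGT_zero hc)).congr' ?_
  filter_upwards [eventually_mem_Ioo_zero_one] with r hr
  exact (ellSq_pow_div_ellA hr n m).symm

theorem tendsto_rpow_of_eq_zero {e : ℝ} (he : e = 0) :
    Tendsto (fun r : ℝ => r ^ e) (𝓝[>] 0) (𝓝 1) := by
  simp [he]

/-! #### The curvature of the Carathéodory metric -/

theorem tendsto_curvature_cAnn (hl0 : 0 < l) (hl1 : l < 1) {c : ℝ}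
    (h : Tendsto (fun r => ellA r / ellSq r l ^ 2) (𝓝[>] 0) (𝓝 c)) :
    Tendsto (fun r => gaussCurvature (cAnn r) (pt r l)) (𝓝[>] 0) (𝓝 (-4 * (1 + c))) := by
  refine ((h.const_add 1).const_mul (-4)).congr' ?_
  filter_upwards [eventually_mem_Ioo_zero_one] with r hr
  exact (gaussCurvature_cAnn_pt hr hl0 hl1).symm

theorem tendsto_curvature_cAnn_low (hl0 : 0 < l) (hl : l < 1 / 4) :
    Tendsto (fun r => gaussCurvature (cAnn r) (pt r l)) (𝓝[>] 0) (𝓝 (-4)) := by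
  have h := tendsto_curvature_cAnn hl0 (by linarith) (tendsto_ellA_div_ellSq 2 one_pos
    (tendsto_lambertR_rpow hl0 (by linarith)) (tendsto_rpow_zero (by push_cast; linarith)))
  norm_num at h
  exact h

theorem tendsto_curvature_cAnn_quarter :
    Tendsto (fun r => gaussCurvature (cAnn r) (pt r (1 / 4))) (𝓝[>] 0) (𝓝 (-8)) := by
  have h := tendsto_curvature_cAnn (l := 1 / 4) (by norm_num) (by norm_num)
    (tendsto_ellA_div_ellSq 2 one_pos (tendsto_lambertR_rpow (by norm_num) (by norm_num))
    (tendsto_rpow_of_eq_zero (by norm_num)))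
  norm_num at h ⊢
  exact h

theorem tendsto_curvature_cAnn_mid (hl0 : 1 / 4 < l) (hl : l ≤ 1 / 2) :
    Tendsto (fun r => gaussCurvature (cAnn r) (pt r l)) (𝓝[>] 0) atBot := by
  obtain ⟨s, hs, -, hlim⟩ := exists_tendsto_lambertR (by linarith) hl
  have h := tendsto_ellA_div_ellSq_atTop 2 hs hlim (by push_cast; linarith)
  refine ((tendsto_atTop_add_const_left _ 1 h).const_mul_atTop_of_neg
    (show (-4 : ℝ) < 0 by norm_num)).congr' ?_
  filter_upwards [eventually_mem_Ioo_zero_one] with r hr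
  exact (gaussCurvature_cAnn_pt hr (by linarith) (by linarith)).symm

theorem tendsto_curvature_cAnn_reflect (hl0 : 0 < l) (hl1 : l < 1) {f : Filter ℝ}
    (h : Tendsto (fun r => gaussCurvature (cAnn r) (pt r (1 - l))) (𝓝[>] 0) f) :
    Tendsto (fun r => gaussCurvature (cAnn r) (pt r l)) (𝓝[>] 0) f := by
  refine h.congr' ?_
  filter_upwards [eventually_mem_Ioo_zero_one] with r hr
  exact gaussCurvature_cAnn_reflect hr hl0 hl1

/-! #### The curvature of the Szegő metric -/

theorem tendsto_curvature_sAnn_reflect (hl0 : 0 < l) (hl1 : l < 1) {f : Filter ℝ}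
    (h : Tendsto (fun r => gaussCurvature (sAnn r) (pt r (1 - l))) (𝓝[>] 0) f) :
    Tendsto (fun r => gaussCurvature (sAnn r) (pt r l)) (𝓝[>] 0) f := by
  refine h.congr' ?_
  filter_upwards [eventually_mem_Ioo_zero_one] with r hr
  exact gaussCurvature_sAnn_reflect hr hl0 hl1

/-- Numerator and denominator are divided by F¹², the right scale when A/F⁴ stays bounded. The term
with β is isolated since it alone can diverge. -/
theorem gaussCurvature_sAnn_pt_low (hr : 0 < r ∧ r < 1) (hl0 : 0 < l) (hl1 : l < 1) {v : ℝ}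
    (hv : v = ellA r / ellSq r l ^ 2) : gaussCurvature (sAnn r) (pt r l) =
      -2 * ((2 + 18 * v - 18 * v ^ 2 - 2 * v ^ 3) / (1 + v) ^ 3 +
        16 * ellB r / (1 + v) ^ 3 * (ellA r / ellSq r l ^ 3)) := by
  have hw := ellSq_pos hr hl0 hl1
  have hA := ellA_pos hr.1 hr.2
  have h1 : ellSq r l ^ 2 + ellA r ≠ 0 := by positivity
  have h2 : 1 + ellA r / ellSq r l ^ 2 ≠ 0 := by positivity
  rw [gaussCurvature_sAnn_pt hr hl0 hl1, hv]
  field_simp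
  ring

/-- The counterpart for A/F⁴ → ∞: division by A³. The exponent 1 on `ellA r` matches the general
form F^{2n}/A^m of the limit lemmas. -/
theorem gaussCurvature_sAnn_pt_high (hr : 0 < r ∧ r < 1) (hl0 : 0 < l) (hl1 : l < 1) {v : ℝ}
    (hv : v = ellSq r l ^ 2 / ellA r ^ 1) : gaussCurvature (sAnn r) (pt r l) =
      -2 * ((2 * v ^ 3 + 18 * v ^ 2 - 18 * v - 2) / (1 + v) ^ 3 +
        16 * ellB r / (1 + v) ^ 3 * (ellSq r l ^ 3 / ellA r ^ 2)) := by
  have hw := ellSq_pos hr hl0 hl1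
  have hA := ellA_pos hr.1 hr.2
  have h1 : ellSq r l ^ 2 + ellA r ≠ 0 := by positivity
  have h2 : 1 + ellSq r l ^ 2 / ellA r ^ 1 ≠ 0 := by positivity
  rw [gaussCurvature_sAnn_pt hr hl0 hl1, hv]
  field_simp
  ring

theorem tendsto_sAnn_low_aux {v : ℝ → ℝ} {v₀ : ℝ} (hv₀ : 0 ≤ v₀)
    (hv : Tendsto v (𝓝[>] 0) (𝓝 v₀)) :
    Tendsto (fun r => (2 + 18 * v r - 18 * v r ^ 2 - 2 * v r ^ 3) / (1 + v r) ^ 3) (𝓝[>] 0)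
      (𝓝 ((2 + 18 * v₀ - 18 * v₀ ^ 2 - 2 * v₀ ^ 3) / (1 + v₀) ^ 3)) :=
  ((((hv.const_mul 18).const_add 2).sub ((hv.pow 2).const_mul 18)).sub
    ((hv.pow 3).const_mul 2)).div ((hv.const_add 1).pow 3) (by positivity)

theorem tendsto_sAnn_high_aux {v : ℝ → ℝ} {v₀ : ℝ} (hv₀ : 0 ≤ v₀)
    (hv : Tendsto v (𝓝[>] 0) (𝓝 v₀)) :
    Tendsto (fun r => (2 * v r ^ 3 + 18 * v r ^ 2 - 18 * v r - 2) / (1 + v r) ^ 3) (𝓝[>] 0)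
      (𝓝 ((2 * v₀ ^ 3 + 18 * v₀ ^ 2 - 18 * v₀ - 2) / (1 + v₀) ^ 3)) :=
  (((((hv.pow 3).const_mul 2).add ((hv.pow 2).const_mul 18)).sub (hv.const_mul 18)).sub_const
    2).div ((hv.const_add 1).pow 3) (by positivity)

theorem tendsto_ellB_div {v : ℝ → ℝ} {v₀ : ℝ} (hv₀ : 0 ≤ v₀) (hv : Tendsto v (𝓝[>] 0) (𝓝 v₀)) :
    Tendsto (fun r => 16 * ellB r / (1 + v r) ^ 3) (𝓝[>] 0) (𝓝 (16 * (1 / 4) / (1 + v₀) ^ 3)) :=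
  (tendsto_ellB.const_mul 16).div ((hv.const_add 1).pow 3) (by positivity)

theorem tendsto_curvature_sAnn_low {c : ℝ} (hl0 : 0 < l) (hl : l < 1 / 4)
    (hc : Tendsto (fun r : ℝ => r ^ (1 - (3 : ℕ) * (2 * l))) (𝓝[>] 0) (𝓝 c)) :
    Tendsto (fun r => gaussCurvature (sAnn r) (pt r l)) (𝓝[>] 0) (𝓝 (-4 - 8 * c)) := by
  have hs := tendsto_lambertR_rpow hl0 (by linarith : l < 1 / 2)
  have hv := tendsto_ellA_div_ellSq 2 one_pos hs (tendsto_rpow_zero (by push_cast; linarith))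
  rw [mul_zero] at hv
  have h := ((tendsto_sAnn_low_aux le_rfl hv).add ((tendsto_ellB_div le_rfl hv).mul
    (tendsto_ellA_div_ellSq 3 one_pos hs hc))).const_mul (-2)
  have e : -2 * ((2 + 18 * 0 - 18 * 0 ^ 2 - 2 * 0 ^ 3) / (1 + 0) ^ 3 +
      16 * (1 / 4) / (1 + 0) ^ 3 * (1 / 1 ^ (2 * 3) * c)) = -4 - 8 * c := by ring
  rw [e] at h
  refine h.congr' ?_
  filter_upwards [eventually_mem_Ioo_zero_one] with r hr
  exact (gaussCurvature_sAnn_pt_low hr hl0 (by linarith) rfl).symm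

theorem tendsto_curvature_sAnn_high {c s : ℝ} (hl0 : 1 / 4 < l) (hl : l ≤ 1 / 2)
    (hs : Tendsto (fun r : ℝ => lambertR r (r ^ (2 * l))) (𝓝[>] 0) (𝓝 s))
    (hc : Tendsto (fun r : ℝ => r ^ ((3 : ℕ) * (2 * l) - (2 : ℕ))) (𝓝[>] 0) (𝓝 c)) :
    Tendsto (fun r => gaussCurvature (sAnn r) (pt r l)) (𝓝[>] 0) (𝓝 (4 - 8 * (s ^ 6 * c))) := by
  have hv := tendsto_ellSq_div_ellA 2 1 hs (tendsto_rpow_zero (by push_cast; linarith))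
  rw [mul_zero] at hv
  have h := ((tendsto_sAnn_high_aux le_rfl hv).add ((tendsto_ellB_div le_rfl hv).mul
    (tendsto_ellSq_div_ellA 3 2 hs hc))).const_mul (-2)
  have e : -2 * ((2 * 0 ^ 3 + 18 * 0 ^ 2 - 18 * 0 - 2) / (1 + 0) ^ 3 +
      16 * (1 / 4) / (1 + 0) ^ 3 * (s ^ (2 * 3) * c)) = 4 - 8 * (s ^ 6 * c) := by ring
  rw [e] at h
  refine h.congr' ?_
  filter_upwards [eventually_mem_Ioo_zero_one] with r hr
  exact (gaussCurvature_sAnn_pt_high hr (by linarith) (by linarith) rfl).symm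

/-- Up to λ = 1/4 the ratio A/F⁴ has a finite limit (1 at λ = 1/4) while A/F⁶ → ∞; beyond it F⁴/A →
0 while F⁶/A² → ∞. In both cases the divergent term has a positive limiting coefficient before the
factor -2. -/
theorem tendsto_curvature_sAnn_atBot (hl0 : 1 / 6 < l) (hl : l < 1 / 3) :
    Tendsto (fun r => gaussCurvature (sAnn r) (pt r l)) (𝓝[>] 0) atBot := by
  have hs := tendsto_lambertR_rpow (by linarith : 0 < l) (by linarith : l < 1 / 2)
  have h2 : (-2 : ℝ) < 0 := by norm_num
  rcases le_or_gt l (1 / 4) with h4 | h4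
  · obtain ⟨c, hc0, hc⟩ : ∃ c : ℝ, 0 ≤ c ∧
        Tendsto (fun r : ℝ => r ^ (1 - (2 : ℕ) * (2 * l))) (𝓝[>] 0) (𝓝 c) := by
      rcases h4.lt_or_eq with h | h
      · exact ⟨0, le_rfl, tendsto_rpow_zero (by push_cast; linarith)⟩
      · exact ⟨1, zero_le_one, tendsto_rpow_of_eq_zero (by push_cast; linarith)⟩
    have hv := tendsto_ellA_div_ellSq 2 one_pos hs hc
    rw [one_pow, div_one, one_mul] at hv
    have h := ((tendsto_sAnn_low_aux hc0 hv).add_atTop ((tendsto_ellB_div hc0 hv).pos_mul_atTop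
      (by positivity)
      (tendsto_ellA_div_ellSq_atTop 3 one_pos hs (by push_cast; linarith)))).const_mul_atTop_of_neg h2
    refine h.congr' ?_
    filter_upwards [eventually_mem_Ioo_zero_one] with r hr
    exact (gaussCurvature_sAnn_pt_low hr (by linarith) (by linarith) rfl).symm
  · have hv := tendsto_ellSq_div_ellA 2 1 hs (tendsto_rpow_zero (by push_cast; linarith))
    rw [mul_zero] at hv
    have h := ((tendsto_sAnn_high_aux le_rfl hv).add_atTop
      ((tendsto_ellB_div le_rfl hv).pos_mul_atTop (by norm_num)
      (tendsto_ellSq_div_ellA_atTop 3 2 one_pos hs (by push_cast; linarith)))).const_mul_atTop_of_neg h2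
    refine h.congr' ?_
    filter_upwards [eventually_mem_Ioo_zero_one] with r hr
    exact (gaussCurvature_sAnn_pt_high hr (by linarith) (by linarith) rfl).symm

theorem tendsto_curvature_sAnn_sixth :
    Tendsto (fun r => gaussCurvature (sAnn r) (pt r (1 / 6))) (𝓝[>] 0) (𝓝 (-12)) := by
  have h := tendsto_curvature_sAnn_low (l := 1 / 6) (by norm_num) (by norm_num)
    (tendsto_rpow_of_eq_zero (by norm_num))
  norm_num at h ⊢
  exact h

theorem tendsto_curvature_sAnn_neg_four (hl0 : 0 < l) (hl : l < 1 / 6) :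
    Tendsto (fun r => gaussCurvature (sAnn r) (pt r l)) (𝓝[>] 0) (𝓝 (-4)) := by
  have h := tendsto_curvature_sAnn_low hl0 (by linarith)
    (tendsto_rpow_zero (by push_cast; linarith))
  rwa [mul_zero, sub_zero] at h

theorem tendsto_curvature_sAnn_third :
    Tendsto (fun r => gaussCurvature (sAnn r) (pt r (1 / 3))) (𝓝[>] 0) (𝓝 (-4)) := by
  have h := tendsto_curvature_sAnn_high (l := 1 / 3) (by norm_num) (by norm_num)
    (tendsto_lambertR_rpow (by norm_num) (by norm_num)) (tendsto_rpow_of_eq_zero (by norm_num))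
  norm_num at h ⊢
  exact h

theorem tendsto_curvature_sAnn_four (hl0 : 1 / 3 < l) (hl : l ≤ 1 / 2) :
    Tendsto (fun r => gaussCurvature (sAnn r) (pt r l)) (𝓝[>] 0) (𝓝 4) := by
  obtain ⟨s, -, -, hs⟩ := exists_tendsto_lambertR (by linarith) hl
  have h := tendsto_curvature_sAnn_high (by linarith) hl hs
    (tendsto_rpow_zero (by push_cast; linarith))
  rwa [mul_zero, mul_zero, sub_zero] at h

/-! #### The Szegő metric -/

theorem tendsto_sAnn {c : ℝ} (hl0 : 0 < l) (hl : l < 1 / 2)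
    (hc : Tendsto (fun r : ℝ => r ^ (1 - 4 * l)) (𝓝[>] 0) (𝓝 c)) :
    Tendsto (fun r => sAnn r (pt r l)) (𝓝[>] 0) (𝓝 (√(1 + c))) := by
  have hs := (tendsto_lambertR_rpow hl0 hl).pow 2
  have h := (hs.add ((tendsto_ellA_div.mul hc).div hs (by norm_num))).sqrt
  rw [one_pow, one_mul, div_one] at h
  refine h.congr' ?_
  filter_upwards [eventually_mem_Ioo_zero_one] with r hr
  exact (sAnn_pt hr hl0 (by linarith)).symm

/-- Up to λ = 1/2 the second summand under the root diverges; beyond it the first one does, and the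
second is nonnegative. -/
theorem tendsto_sAnn_atTop (hl0 : 1 / 4 < l) (hl1 : l < 1) :
    Tendsto (fun r => sAnn r (pt r l)) (𝓝[>] 0) atTop := by
  have hsq : Tendsto (fun r : ℝ => lambertR r (r ^ (2 * l)) ^ 2 +
      ellA r / r * r ^ (1 - 4 * l) / lambertR r (r ^ (2 * l)) ^ 2) (𝓝[>] 0) atTop := by
    rcases le_or_gt l (1 / 2) with h | h
    · obtain ⟨s, hs0, -, hs⟩ := exists_tendsto_lambertR (by linarith) h
      have h1 := (tendsto_ellA_div.div (hs.pow 2) (by positivity)).pos_mul_atTop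
        (show 0 < 1 / s ^ 2 by positivity)
        (tendsto_rpow_neg_nhdsGT_zero (y := 1 - 4 * l) (by linarith))
      refine ((hs.pow 2).add_atTop h1).congr fun r => ?_
      simp only [Pi.div_apply]
      ring
    · have h1 := (tendsto_pow_atTop (α := ℝ) two_ne_zero).comp (tendsto_lambertR_atTop h hl1)
      refine tendsto_atTop_mono' _ ?_ h1
      filter_upwards [eventually_mem_Ioo_zero_one] with r hr
      have h2 := ellA_pos hr.1 hr.2
      have h3 := Real.rpow_pos_of_pos hr.1 (1 - 4 * l)
      have h4 := hr.1
      have h5 := lambertR_rpow_pos hr (by linarith) hl1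
      simp only [Function.comp_apply]
      have : 0 ≤ ellA r / r * r ^ (1 - 4 * l) / lambertR r (r ^ (2 * l)) ^ 2 := by positivity
      linarith
  refine (Real.tendsto_sqrt_atTop.comp hsq).congr' ?_
  filter_upwards [eventually_mem_Ioo_zero_one] with r hr
  exact (sAnn_pt hr (by linarith) hl1).symm

/-! #### The Carathéodory metric -/

theorem tendsto_cAnn {f : Filter ℝ} (hl0 : 0 < l) (hl1 : l < 1)
    (h : Tendsto (fun r : ℝ => lambertR r (r ^ (2 * l))) (𝓝[>] 0) f) :
    Tendsto (fun r => cAnn r (pt r l)) (𝓝[>] 0) f := by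
  refine h.congr' ?_
  filter_upwards [eventually_mem_Ioo_zero_one] with r hr
  exact (cAnn_pt hr hl0 hl1).symm

end

end PlanarMetric

end

/-! ### Assembly of the limits, with the upper range of λ in the curvatures obtained by reflection
-/

theorem theorem1p6 (l : ℝ) (hl₀ : 0 < l) (hl₁ : l < 1) :
    -- (a) the Carathéodory metric and the Szegő kernel
    ((∀ r : ℝ, 0 < r → r < 1 →
        PlanarMetric.cAnn r (PlanarMetric.pt r l) =
          2 * Real.pi * PlanarMetric.SAnn r (PlanarMetric.pt r l)) ∧
      (l < 1 / 2 →
        Tendsto (fun r : ℝ => PlanarMetric.cAnn r (PlanarMetric.pt r l)) (𝓝[>] 0) (𝓝 1)) ∧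
      (l = 1 / 2 →
        Tendsto (fun r : ℝ => PlanarMetric.cAnn r (PlanarMetric.pt r l)) (𝓝[>] 0) (𝓝 2)) ∧
      (1 / 2 < l →
        Tendsto (fun r : ℝ => PlanarMetric.cAnn r (PlanarMetric.pt r l)) (𝓝[>] 0) atTop)) ∧
    -- (b) the Szegő metric
    ((l < 1 / 4 →
        Tendsto (fun r : ℝ => PlanarMetric.sAnn r (PlanarMetric.pt r l)) (𝓝[>] 0) (𝓝 1)) ∧
      (l = 1 / 4 →
        Tendsto (fun r : ℝ => PlanarMetric.sAnn r (PlanarMetric.pt r l)) (𝓝[>] 0) (𝓝 (√2))) ∧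
      (1 / 4 < l →
        Tendsto (fun r : ℝ => PlanarMetric.sAnn r (PlanarMetric.pt r l)) (𝓝[>] 0) atTop)) ∧
    -- (c) the Gaussian curvature of the Carathéodory metric
    ((l < 1 / 4 →
        Tendsto (fun r : ℝ => PlanarMetric.gaussCurvature (PlanarMetric.cAnn r)
          (PlanarMetric.pt r l)) (𝓝[>] 0) (𝓝 (-4))) ∧
      (l = 1 / 4 →
        Tendsto (fun r : ℝ => PlanarMetric.gaussCurvature (PlanarMetric.cAnn r)
          (PlanarMetric.pt r l)) (𝓝[>] 0) (𝓝 (-8))) ∧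
      (1 / 4 < l → l < 3 / 4 →
        Tendsto (fun r : ℝ => PlanarMetric.gaussCurvature (PlanarMetric.cAnn r)
          (PlanarMetric.pt r l)) (𝓝[>] 0) atBot) ∧
      (l = 3 / 4 →
        Tendsto (fun r : ℝ => PlanarMetric.gaussCurvature (PlanarMetric.cAnn r)
          (PlanarMetric.pt r l)) (𝓝[>] 0) (𝓝 (-8))) ∧
      (3 / 4 < l →
        Tendsto (fun r : ℝ => PlanarMetric.gaussCurvature (PlanarMetric.cAnn r)
          (PlanarMetric.pt r l)) (𝓝[>] 0) (𝓝 (-4)))) ∧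
    -- (d) the Gaussian curvature of the Szegő metric
    ((l < 1 / 6 →
        Tendsto (fun r : ℝ => PlanarMetric.gaussCurvature (PlanarMetric.sAnn r)
          (PlanarMetric.pt r l)) (𝓝[>] 0) (𝓝 (-4))) ∧
      (l = 1 / 6 →
        Tendsto (fun r : ℝ => PlanarMetric.gaussCurvature (PlanarMetric.sAnn r)
          (PlanarMetric.pt r l)) (𝓝[>] 0) (𝓝 (-12))) ∧
      (1 / 6 < l → l < 1 / 3 →
        Tendsto (fun r : ℝ => PlanarMetric.gaussCurvature (PlanarMetric.sAnn r)
          (PlanarMetric.pt r l)) (𝓝[>] 0) atBot) ∧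
      (l = 1 / 3 →
        Tendsto (fun r : ℝ => PlanarMetric.gaussCurvature (PlanarMetric.sAnn r)
          (PlanarMetric.pt r l)) (𝓝[>] 0) (𝓝 (-4))) ∧
      (1 / 3 < l → l < 2 / 3 →
        Tendsto (fun r : ℝ => PlanarMetric.gaussCurvature (PlanarMetric.sAnn r)
          (PlanarMetric.pt r l)) (𝓝[>] 0) (𝓝 4)) ∧
      (l = 2 / 3 →
        Tendsto (fun r : ℝ => PlanarMetric.gaussCurvature (PlanarMetric.sAnn r)
          (PlanarMetric.pt r l)) (𝓝[>] 0) (𝓝 (-4))) ∧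
      (2 / 3 < l → l < 5 / 6 →
        Tendsto (fun r : ℝ => PlanarMetric.gaussCurvature (PlanarMetric.sAnn r)
          (PlanarMetric.pt r l)) (𝓝[>] 0) atBot) ∧
      (l = 5 / 6 →
        Tendsto (fun r : ℝ => PlanarMetric.gaussCurvature (PlanarMetric.sAnn r)
          (PlanarMetric.pt r l)) (𝓝[>] 0) (𝓝 (-12))) ∧
      (5 / 6 < l →
        Tendsto (fun r : ℝ => PlanarMetric.gaussCurvature (PlanarMetric.sAnn r)
          (PlanarMetric.pt r l)) (𝓝[>] 0) (𝓝 (-4)))) := by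
  refine ⟨⟨?_, ?_, ?_, ?_⟩, ⟨?_, ?_, ?_⟩, ⟨?_, ?_, ?_, ?_, ?_⟩,
    ⟨?_, ?_, ?_, ?_, ?_, ?_, ?_, ?_, ?_⟩⟩
  · exact fun r h0 h1 => PlanarMetric.cAnn_pt_eq_SAnn ⟨h0, h1⟩ hl₀ hl₁
  · exact fun h => PlanarMetric.tendsto_cAnn hl₀ hl₁ (PlanarMetric.tendsto_lambertR_rpow hl₀ h)
  · rintro rfl
    refine PlanarMetric.tendsto_cAnn hl₀ hl₁ ?_
    norm_num
    exact PlanarMetric.tendsto_lambertR_self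
  · exact fun h => PlanarMetric.tendsto_cAnn hl₀ hl₁ (PlanarMetric.tendsto_lambertR_atTop h hl₁)
  · intro h
    have := PlanarMetric.tendsto_sAnn hl₀ (by linarith)
      (PlanarMetric.tendsto_rpow_zero (e := 1 - 4 * l) (by linarith))
    rwa [add_zero, Real.sqrt_one] at this
  · intro h
    have := PlanarMetric.tendsto_sAnn hl₀ (by linarith)
      (PlanarMetric.tendsto_rpow_of_eq_zero (e := 1 - 4 * l) (by linarith))
    rwa [one_add_one_eq_two] at this
  · exact fun h => PlanarMetric.tendsto_sAnn_atTop h hl₁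
  · exact fun h => PlanarMetric.tendsto_curvature_cAnn_low hl₀ h
  · rintro rfl
    exact PlanarMetric.tendsto_curvature_cAnn_quarter
  · intro h1 h2
    rcases le_total l (1 / 2) with h | h
    · exact PlanarMetric.tendsto_curvature_cAnn_mid h1 h
    · exact PlanarMetric.tendsto_curvature_cAnn_reflect hl₀ hl₁
        (PlanarMetric.tendsto_curvature_cAnn_mid (by linarith) (by linarith))
  · rintro rfl
    refine PlanarMetric.tendsto_curvature_cAnn_reflect hl₀ hl₁ ?_
    rw [show (1 - 3 / 4 : ℝ) = 1 / 4 by norm_num]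
    exact PlanarMetric.tendsto_curvature_cAnn_quarter
  · exact fun h => PlanarMetric.tendsto_curvature_cAnn_reflect hl₀ hl₁
      (PlanarMetric.tendsto_curvature_cAnn_low (by linarith) (by linarith))
  · exact fun h => PlanarMetric.tendsto_curvature_sAnn_neg_four hl₀ h
  · rintro rfl
    exact PlanarMetric.tendsto_curvature_sAnn_sixth
  · exact fun h1 h2 => PlanarMetric.tendsto_curvature_sAnn_atBot h1 h2
  · rintro rfl
    exact PlanarMetric.tendsto_curvature_sAnn_third
  · intro h1 h2
    rcases le_total l (1 / 2) with h | h
    · exact PlanarMetric.tendsto_curvature_sAnn_four h1 h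
    · exact PlanarMetric.tendsto_curvature_sAnn_reflect hl₀ hl₁
        (PlanarMetric.tendsto_curvature_sAnn_four (by linarith) (by linarith))
  · rintro rfl
    refine PlanarMetric.tendsto_curvature_sAnn_reflect hl₀ hl₁ ?_
    rw [show (1 - 2 / 3 : ℝ) = 1 / 3 by norm_num]
    exact PlanarMetric.tendsto_curvature_sAnn_third
  · exact fun h1 h2 => PlanarMetric.tendsto_curvature_sAnn_reflect hl₀ hl₁
      (PlanarMetric.tendsto_curvature_sAnn_atBot (by linarith) (by linarith))
  · rintro rfl
    refine PlanarMetric.tendsto_curvature_sAnn_reflect hl₀ hl₁ ?_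
    rw [show (1 - 5 / 6 : ℝ) = 1 / 6 by norm_num]
    exact PlanarMetric.tendsto_curvature_sAnn_sixth
  · exact fun h => PlanarMetric.tendsto_curvature_sAnn_reflect hl₀ hl₁
      (PlanarMetric.tendsto_curvature_sAnn_neg_four (by linarith) (by linarith))
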